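/- Let $[\cdot,\cdot]$ be the standard determinant on $\mathbb{R}^2$. For a smooth, closed, embedded, positively oriented, strictly convex curve $\gamma:S^1\to\mathbb{R}^2$, $S^1=\mathbb{R}/2\pi\mathbb{Z}$ (so $[\gamma_x,\gamma_{xx}]>0$), let $g=[\gamma_x,\gamma_{xx}]^{1/3}$ be the equi-affine metric, $ds=g\,dx$ the equi-affine arc-length element, $\partial_s=g^{-1}\partial_x$, $\mathcal{N}=\gamma_{ss}$ the equi-affine normal, $\mathcal{K}=[\gamma_{ss},\gamma_{sss}]$ the equi-affine curvature, $\sigma=[\gamma,\gamma_s]$ the affine support function, and $\sigma_{s^n}=\partial_s^n\sigma$. Proposition (energy estimate). Let $\gamma_0:S^1\to\mathbb{R}^2$ be a smooth, closed, embedded, strictly convex curve symmetric about the origin, and let $n\ge 1$ be an integer. There is a constant $C>0$, depending only on $n$ and $\gamma_0$, such that for every $T\in(0,\infty]$ and every solution $\gamma\in C^\infty(S^1\times[0,T))$ of $$\frac{\partial\gamma}{\partial t}=(1-\sigma\mathcal{K})\,\mathcal{N},\qquad \gamma(\cdot,0)=\gamma_0,$$ all of whose curves $\gamma(\cdot,t)$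 are closed, embedded, strictly convex and symmetric about the origin, the function $t\mapsto\oint\sigma_{s^n}^2\,ds$ is differentiable on $[0,T)$ (one-sidedly at $t=0$) and $$\frac{d}{dt}\oint\sigma_{s^n}^2\,ds\le C\bigl(E+E^{2n+3}\bigr)\quad\text{for all }t\in[0,T),\qquad\text{where } E(t)=\oint\sigma_s^2\,ds .$$ -/

import Mathlib

open Set
open scoped ContDiff

noncomputable section

namespace EquiAffine

/-- The plane `ℝ²`. -/
abbrev Plane : Type := EuclideanSpace ℝ (Fin 2)

/-- The standard determinant `[u, v]` on the plane. -/
def bracket (u v : Plane) : ℝ := u 0 * v 1 - u 1 * v 0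

/-- A smooth closed curve `S¹ → ℝ²`, `S¹ = ℝ / 2πℤ`, which is embedded and strictly convex
(positively oriented, with nowhere vanishing curvature). -/
structure IsStrictlyConvexCurve (γ : ℝ → Plane) : Prop where
  smooth : ContDiff ℝ ∞ γ
  periodic : Function.Periodic γ (2 * Real.pi)
  embedded : InjOn γ (Ico 0 (2 * Real.pi))
  convex : ∀ x, 0 < bracket (deriv γ x) (deriv (deriv γ) x)

/-- The curve, as a subset of the plane, is symmetric about the origin. -/
def IsOriginSymmetric (γ : ℝ → Plane) : Prop := ∀ x, -γ x ∈ range γ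

/-- The equi-affine metric `g = [γ_x, γ_xx]^(1/3)`. -/
def metric (γ : ℝ → Plane) (x : ℝ) : ℝ :=
  bracket (deriv γ x) (deriv (deriv γ) x) ^ (1 / 3 : ℝ)

/-- The derivative `∂_s = g⁻¹ ∂_x` with respect to the equi-affine arc length of `γ`. -/
def arcDeriv {V : Type} [NormedAddCommGroup V] [NormedSpace ℝ V]
    (γ : ℝ → Plane) (f : ℝ → V) (x : ℝ) : V :=
  (metric γ x)⁻¹ • deriv f x

/-- The integral `∮ f ds` over one period, where `ds = g dx`. -/
def arcIntegral (γ : ℝ → Plane) (f : ℝ → ℝ) : ℝ :=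
  ∫ x in (0 : ℝ)..(2 * Real.pi), f x * metric γ x

/-- The equi-affine tangent vector `γ_s`. -/
def tangent (γ : ℝ → Plane) : ℝ → Plane := arcDeriv γ γ

/-- The equi-affine normal vector `γ_ss`. -/
def normal (γ : ℝ → Plane) : ℝ → Plane := arcDeriv γ (tangent γ)

/-- The equi-affine curvature `[γ_ss, γ_sss]`. -/
def curvature (γ : ℝ → Plane) (x : ℝ) : ℝ := bracket (normal γ x) (arcDeriv γ (normal γ) x)

/-- The affine support function `σ = [γ, γ_s]`. -/
def support (γ : ℝ → Plane) (x : ℝ) : ℝ := bracket (γ x) (tangent γ x)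

/-- The `n`-th arc length derivative `σ_{s^n}` of the affine support function. -/
def supportDeriv (γ : ℝ → Plane) (n : ℕ) : ℝ → ℝ := (arcDeriv γ)^[n] (support γ)

/-- The energy of order `n`, `∮ (σ_{s^n})² ds`. -/
def energy (n : ℕ) (γ : ℝ → Plane) : ℝ := arcIntegral γ (fun x => supportDeriv γ n x ^ 2)

/-- The time interval `[0, T)`, where `T = ∞` is allowed. -/
def timeInterval (T : EReal) : Set ℝ := {t | 0 ≤ t ∧ (t : EReal) < T}

/-- `γ t x` (time `t ∈ [0, T)`, parameter `x`) is a smooth, strictly convex, origin-symmetric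
solution of `γ_t = (1 - σ 𝒦) 𝒩` with initial curve `γ₀`. -/
structure IsFlow (γ₀ : ℝ → Plane) (T : EReal) (γ : ℝ → ℝ → Plane) : Prop where
  smooth : ContDiffOn ℝ ∞ (fun p : ℝ × ℝ => γ p.1 p.2) (timeInterval T ×ˢ univ)
  strictlyConvex : ∀ t ∈ timeInterval T, IsStrictlyConvexCurve (γ t)
  symmetric : ∀ t ∈ timeInterval T, IsOriginSymmetric (γ t)
  evolution : ∀ t ∈ timeInterval T, ∀ x, HasDerivWithinAt (fun τ => γ τ x)
    ((1 - support (γ t) x * curvature (γ t) x) • normal (γ t) x) (timeInterval T) t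
  initial : γ 0 = γ₀

end EquiAffine

end

open Set
open scoped ContDiff

noncomputable section

namespace EquiAffine

/-! Since `σ_ss = 1 - σ𝒦` (`deriv_deriv_support`), the flow reads `γ_t = σ_ss γ_ss`. Differentiating
`σ = [γ, γ_s]` and the constraint `[γ_s, γ_ss] = 1` in time yields a fourth-order parabolic equation
for `σ` and a formula for the rate of change of `ds`, both polynomial in `1/σ`, `σ` and its
arc-length derivatives (`SupportData`, `IsFlow.supportData`).

Uniform bounds. The area `∮ σ ds` is conserved, and the polar area `B = ∮ σ⁻² ds` satisfies `B' = 6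
∮ σ_s² σ⁻⁴ ds ≥ 0`. A weak Blaschke-Santaló inequality (`integral_mul_integral_le`) keeps their
product below 64, so `B` is increasing and bounded. Completing squares gives `E' ≤ 6 ∮ σ_s² σ⁻¹ ds`,
while `σ³ ≤ c (1 + E)`; hence `log (1 + E) - c B` is nonincreasing and `E` stays bounded in terms of
`γ₀` (`energy_one_le`). The oscillation of `log σ` is then controlled, which bounds `σ` from below
and the length from above.

Higher energies. The norms `‖σ_{s^(k+1)}‖` are log-convex in `k`, hence lie below a geometric
sequence `e μ^(2k)`, where `e² = E`, with equality at order `m + 4` when `n = m + 2`. On this scale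
a derivative costs `μ²`, and a sup norm instead of an `L²` norm costs `μ`. The dissipation `∮ σ
(σ_{s^(m+4)})² ds` is at least of size `e² μ^(4m+12)`, the errors at most of size `e² μ^(4m+11)`:
for large `μ` the energy decreases, otherwise its derivative is at most `C e²`. This proves the
stronger bound `C E`; for `n = 1` it follows directly from `E' ≤ 6 ∮ σ_s² σ⁻¹ ds` and the lower
bound of `σ`.

The convex geometry needs one global input: an embedded, locally convex closed curve has turning
number one (`turning_eq_one`), so that it lies on one side of each tangent. -/

/-! ### Abstract calculus on a closed curve -/

/-- The algebra of smooth `2π`-periodic real functions. -/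
def SmoothPeriodic : Subalgebra ℝ (ℝ → ℝ) where
  carrier := {f | ContDiff ℝ ∞ f ∧ Function.Periodic f (2 * Real.pi)}
  mul_mem' hf hg := ⟨hf.1.mul hg.1, hf.2.mul hg.2⟩
  add_mem' hf hg := ⟨hf.1.add hg.1, hf.2.add hg.2⟩
  algebraMap_mem' _ := ⟨contDiff_const, fun _ => rfl⟩

namespace SmoothPeriodic

instance : CoeFun SmoothPeriodic (fun _ => ℝ → ℝ) := ⟨fun f => f.1⟩

@[simp] lemma mul_apply (f h : SmoothPeriodic) (x : ℝ) : (f * h) x = f x * h x := rfl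
@[simp] lemma add_apply (f h : SmoothPeriodic) (x : ℝ) : (f + h) x = f x + h x := rfl
@[simp] lemma sub_apply (f h : SmoothPeriodic) (x : ℝ) : (f - h) x = f x - h x := rfl
@[simp] lemma neg_apply (f : SmoothPeriodic) (x : ℝ) : (-f) x = -f x := rfl
@[simp] lemma smul_apply (c : ℝ) (f : SmoothPeriodic) (x : ℝ) : (c • f) x = c * f x := rfl
@[simp] lemma one_apply (x : ℝ) : (1 : SmoothPeriodic) x = 1 := rfl
@[simp] lemma pow_apply (f : SmoothPeriodic) (n : ℕ) (x : ℝ) : (f ^ n) x = f x ^ n := rfl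

lemma exists_forall_le (f : SmoothPeriodic) : ∃ x, ∀ y, f y ≤ f x := by
  obtain ⟨x, -, hx⟩ := isCompact_Icc.exists_isMaxOn (s := Icc 0 (2 * Real.pi))
    (nonempty_Icc.2 (by positivity)) f.2.1.continuous.continuousOn
  refine ⟨x, fun y => ?_⟩
  obtain ⟨z, hz, hyz⟩ := f.2.2.exists_mem_Ico₀ (by positivity) y
  rw [hyz]
  exact hx (Ico_subset_Icc_self hz)

lemma exists_forall_ge (f : SmoothPeriodic) : ∃ x, ∀ y, f x ≤ f y := by
  obtain ⟨x, hx⟩ := exists_forall_le (-f)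
  exact ⟨x, fun y => by simpa using hx y⟩

end SmoothPeriodic

/-- Differentiation and integration along a closed curve: a derivation and a positive linear
functional on smooth periodic functions, related by the fundamental theorem of calculus. -/
structure ArcCalculus (D : Derivation ℝ SmoothPeriodic SmoothPeriodic)
    (I : SmoothPeriodic →ₗ[ℝ] ℝ) : Prop where
  integral_deriv : ∀ f, I (D f) = 0
  integral_nonneg : ∀ f : SmoothPeriodic, (∀ x, 0 ≤ f x) → 0 ≤ I f
  exists_zero : ∀ f, ∃ x, (D f) x = 0
  abs_sub_le : ∀ f h : SmoothPeriodic, (∀ x, |(D f) x| ≤ h x) → ∀ x y, |f x - f y| ≤ I h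

/-- The `L²` norm attached to a positive functional. -/
def l2norm (I : SmoothPeriodic →ₗ[ℝ] ℝ) (f : SmoothPeriodic) : ℝ := √(I (f * f))

/-- The optimal weight is `δ = q / p`; replacing `p, q` by `p + ε, q + ε` covers vanishing values.
This converts weighted Young inequalities into product inequalities. -/
lemma le_two_mul_of_forall_le {z p q : ℝ} (hp : 0 ≤ p) (hq : 0 ≤ q)
    (h : ∀ δ : ℝ, 0 < δ → z ≤ δ * p ^ 2 + δ⁻¹ * q ^ 2) : z ≤ 2 * p * q := by
  have key : ∀ ε : ℝ, 0 < ε → z ≤ 2 * (p + ε) * (q + ε) := by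
    intro ε hε
    have h1 := h ((q + ε) / (p + ε)) (by positivity)
    have h2 : (q + ε) / (p + ε) * p ^ 2 ≤ (q + ε) / (p + ε) * (p + ε) ^ 2 := by gcongr; linarith
    have h3 : ((q + ε) / (p + ε))⁻¹ * q ^ 2 ≤ ((q + ε) / (p + ε))⁻¹ * (q + ε) ^ 2 := by
      gcongr; linarith
    have h4 : (q + ε) / (p + ε) * (p + ε) ^ 2 + ((q + ε) / (p + ε))⁻¹ * (q + ε) ^ 2
        = 2 * (p + ε) * (q + ε) := by
      have : p + ε ≠ 0 := by positivity
      have : q + ε ≠ 0 := by positivity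
      field_simp; ring
    linarith
  have lim : Filter.Tendsto (fun ε : ℝ => 2 * (p + ε) * (q + ε)) (nhdsWithin 0 (Ioi 0))
      (nhds (2 * (p + 0) * (q + 0))) :=
    ((by fun_prop : Continuous (fun ε : ℝ => 2 * (p + ε) * (q + ε))).tendsto 0).mono_left
      nhdsWithin_le_nhds
  simpa using ge_of_tendsto lim (Filter.eventually_of_mem self_mem_nhdsWithin key)

namespace ArcCalculus

variable {D : Derivation ℝ SmoothPeriodic SmoothPeriodic} {I : SmoothPeriodic →ₗ[ℝ] ℝ}

lemma integral_mono (h : ArcCalculus D I) {f k : SmoothPeriodic} (hfk : ∀ x, f x ≤ k x) :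
    I f ≤ I k := by
  have := h.integral_nonneg (k - f) (fun x => by simpa using hfk x)
  rw [map_sub] at this
  linarith

lemma integral_mul_self_nonneg (h : ArcCalculus D I) (f : SmoothPeriodic) : 0 ≤ I (f * f) :=
  h.integral_nonneg _ fun x => mul_self_nonneg (f x)

lemma l2norm_sq (h : ArcCalculus D I) (f : SmoothPeriodic) : l2norm I f ^ 2 = I (f * f) :=
  Real.sq_sqrt (h.integral_mul_self_nonneg f)

lemma l2norm_nonneg (f : SmoothPeriodic) : 0 ≤ l2norm I f := Real.sqrt_nonneg _

lemma integral_mul_le (h : ArcCalculus D I) (f k : SmoothPeriodic) :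
    I (f * k) ≤ l2norm I f * l2norm I k := by
  have : 2 * I (f * k) ≤ 2 * l2norm I f * l2norm I k := by
    refine le_two_mul_of_forall_le (l2norm_nonneg f) (l2norm_nonneg k) fun δ hδ => ?_
    rw [h.l2norm_sq, h.l2norm_sq]
    have := h.integral_mono (f := (2 : ℝ) • (f * k)) (k := δ • (f * f) + δ⁻¹ • (k * k))
      (fun x => by
        simp only [SmoothPeriodic.smul_apply, SmoothPeriodic.add_apply, SmoothPeriodic.mul_apply]
        have h0 : 0 ≤ δ⁻¹ * (δ * f x - k x) ^ 2 := by positivity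
        have h1 : δ⁻¹ * (δ * f x - k x) ^ 2
            = δ * (f x * f x) + δ⁻¹ * (k x * k x) - 2 * (f x * k x) := by
          field_simp; ring
        linarith)
    simpa using this
  linarith

lemma l2norm_smul (I : SmoothPeriodic →ₗ[ℝ] ℝ) (c : ℝ) (f : SmoothPeriodic) :
    l2norm I (c • f) = |c| * l2norm I f := by
  rw [l2norm, smul_mul_smul_comm, map_smul, smul_eq_mul, ← sq, Real.sqrt_mul (sq_nonneg c),
    Real.sqrt_sq_eq_abs, l2norm]

lemma abs_integral_mul_le (h : ArcCalculus D I) (f k : SmoothPeriodic) :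
    |I (f * k)| ≤ l2norm I f * l2norm I k := by
  rw [abs_le]
  refine ⟨?_, h.integral_mul_le f k⟩
  have h1 := h.integral_mul_le ((-1 : ℝ) • f) k
  have h2 : l2norm I ((-1 : ℝ) • f) = l2norm I f := by rw [l2norm_smul]; simp
  rw [h2, smul_mul_assoc, map_smul, smul_eq_mul] at h1
  linarith

lemma l2norm_le_of_integral_le (h : ArcCalculus D I) {f : SmoothPeriodic} {B : ℝ} (hB : 0 ≤ B)
    (hf : I (f * f) ≤ B ^ 2) : l2norm I f ≤ B := by
  rw [← h.l2norm_sq] at hf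
  exact abs_le_of_sq_le_sq' hf hB |>.2

lemma l2norm_add_le (h : ArcCalculus D I) (f k : SmoothPeriodic) :
    l2norm I (f + k) ≤ l2norm I f + l2norm I k := by
  refine h.l2norm_le_of_integral_le (add_nonneg (l2norm_nonneg _) (l2norm_nonneg _)) ?_
  have : I ((f + k) * (f + k)) = I (f * f) + 2 * I (f * k) + I (k * k) := by
    rw [show (f + k) * (f + k) = f * f + (2 : ℝ) • (f * k) + k * k by rw [two_smul]; ring]
    simp
  rw [this, add_sq, h.l2norm_sq, h.l2norm_sq]
  linarith [h.integral_mul_le f k]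

lemma l2norm_mul_le (h : ArcCalculus D I) {f k : SmoothPeriodic} {A : ℝ}
    (hf : ∀ x, |f x| ≤ A) : l2norm I (f * k) ≤ A * l2norm I k := by
  have hA : 0 ≤ A := (abs_nonneg _).trans (hf 0)
  refine h.l2norm_le_of_integral_le (mul_nonneg hA (l2norm_nonneg _)) ?_
  rw [mul_pow, h.l2norm_sq]
  have := h.integral_mono (f := f * k * (f * k)) (k := (A ^ 2) • (k * k)) fun x => by
    simp only [SmoothPeriodic.smul_apply, SmoothPeriodic.mul_apply]
    have h1 : f x * f x ≤ A ^ 2 := by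
      rw [← sq]; exact sq_le_sq' (by linarith [neg_abs_le (f x), hf x]) ((le_abs_self _).trans (hf x))
    nlinarith [mul_self_nonneg (k x)]
  simpa using this

lemma integral_mul_deriv (h : ArcCalculus D I) (f k : SmoothPeriodic) :
    I (f * D k) = -I (D f * k) := by
  have := h.integral_deriv (f * k)
  rw [Derivation.leibniz, map_add, smul_eq_mul, smul_eq_mul, mul_comm k] at this
  linarith

/-- Integration by parts and Cauchy-Schwarz. Applied to iterated derivatives, this is the
log-convexity of their norms. -/
lemma l2norm_deriv_sq_le (h : ArcCalculus D I) (f : SmoothPeriodic) :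
    l2norm I (D f) ^ 2 ≤ l2norm I f * l2norm I (D (D f)) := by
  rw [h.l2norm_sq]
  have h1 : I (D f * D f) = -I (f * D (D f)) := by
    rw [h.integral_mul_deriv f (D f)]; ring
  rw [h1]
  exact (neg_le_abs _).trans (h.abs_integral_mul_le _ _)

/-- Agmon's inequality: `D f` vanishes somewhere, so `(D f)²` is at most the integral of `2 |D f| |D
(D f)|`, to which Young's inequality with weight `δ` applies. -/
lemma sq_apply_deriv_le (h : ArcCalculus D I) (f : SmoothPeriodic) (x : ℝ) :
    (D f) x ^ 2 ≤ 2 * l2norm I (D f) * l2norm I (D (D f)) := by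
  obtain ⟨y, hy⟩ := h.exists_zero f
  refine le_two_mul_of_forall_le (l2norm_nonneg _) (l2norm_nonneg _) fun δ hδ => ?_
  rw [h.l2norm_sq, h.l2norm_sq]
  have := h.abs_sub_le (D f * D f) (δ • (D f * D f) + δ⁻¹ • (D (D f) * D (D f)))
    (fun z => by
      rw [Derivation.leibniz]
      simp only [smul_eq_mul, SmoothPeriodic.smul_apply, SmoothPeriodic.add_apply,
        SmoothPeriodic.mul_apply]
      set p := (D f) z
      set q := (D (D f)) z
      have h0 : 0 ≤ δ⁻¹ * (δ * p - q) ^ 2 := by positivity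
      have h0' : 0 ≤ δ⁻¹ * (δ * p + q) ^ 2 := by positivity
      have h1 : δ⁻¹ * (δ * p - q) ^ 2 = δ * (p * p) + δ⁻¹ * (q * q) - 2 * (p * q) := by
        field_simp; ring
      have h2 : δ⁻¹ * (δ * p + q) ^ 2 = δ * (p * p) + δ⁻¹ * (q * q) + 2 * (p * q) := by
        field_simp; ring
      rw [abs_le]; constructor <;> linarith) x y
  have h3 := (le_abs_self _).trans this
  simp only [SmoothPeriodic.mul_apply, hy, map_add, map_smul, smul_eq_mul] at h3
  nlinarith

lemma integral_one_nonneg (h : ArcCalculus D I) : 0 ≤ I 1 :=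
  h.integral_nonneg _ fun _ => zero_le_one

/-- Poincaré's inequality, from integrating the pointwise bound of `(D f)²` over the curve of length
`I 1`. -/
lemma l2norm_deriv_le (h : ArcCalculus D I) (f : SmoothPeriodic) :
    l2norm I (D f) ≤ 2 * I 1 * l2norm I (D (D f)) := by
  have h1 : I (D f * D f) ≤ I ((2 * l2norm I (D f) * l2norm I (D (D f))) • 1) :=
    h.integral_mono fun x => by
      simpa [sq] using h.sq_apply_deriv_le f x
  rw [map_smul, smul_eq_mul, ← h.l2norm_sq] at h1
  rcases (l2norm_nonneg (I := I) (D f)).eq_or_lt with h0 | h0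
  · rw [← h0]
    exact mul_nonneg (mul_nonneg two_pos.le h.integral_one_nonneg) (l2norm_nonneg _)
  · nlinarith

end ArcCalculus

/-! ### Geometric interpolation between norms of derivatives -/

/-- A nonnegative log-convex sequence lies below the geometric sequence through its end points. -/
lemma exists_geometric_majorant (N : ℕ) (b : ℕ → ℝ) (hb : ∀ k, 0 ≤ b k)
    (hlog : ∀ k, b (k + 1) ^ 2 ≤ b k * b (k + 2)) (Λ : ℝ) (hΛ : 0 < Λ)
    (hstep : ∀ k, b k ≤ Λ * b (k + 1)) :
    ∃ μ : ℝ, 0 < μ ∧ 1 ≤ Λ * μ ^ 2 + μ ^ 2 ∧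
      (∀ k, k ≤ N + 1 → b k ≤ b 0 * μ ^ (2 * k)) ∧ b (N + 1) = b 0 * μ ^ (2 * (N + 1)) := by
  rcases (hb 0).eq_or_lt with h0 | h0
  · have hz : ∀ k, b k = 0 := by
      intro k
      induction k with
      | zero => exact h0.symm
      | succ k ih =>
        have := hlog k
        rw [ih, zero_mul] at this
        exact pow_eq_zero_iff two_ne_zero |>.1 (le_antisymm this (sq_nonneg _))
    -- For a vanishing sequence the scale is arbitrary; the extra `μ ^ 2` in the lower bound lets `μ
    -- = 1` qualify for every `Λ`.
    exact ⟨1, one_pos, by nlinarith, fun k _ => by simp [hz], by simp [hz]⟩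
  have hpos : ∀ k, 0 < b k := by
    intro k
    induction k with
    | zero => exact h0
    | succ k ih => exact pos_of_mul_pos_right (ih.trans_le (hstep k)) hΛ.le
  set r : ℝ := b (N + 1) / b 0 with hr
  have hrpos : 0 < r := div_pos (hpos _) h0
  set ν : ℝ := r ^ (1 / ((2 * (N + 1) : ℕ) : ℝ)) with hν
  have hνpos : 0 < ν := Real.rpow_pos_of_pos hrpos _
  have hνpow : ν ^ (2 * (N + 1)) = r := by
    rw [hν, one_div]
    exact Real.rpow_inv_natCast_pow hrpos.le (by positivity)
  have hend : b (N + 1) = b 0 * ν ^ (2 * (N + 1)) := by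
    rw [hνpow, hr]; field_simp
  refine ⟨ν, hνpos, ?_, ?_, hend⟩
  · have hchain : ∀ k, b 0 ≤ Λ ^ k * b k := by
      intro k
      induction k with
      | zero => simp
      | succ k ih =>
        calc b 0 ≤ Λ ^ k * b k := ih
          _ ≤ Λ ^ k * (Λ * b (k + 1)) := by gcongr; exact hstep k
          _ = _ := by ring
    have h1 := hchain (N + 1)
    rw [hend, ← mul_assoc, mul_comm (Λ ^ (N + 1)), mul_assoc, pow_mul, ← mul_pow] at h1
    have h2 : 1 ≤ (Λ * ν ^ 2) ^ (N + 1) := by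
      by_contra hcon
      push Not at hcon
      nlinarith
    have h3 : 1 ≤ Λ * ν ^ 2 := by
      by_contra hcon
      push Not at hcon
      exact absurd h2 (not_le.2 (pow_lt_one₀ (by positivity) hcon (Nat.succ_ne_zero N)))
    nlinarith [sq_nonneg ν]
  -- Dividing out the geometric sequence leaves a log-convex sequence with equal end values, to
  -- which a discrete maximum principle applies.
  · set c : ℕ → ℝ := fun k => b k / ν ^ (2 * k) with hc
    have hcpos : ∀ k, 0 < c k := fun k => div_pos (hpos k) (by positivity)
    have hclog : ∀ k, c (k + 1) ^ 2 ≤ c k * c (k + 2) := by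
      intro k
      have e : c k * c (k + 2) = (b k * b (k + 2)) / (ν ^ (2 * (k + 1))) ^ 2 := by
        simp only [hc]; rw [div_mul_div_comm]; ring_nf
      rw [e]
      simp only [hc, div_pow]
      gcongr
      exact hlog k
    have hc0 : c 0 = b 0 := by simp [hc]
    have hcN : c (N + 1) = b 0 := by
      simp only [hc]; rw [hend]; field_simp
    have key : ∀ k, k ≤ N + 1 → c k ≤ b 0 := by
      by_contra hcon
      push Not at hcon
      obtain ⟨k0, hk0, hk0'⟩ := hcon
      obtain ⟨m, hm, hmax⟩ := Finset.exists_max_image (Finset.range (N + 2)) c ⟨0, by simp⟩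
      have hmb : b 0 < c m := hk0'.trans_le (hmax k0 (by simp; omega))
      have hex : ∃ k, c k = c m ∧ k ≤ N + 1 := ⟨m, rfl, by simp at hm; omega⟩
      classical
      -- At the first index attaining the maximum the left neighbour is strictly smaller, which
      -- contradicts log-convexity.
      set k := Nat.find hex with hk
      obtain ⟨hkm, hkN⟩ := Nat.find_spec hex
      have hk0 : k ≠ 0 := fun h => by
        rw [← hk, h, hc0] at hkm; linarith
      have hkN' : k ≠ N + 1 := fun h => by
        rw [← hk, h, hcN] at hkm; linarith
      obtain ⟨j, hj⟩ := Nat.exists_eq_succ_of_ne_zero hk0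
      have hlt : c j < c m := by
        refine lt_of_le_of_ne (hmax j (by simp; omega)) fun h => ?_
        exact Nat.find_min hex (m := j) (by omega) ⟨h, by omega⟩
      have hle : c (j + 2) ≤ c m := hmax _ (by simp; omega)
      have := hclog j
      rw [show j + 1 = k from hj.symm, hkm] at this
      nlinarith [hcpos j, hcpos (j + 2), hcpos m]
    intro k hk
    have := key k hk
    simp only [hc] at this
    rwa [div_le_iff₀ (by positivity)] at this

/-! ### Integral identities and pointwise bounds for the support function -/

lemma deriv_ofNat (D : Derivation ℝ SmoothPeriodic SmoothPeriodic) (n : ℕ) [n.AtLeastTwo] :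
    D (OfNat.ofNat n) = 0 := by
  rw [← Nat.cast_ofNat]
  exact D.map_natCast n

lemma integral_ofNat_mul (I : SmoothPeriodic →ₗ[ℝ] ℝ) (n : ℕ) [n.AtLeastTwo]
    (f : SmoothPeriodic) :
    I (OfNat.ofNat n * f) = OfNat.ofNat n * I f := by
  have : (OfNat.ofNat n : SmoothPeriodic) * f = (OfNat.ofNat n : ℝ) • f := by
    ext x; rfl
  rw [this, map_smul, smul_eq_mul]

/-- `u` plays the role of the affine support function, `v` of its reciprocal, `a` of the rate of
change of the length element and `G` of the time derivative of `u` along the flow. -/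
structure SupportData (D : Derivation ℝ SmoothPeriodic SmoothPeriodic)
    (u v a G : SmoothPeriodic) : Prop where
  pos : ∀ x, 0 < u x
  mul_inv : u * v = 1
  speed : 3 * G = -(u * D (D (D (D u)))) + 3 * (D u * D (D (D u))) + D (D u) ^ 2 - 4 * D (D u)
  stretch : 3 * a = D (D (D (D u))) + 2 * (D (D u) ^ 2 * v) - 2 * (D (D u) * v)

namespace SupportData

variable {D : Derivation ℝ SmoothPeriodic SmoothPeriodic} {I : SmoothPeriodic →ₗ[ℝ] ℝ}
  {u v a G : SmoothPeriodic}

lemma inv_apply (S : SupportData D u v a G) (x : ℝ) : v x = (u x)⁻¹ := by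
  have h : u x * v x = 1 := congrArg (fun f : SmoothPeriodic => f x) S.mul_inv
  exact eq_inv_of_mul_eq_one_right h

lemma inv_pos (S : SupportData D u v a G) (x : ℝ) : 0 < v x := by
  rw [S.inv_apply]; exact _root_.inv_pos.2 (S.pos x)

lemma deriv_inv (S : SupportData D u v a G) : D v = -(v ^ 2 * D u) := by
  have h : D (u * v) = 0 := by rw [S.mul_inv]; simp
  rw [Derivation.leibniz, smul_eq_mul, smul_eq_mul] at h
  linear_combination v * h - D v * S.mul_inv

/-- The integrand is the rate of change of `σ ds`, an exact derivative by the equations for `G` and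
`a`: the area is conserved. -/
lemma integral_area (S : SupportData D u v a G) (h : ArcCalculus D I) : I (G + a * u) = 0 := by
  have e : 3 * (G + a * u) = 3 * D (D u * D (D u) - (D u + D u)) := by
    simp only [map_sub, map_add, Derivation.leibniz, smul_eq_mul]
    linear_combination S.speed + u * S.stretch + (2 * D (D u) ^ 2 - 2 * D (D u)) * S.mul_inv
  have := congrArg I e
  rw [integral_ofNat_mul, integral_ofNat_mul, h.integral_deriv] at this
  linarith

/-- The left side is the time derivative of `∮ σ⁻² ds`, as `v` evolves by `-v² G`. Its sign makes
the polar area monotone, and its form is what the growth of the first energy is compared with. -/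
lemma integral_polarArea (S : SupportData D u v a G) (h : ArcCalculus D I) :
    I (2 * v * -(v ^ 2 * G) + a * v ^ 2) = 6 * I (v ^ 4 * D u ^ 2) := by
  have e : 3 * (2 * v * -(v ^ 2 * G) + a * v ^ 2)
      = 3 * (D (v * v * D (D (D u)) + (v * v * v * D u + v * v * v * D u)) +
        6 * (v ^ 4 * D u ^ 2)) := by
    simp only [map_add, Derivation.leibniz, smul_eq_mul, S.deriv_inv]
    linear_combination (-2 * v ^ 3) * S.speed + v ^ 2 * S.stretch +
      2 * v ^ 2 * D (D (D (D u))) * S.mul_inv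
  have := congrArg I e
  rw [integral_ofNat_mul, integral_ofNat_mul, map_add I (D _), h.integral_deriv,
    integral_ofNat_mul] at this
  linarith

/-- The left side is the time derivative of the first energy, since `∂_t σ_s = D G - a D u`. Up to
an exact derivative, three times the integrand is `w`, and `18 σ_s²/σ - w` is a sum of squares
divided by `σ`. -/
lemma integral_firstEnergy_le (S : SupportData D u v a G) (h : ArcCalculus D I) :
    I (2 * D u * (D G - a * D u) + a * D u ^ 2) ≤ 6 * I (D u ^ 2 * v) := by
  set w : SmoothPeriodic := -2 * (u * D (D (D u)) ^ 2) - 2 * (D u * D (D u) * D (D (D u)))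
    - 8 * (D u * D (D (D u))) - 2 * (D u ^ 2 * D (D u) ^ 2 * v) + 2 * (D u ^ 2 * D (D u) * v)
    with hw
  have e : 3 * (2 * D u * (D G - a * D u) + a * D u ^ 2)
      = D (3 * (D u * G + D u * G) + (u * (D (D u) * D (D (D u))) + u * (D (D u) * D (D (D u))))
        - D u * (D u * D (D (D u))) - (D u * (D (D u) * D (D u)) + D u * (D (D u) * D (D u)))
        + 8 * (D u * D (D u))) + w := by
    simp only [map_add, map_sub, Derivation.leibniz, smul_eq_mul, hw]
    linear_combination (-2 * D (D u)) * S.speed - D u ^ 2 * S.stretch -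
      D u * D (D u) * deriv_ofNat D 8 - 2 * D u * G * deriv_ofNat D 3
  have hle : I w ≤ I (18 * (D u ^ 2 * v)) := by
    refine h.integral_mono fun x => ?_
    have hu := S.pos x
    simp only [hw, SmoothPeriodic.add_apply, SmoothPeriodic.sub_apply, SmoothPeriodic.mul_apply,
      SmoothPeriodic.neg_apply, SmoothPeriodic.pow_apply, S.inv_apply]
    rw [show ∀ y, (2 : SmoothPeriodic) y = 2 from fun _ => rfl,
      show ∀ y, (8 : SmoothPeriodic) y = 8 from fun _ => rfl,
      show ∀ y, (18 : SmoothPeriodic) y = 18 from fun _ => rfl]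
    set p := (D (D (D u))) x
    set q := (D (D u)) x
    set z := (D u) x
    set U := u x
    have key : 18 * (z ^ 2 * U⁻¹) - (-2 * (U * p ^ 2) - 2 * (z * q * p) - 8 * (z * p)
        - 2 * (z ^ 2 * q ^ 2 * U⁻¹) + 2 * (z ^ 2 * q * U⁻¹))
        = U⁻¹ * ((U * p + z * q) ^ 2 + (U * p + 4 * z) ^ 2 + (z * q - z) ^ 2 + z ^ 2) := by
      field_simp; ring
    have : 0 ≤ U⁻¹ * ((U * p + z * q) ^ 2 + (U * p + 4 * z) ^ 2 + (z * q - z) ^ 2 + z ^ 2) := by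
      positivity
    linarith
  have := congrArg I e
  rw [integral_ofNat_mul, map_add I (D _), h.integral_deriv] at this
  rw [integral_ofNat_mul] at hle
  linarith

/-- Bound of the maximum of `u` by the integral and the first energy. -/
lemma pow_three_le (S : SupportData D u v a G) (h : ArcCalculus D I) (x : ℝ)
    (hB : 0 < I (v ^ 2)) :
    u x ^ 3 ≤ 8 * I u * I (D u ^ 2) + 8 * I u / I (v ^ 2) := by
  obtain ⟨xM, hM⟩ := SmoothPeriodic.exists_forall_le u
  obtain ⟨xm, hm⟩ := SmoothPeriodic.exists_forall_ge u
  set H := u xM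
  set m := u xm
  have hH : 0 < H := S.pos xM
  have hm0 : 0 < m := S.pos xm
  have hmB : m ^ 3 * I (v ^ 2) ≤ I u := by
    have := h.integral_mono (f := (m ^ 3) • v ^ 2) (k := u) fun y => by
      simp only [SmoothPeriodic.smul_apply, SmoothPeriodic.pow_apply, S.inv_apply]
      have hy := S.pos y
      have : m ^ 3 ≤ u y ^ 3 := pow_le_pow_left₀ hm0.le (hm y) 3
      calc m ^ 3 * (u y)⁻¹ ^ 2 ≤ u y ^ 3 * (u y)⁻¹ ^ 2 := by gcongr
        _ = u y := by field_simp
    simpa using this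
  have hA : 0 < I u := lt_of_lt_of_le (by positivity) hmB
  have hE : 0 ≤ I (D u ^ 2) := h.integral_nonneg _ fun y => sq_nonneg _
  -- This weight makes `δ * I u` equal to `H ^ 2 / 2`, which the left side absorbs.
  set δ : ℝ := H ^ 2 / (2 * I u) with hδ
  have hδ0 : 0 < δ := by positivity
  have h1 := h.abs_sub_le (u * u) (δ • u + (H / δ) • (D u) ^ 2) (fun y => by
    rw [Derivation.leibniz]
    simp only [smul_eq_mul, SmoothPeriodic.smul_apply, SmoothPeriodic.add_apply,
      SmoothPeriodic.mul_apply, SmoothPeriodic.pow_apply]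
    have hy := S.pos y
    have hyH := hM y
    set z := (D u) y
    set U := u y
    have h2 : 2 * |z| * U ≤ δ * U + U / δ * z ^ 2 := by
      have : 0 ≤ U / δ * (δ - |z|) ^ 2 := by positivity
      have e : U / δ * (δ - |z|) ^ 2 = δ * U + U / δ * z ^ 2 - 2 * |z| * U := by
        rw [sub_sq, sq_abs]; field_simp; ring
      linarith
    have h3 : U / δ * z ^ 2 ≤ H / δ * z ^ 2 := by gcongr
    rw [← two_mul, abs_mul, abs_mul, abs_of_pos hy, abs_two]
    linarith) xM xm
  have h2 := (le_abs_self _).trans h1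
  simp only [SmoothPeriodic.mul_apply, map_add, map_smul, smul_eq_mul] at h2
  have e1 : δ * I u = H ^ 2 / 2 := by rw [hδ]; field_simp
  have e2 : H / δ = 2 * I u / H := by rw [hδ]; field_simp
  rw [e1, e2] at h2
  change H * H - m * m ≤ _ at h2
  have h3 : H ^ 3 ≤ 2 * m ^ 2 * H + 4 * I u * I (D u ^ 2) := by
    have : H * (H * H - m * m) ≤ H * (H ^ 2 / 2 + 2 * I u / H * I (D u ^ 2)) := by gcongr
    have e3 : H * (H ^ 2 / 2 + 2 * I u / H * I (D u ^ 2))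
        = H ^ 3 / 2 + 2 * I u * I (D u ^ 2) := by field_simp
    rw [e3] at this
    nlinarith
  have hmB' : m ^ 3 ≤ I u / I (v ^ 2) := by rwa [le_div_iff₀ hB]
  have hx3 : u x ^ 3 ≤ H ^ 3 := pow_le_pow_left₀ (S.pos x).le (hM x) 3
  refine hx3.trans ?_
  rw [mul_div_assoc]
  -- If `2 m ≤ H`, the term `2 m² H` is absorbed into `H³`; otherwise `H³ ≤ 8 m³`, and the integral
  -- bound on the minimum suffices.
  rcases le_total (2 * m) H with hc | hc
  · have : 2 * m ^ 2 * H ≤ H ^ 3 / 2 := by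
      have : 4 * m ^ 2 ≤ H ^ 2 := by nlinarith
      nlinarith
    have : 0 ≤ I u / I (v ^ 2) := by positivity
    linarith
  · have : H ^ 3 ≤ (2 * m) ^ 3 := pow_le_pow_left₀ hH.le hc 3
    have : 0 ≤ I u * I (D u ^ 2) := by positivity
    nlinarith

/-- Lower bound of `u`, given a logarithm of `u`. -/
lemma lower_bound (S : SupportData D u v a G) (h : ArcCalculus D I) (ℓ : SmoothPeriodic)
    (hℓ : ∀ x, ℓ x = Real.log (u x)) (hDℓ : D ℓ = D u * v) (x : ℝ) {A B E : ℝ} (hA : 0 < A)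
    (hB0 : 0 < B) (hIu : A ≤ I u) (hIv : I (v ^ 2) ≤ B) (hE : I (D u ^ 2) ≤ E) :
    Real.exp ((Real.log (A / B)) / 3 - (E + B)) ≤ u x := by
  obtain ⟨xM, hM⟩ := SmoothPeriodic.exists_forall_le u
  have hH := S.pos xM
  have h1 : I u ≤ u xM ^ 3 * I (v ^ 2) := by
    have := h.integral_mono (f := u) (k := (u xM ^ 3) • v ^ 2) fun y => by
      simp only [SmoothPeriodic.smul_apply, SmoothPeriodic.pow_apply, S.inv_apply]
      have hy := S.pos y
      have : u y ^ 3 ≤ u xM ^ 3 := pow_le_pow_left₀ hy.le (hM y) 3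
      calc u y = u y ^ 3 * (u y)⁻¹ ^ 2 := by field_simp
        _ ≤ _ := by gcongr
    simpa using this
  have h2 : A / B ≤ u xM ^ 3 := by
    rw [div_le_iff₀ hB0]
    calc A ≤ u xM ^ 3 * I (v ^ 2) := hIu.trans h1
      _ ≤ _ := by gcongr
  have h3 : Real.log (A / B) / 3 ≤ Real.log (u xM) := by
    have := Real.log_le_log (by positivity) h2
    rw [Real.log_pow] at this
    push_cast at this
    linarith
  -- The oscillation of `log u` is at most the integral of `|D u| v ≤ (D u)² + v²`.
  have h4 := h.abs_sub_le ℓ (D u ^ 2 + v ^ 2) (fun y => by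
    rw [hDℓ]
    simp only [SmoothPeriodic.add_apply, SmoothPeriodic.mul_apply, SmoothPeriodic.pow_apply]
    rw [abs_le]
    constructor <;> nlinarith [sq_nonneg ((D u) y - v y), sq_nonneg ((D u) y + v y)]) xM x
  have h5 := (le_abs_self _).trans h4
  rw [hℓ, hℓ, map_add] at h5
  rw [← Real.exp_log (S.pos x)]
  exact Real.exp_le_exp.2 (by linarith)

end SupportData

/-! ### Product estimates at a fixed frequency scale -/

/-- The derivatives of `f` up to order `J` are bounded by `A ρ ^ j` uniformly. -/
def SupBound (D : Derivation ℝ SmoothPeriodic SmoothPeriodic) (ρ : ℝ) (J : ℕ) (A : ℝ)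
    (f : SmoothPeriodic) : Prop :=
  ∀ j ≤ J, ∀ x, |((⇑D)^[j] f) x| ≤ A * ρ ^ j

/-- The derivatives of `f` up to order `J` are bounded by `B ρ ^ j` in `L²`. -/
def L2Bound (D : Derivation ℝ SmoothPeriodic SmoothPeriodic) (I : SmoothPeriodic →ₗ[ℝ] ℝ) (ρ : ℝ)
    (J : ℕ) (B : ℝ) (f : SmoothPeriodic) : Prop :=
  ∀ j ≤ J, l2norm I ((⇑D)^[j] f) ≤ B * ρ ^ j

section Bounds

variable {D : Derivation ℝ SmoothPeriodic SmoothPeriodic} {I : SmoothPeriodic →ₗ[ℝ] ℝ} {ρ : ℝ}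
  {J : ℕ} {A B : ℝ} {f g : SmoothPeriodic}

lemma SupBound.nonneg (hf : SupBound D ρ J A f) : 0 ≤ A := by
  have := hf 0 (Nat.zero_le _) 0
  simp only [pow_zero, mul_one] at this
  exact (abs_nonneg _).trans this

lemma L2Bound.nonneg (hf : L2Bound D I ρ J A f) : 0 ≤ A := by
  have := hf 0 (Nat.zero_le _)
  simp only [pow_zero, mul_one] at this
  exact (Real.sqrt_nonneg _).trans this

lemma SupBound.weaken {J' : ℕ} (hf : SupBound D ρ J A f) (hρ : 0 ≤ ρ) (hJ : J' ≤ J)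
    (hA : A ≤ B) : SupBound D ρ J' B f :=
  fun j hj x => (hf j (hj.trans hJ) x).trans (by gcongr)

lemma L2Bound.weaken {J' : ℕ} (hf : L2Bound D I ρ J A f) (hρ : 0 ≤ ρ) (hJ : J' ≤ J)
    (hA : A ≤ B) : L2Bound D I ρ J' B f :=
  fun j hj => (hf j (hj.trans hJ)).trans (by gcongr)

lemma SupBound.deriv (hf : SupBound D ρ (J + 1) A f) : SupBound D ρ J (A * ρ) (D f) := by
  intro j hj x
  have := hf (j + 1) (by omega) x
  rwa [Function.iterate_succ_apply, pow_succ', ← mul_assoc] at this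

lemma L2Bound.deriv (hf : L2Bound D I ρ (J + 1) A f) : L2Bound D I ρ J (A * ρ) (D f) := by
  intro j hj
  have := hf (j + 1) (by omega)
  rwa [Function.iterate_succ_apply, pow_succ', ← mul_assoc] at this

lemma SupBound.of_deriv (h0 : ∀ x, |f x| ≤ A) (hf : SupBound D ρ J (A * ρ) (D f)) :
    SupBound D ρ (J + 1) A f := by
  rintro (_ | j) hj x
  · simpa using h0 x
  · rw [Function.iterate_succ_apply, pow_succ', ← mul_assoc]
    exact hf j (by omega) x

lemma L2Bound.of_deriv (h0 : l2norm I f ≤ A) (hf : L2Bound D I ρ J (A * ρ) (D f)) :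
    L2Bound D I ρ (J + 1) A f := by
  rintro (_ | j) hj
  · simpa using h0
  · rw [Function.iterate_succ_apply, pow_succ', ← mul_assoc]
    exact hf j (by omega)

lemma iterate_deriv_add (D : Derivation ℝ SmoothPeriodic SmoothPeriodic) (j : ℕ)
    (f g : SmoothPeriodic) : (⇑D)^[j] (f + g) = (⇑D)^[j] f + (⇑D)^[j] g :=
  iterate_map_add D j f g

lemma iterate_deriv_smul (D : Derivation ℝ SmoothPeriodic SmoothPeriodic) (j : ℕ) (c : ℝ)
    (f : SmoothPeriodic) : (⇑D)^[j] (c • f) = c • (⇑D)^[j] f := by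
  induction j with
  | zero => rfl
  | succ j ih => rw [Function.iterate_succ_apply', ih, Function.iterate_succ_apply', D.map_smul]

lemma SupBound.add (hf : SupBound D ρ J A f) (hg : SupBound D ρ J B g) :
    SupBound D ρ J (A + B) (f + g) := by
  intro j hj x
  rw [iterate_deriv_add, add_mul]
  exact (abs_add_le _ _).trans (add_le_add (hf j hj x) (hg j hj x))

lemma L2Bound.add (h : ArcCalculus D I) (hf : L2Bound D I ρ J A f) (hg : L2Bound D I ρ J B g) :
    L2Bound D I ρ J (A + B) (f + g) := by
  intro j hj
  rw [iterate_deriv_add, add_mul]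
  exact (h.l2norm_add_le _ _).trans (add_le_add (hf j hj) (hg j hj))

lemma SupBound.smul (c : ℝ) (hf : SupBound D ρ J A f) :
    SupBound D ρ J (|c| * A) (c • f) := by
  intro j hj x
  rw [iterate_deriv_smul, SmoothPeriodic.smul_apply, abs_mul, mul_assoc]
  exact mul_le_mul_of_nonneg_left (hf j hj x) (abs_nonneg c)

lemma L2Bound.smul (c : ℝ) (hf : L2Bound D I ρ J A f) :
    L2Bound D I ρ J (|c| * A) (c • f) := by
  intro j hj
  rw [iterate_deriv_smul, ArcCalculus.l2norm_smul, mul_assoc]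
  exact mul_le_mul_of_nonneg_left (hf j hj) (abs_nonneg c)

lemma deriv_mul_eq (D : Derivation ℝ SmoothPeriodic SmoothPeriodic) (f g : SmoothPeriodic) :
    D (f * g) = D f * g + f * D g := by
  rw [Derivation.leibniz, smul_eq_mul, smul_eq_mul]; ring

/-- Each use of the product rule doubles the number of terms, whence `2 ^ J`; both factors lose one
derivative at the same price `ρ`. -/
lemma SupBound.mul (hρ : 0 ≤ ρ) : ∀ {J : ℕ} {A B : ℝ} {f g : SmoothPeriodic},
    SupBound D ρ J A f → SupBound D ρ J B g → SupBound D ρ J (2 ^ J * A * B) (f * g) := by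
  intro J
  induction J with
  | zero =>
    intro A B f g hf hg j hj x
    obtain rfl : j = 0 := by omega
    have h1 := hf 0 le_rfl x
    have h2 := hg 0 le_rfl x
    simp only [Function.iterate_zero, id, pow_zero, mul_one, one_mul, SmoothPeriodic.mul_apply,
      abs_mul] at *
    exact mul_le_mul h1 h2 (abs_nonneg _) hf.nonneg
  | succ J ih =>
    intro A B f g hf hg
    have hA := hf.nonneg
    have hB := hg.nonneg
    refine SupBound.of_deriv (fun x => ?_) ?_
    · have h1 := hf 0 (by omega) x
      have h2 := hg 0 (by omega) x
      simp only [Function.iterate_zero, id, pow_zero, mul_one] at h1 h2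
      rw [SmoothPeriodic.mul_apply, abs_mul]
      have : |f x| * |g x| ≤ A * B := mul_le_mul h1 h2 (abs_nonneg _) hA
      have h3 : 1 ≤ (2 : ℝ) ^ (J + 1) := one_le_pow₀ one_le_two
      nlinarith [mul_nonneg hA hB]
    · rw [deriv_mul_eq]
      refine ((ih hf.deriv (hg.weaken hρ (Nat.le_succ J) le_rfl)).add
        (ih (hf.weaken hρ (Nat.le_succ J) le_rfl) hg.deriv)).weaken hρ le_rfl (le_of_eq ?_)
      ring

lemma L2Bound.mul (h : ArcCalculus D I) (hρ : 0 ≤ ρ) :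
    ∀ {J : ℕ} {A B : ℝ} {f g : SmoothPeriodic},
    SupBound D ρ J A f → L2Bound D I ρ J B g → L2Bound D I ρ J (2 ^ J * A * B) (f * g) := by
  intro J
  induction J with
  | zero =>
    intro A B f g hf hg j hj
    obtain rfl : j = 0 := by omega
    have h1 := fun x => hf 0 le_rfl x
    have h2 := hg 0 le_rfl
    simp only [Function.iterate_zero, id, pow_zero, mul_one, one_mul] at *
    exact (h.l2norm_mul_le h1).trans (mul_le_mul_of_nonneg_left h2 hf.nonneg)
  | succ J ih =>
    intro A B f g hf hg
    have hA := hf.nonneg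
    have hB := hg.nonneg
    refine L2Bound.of_deriv ?_ ?_
    · have h1 := fun x => hf 0 (by omega) x
      have h2 := hg 0 (by omega)
      simp only [Function.iterate_zero, id, pow_zero, mul_one] at h1 h2
      have := (h.l2norm_mul_le (k := g) h1).trans (mul_le_mul_of_nonneg_left h2 hA)
      have h3 : 1 ≤ (2 : ℝ) ^ (J + 1) := one_le_pow₀ one_le_two
      nlinarith [mul_nonneg hA hB]
    · rw [deriv_mul_eq]
      refine ((ih hf.deriv (hg.weaken hρ (Nat.le_succ J) le_rfl)).add h
        (ih (hf.weaken hρ (Nat.le_succ J) le_rfl) hg.deriv)).weaken hρ le_rfl (le_of_eq ?_)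
      ring

end Bounds

/-! ### Support functions at the scale `μ ^ 2` -/

/-- A support function all of whose derivatives up to order `m + 4` are controlled, at the
frequency scale `μ ^ 2`, by the norm `e` of the first one. -/
structure Scaled (m : ℕ) (K P M : ℝ) (D : Derivation ℝ SmoothPeriodic SmoothPeriodic)
    (I : SmoothPeriodic →ₗ[ℝ] ℝ) (u v a G : SmoothPeriodic) (e μ : ℝ) : Prop where
  calc' : ArcCalculus D I
  data : SupportData D u v a G
  inv_le : ∀ x, v x ≤ K
  e_nonneg : 0 ≤ e
  e_le : e ≤ M
  μ_pos : 0 < μ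
  one_le : 1 ≤ P * μ
  one_le_sq : 1 ≤ P * μ ^ 2
  sup_le : ∀ k ≤ m + 2, ∀ x, |((⇑D)^[k + 1] u) x| ≤ 2 * e * μ * (μ ^ 2) ^ k
  l2_le : ∀ k ≤ m + 3, l2norm I ((⇑D)^[k + 1] u) ≤ e * (μ ^ 2) ^ k

namespace Scaled

variable {m : ℕ} {K P M : ℝ} {D : Derivation ℝ SmoothPeriodic SmoothPeriodic}
  {I : SmoothPeriodic →ₗ[ℝ] ℝ} {u v a G : SmoothPeriodic} {e μ : ℝ}

lemma P_pos (s : Scaled m K P M D I u v a G e μ) : 0 < P :=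
  pos_of_mul_pos_left (one_pos.trans_le s.one_le) s.μ_pos.le

lemma supBound (s : Scaled m K P M D I u v a G e μ) {k J : ℕ} (hk : k + J ≤ m + 2) :
    SupBound D (μ ^ 2) J (2 * e * μ * (μ ^ 2) ^ k) ((⇑D)^[k + 1] u) := by
  intro j hj x
  rw [← Function.iterate_add_apply, mul_assoc, ← pow_add, add_comm k j]
  exact s.sup_le (j + k) (by omega) x

lemma l2Bound (s : Scaled m K P M D I u v a G e μ) {k J : ℕ} (hk : k + J ≤ m + 3) :
    L2Bound D I (μ ^ 2) J (e * (μ ^ 2) ^ k) ((⇑D)^[k + 1] u) := by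
  intro j hj
  rw [← Function.iterate_add_apply, mul_assoc, ← pow_add, add_comm k j]
  exact s.l2_le (j + k) (by omega)

-- Induction through `v_s = -v² σ_s`. The sup norm of `σ_s` is of size `e μ`, and `e μ ≤ M P μ²`
-- turns it into the full price `μ²` of one derivative.
variable (m K P M) in
lemma exists_supBound_inv (hK : 0 ≤ K) (J : ℕ) : ∃ C : ℝ, K ≤ C ∧
    ∀ {D : Derivation ℝ SmoothPeriodic SmoothPeriodic}
    {I : SmoothPeriodic →ₗ[ℝ] ℝ} {u v a G : SmoothPeriodic} {e μ : ℝ},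
    Scaled m K P M D I u v a G e μ → J ≤ m + 2 → SupBound D (μ ^ 2) J C v := by
  induction J with
  | zero =>
    refine ⟨K, le_rfl, fun s _ j hj x => ?_⟩
    obtain rfl : j = 0 := by omega
    simpa [abs_of_pos (s.data.inv_pos x)] using s.inv_le x
  | succ J ih =>
    obtain ⟨C, hKC, hC⟩ := ih
    refine ⟨C + 2 ^ J * (2 ^ J * C * C) * (2 * |M| * |P|), ?_, fun {D I u v a G e μ} s hJ => ?_⟩
    · have : 0 ≤ C := hK.trans hKC
      have : 0 ≤ 2 ^ J * (2 ^ J * C * C) * (2 * |M| * |P|) := by positivity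
      linarith
    have hv := hC s (by omega)
    have hC0 : 0 ≤ C := hK.trans hKC
    have hρ : 0 ≤ μ ^ 2 := sq_nonneg μ
    have hnn : 0 ≤ 2 ^ J * (2 ^ J * C * C) * (2 * |M| * |P|) := by positivity
    refine SupBound.of_deriv (fun x => ?_) ?_
    · rw [abs_of_pos (s.data.inv_pos x)]
      linarith [s.inv_le x]
    · have h1 := ((SupBound.mul hρ (SupBound.mul hρ hv hv)
        (s.supBound (k := 0) (J := J) (by omega))).smul (-1))
      have e1 : D v = (-1 : ℝ) • (v * v * (⇑D)^[0 + 1] u) := by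
        rw [s.data.deriv_inv, neg_one_smul]
        simp only [zero_add, Function.iterate_one]; ring
      rw [e1]
      refine h1.weaken hρ le_rfl ?_
      have h2 : e * μ ≤ |M| * (|P| * μ ^ 2) := by
        refine mul_le_mul (s.e_le.trans (le_abs_self M)) ?_ s.μ_pos.le (abs_nonneg _)
        rw [abs_of_pos s.P_pos]
        nlinarith [s.one_le, s.μ_pos]
      have h3 : 2 ^ J * (2 ^ J * C * C) * (2 * (e * μ))
          ≤ 2 ^ J * (2 ^ J * C * C) * (2 * (|M| * (|P| * μ ^ 2))) := by gcongr
      simp only [abs_neg, abs_one, one_mul, pow_zero, mul_one]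
      nlinarith [mul_nonneg hC0 hρ]

-- The term `σ_ssss` sets the size `e μ⁶`. The other terms carry fewer powers of `μ`, made up for by
-- `e ≤ M` and the lower bounds on `P μ` and `P μ²`.
variable (m K P M) in
lemma exists_l2Bound_stretch (hK : 0 ≤ K) : ∃ C : ℝ, 0 ≤ C ∧
    ∀ {D : Derivation ℝ SmoothPeriodic SmoothPeriodic}
    {I : SmoothPeriodic →ₗ[ℝ] ℝ} {u v a G : SmoothPeriodic} {e μ : ℝ},
    Scaled m K P M D I u v a G e μ → L2Bound D I (μ ^ 2) m (C * e * (μ ^ 2) ^ 3) a := by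
  obtain ⟨V, hV, hv⟩ := exists_supBound_inv m K P M hK m
  have hV0 : 0 ≤ V := hK.trans hV
  refine ⟨1 + 2 ^ m * V * (2 ^ m * (2 * |M| * |P|)) + 2 ^ m * V * (P ^ 2), by positivity,
    fun {D I u v a G e μ} s => ?_⟩
  have hρ : 0 ≤ μ ^ 2 := sq_nonneg μ
  have h := s.calc'
  have h1 := (s.l2Bound (k := 3) (J := m) (by omega)).smul (1 / 3)
  have h2 := (L2Bound.mul h hρ (hv s (by omega)) (L2Bound.mul h hρ
    (s.supBound (k := 1) (J := m) (by omega)) (s.l2Bound (k := 1) (J := m) (by omega)))).smul (2 / 3)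
  have h3 := (L2Bound.mul h hρ (hv s (by omega))
    (s.l2Bound (k := 1) (J := m) (by omega))).smul (-2 / 3)
  have e1 : a = (1 / 3 : ℝ) • (⇑D)^[3 + 1] u +
      (2 / 3 : ℝ) • (v * ((⇑D)^[1 + 1] u * (⇑D)^[1 + 1] u)) +
      (-2 / 3 : ℝ) • (v * (⇑D)^[1 + 1] u) := by
    ext x
    have := congrArg (fun f : SmoothPeriodic => f x) s.data.stretch
    change 3 * a x = (D (D (D (D u)))) x + 2 * ((D (D u)) x ^ 2 * v x)
      - 2 * ((D (D u)) x * v x) at this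
    change a x = 1 / 3 * (D (D (D (D u)))) x + 2 / 3 * (v x * ((D (D u)) x * (D (D u)) x))
      + -2 / 3 * (v x * (D (D u)) x)
    linarith
  rw [e1]
  refine ((h1.add h h2).add h h3).weaken hρ le_rfl ?_
  have he := s.e_nonneg
  have hμ := s.μ_pos
  have hP := s.P_pos
  have b1 : e * μ ≤ |M| * (|P| * μ ^ 2) := by
    refine mul_le_mul (s.e_le.trans (le_abs_self M)) ?_ hμ.le (abs_nonneg _)
    rw [abs_of_pos hP]
    nlinarith [s.one_le]
  have b2 : 1 ≤ P ^ 2 * (μ ^ 2) ^ 2 := by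
    rw [← mul_pow]; exact one_le_pow₀ s.one_le_sq
  have t1 : e * (μ ^ 2) ^ 3 * (2 / 3) ≥ 0 := by positivity
  have t2 : 2 ^ m * V * (2 ^ m * (2 * e * μ * (μ ^ 2) ^ 1) * (e * (μ ^ 2) ^ 1))
      ≤ 2 ^ m * V * (2 ^ m * (2 * |M| * |P|)) * e * (μ ^ 2) ^ 3 := by
    calc 2 ^ m * V * (2 ^ m * (2 * e * μ * (μ ^ 2) ^ 1) * (e * (μ ^ 2) ^ 1))
        = 2 ^ m * V * (2 ^ m * (2 * (e * μ))) * e * (μ ^ 2) ^ 2 := by ring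
      _ ≤ 2 ^ m * V * (2 ^ m * (2 * (|M| * (|P| * μ ^ 2)))) * e * (μ ^ 2) ^ 2 := by gcongr
      _ = _ := by ring
  have t3 : 2 ^ m * V * (e * (μ ^ 2) ^ 1) ≤ 2 ^ m * V * (P ^ 2) * e * (μ ^ 2) ^ 3 := by
    calc 2 ^ m * V * (e * (μ ^ 2) ^ 1) = 2 ^ m * V * (e * (μ ^ 2) ^ 1) * 1 := by ring
      _ ≤ 2 ^ m * V * (e * (μ ^ 2) ^ 1) * (P ^ 2 * (μ ^ 2) ^ 2) := by gcongr
      _ = _ := by ring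
  have t2' : 0 ≤ 2 ^ m * V * (2 ^ m * (2 * e * μ * (μ ^ 2) ^ 1) * (e * (μ ^ 2) ^ 1)) := by
    positivity
  have t3' : 0 ≤ 2 ^ m * V * (e * (μ ^ 2) ^ 1) := by positivity
  rw [show |(1 / 3 : ℝ)| = 1 / 3 by norm_num, show |(2 / 3 : ℝ)| = 2 / 3 by norm_num,
    show |(-2 / 3 : ℝ)| = 2 / 3 by norm_num]
  linarith

end Scaled

/-! ### The higher order energy estimate -/

/-- The time derivative of the `k`-th arc length derivative of `u`, when `u` has time derivative
`G` and the length element has rate of change `a`. -/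
def derivSpeed (D : Derivation ℝ SmoothPeriodic SmoothPeriodic) (u a G : SmoothPeriodic) :
    ℕ → SmoothPeriodic
  | 0 => G
  | k + 1 => D (derivSpeed D u a G k) - a * (⇑D)^[k + 1] u

/-- The part of the commutator of `∂_t` and `∂_s ^ (k + 2)` with few derivatives of `a`. -/
def commutatorRemainder (D : Derivation ℝ SmoothPeriodic SmoothPeriodic) (u a : SmoothPeriodic) :
    ℕ → SmoothPeriodic
  | 0 => a * (⇑D)^[2] u
  | k + 1 => D (commutatorRemainder D u a k) + a * (⇑D)^[k + 3] u

/-- The lower order part of `∂_s ^ k (u u_{ssss})`. -/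
def leibnizRemainder (D : Derivation ℝ SmoothPeriodic SmoothPeriodic) (u : SmoothPeriodic) :
    ℕ → SmoothPeriodic
  | 0 => 0
  | k + 1 => D (leibnizRemainder D u k) + (⇑D)^[0 + 1] u * (⇑D)^[k + 3 + 1] u

/-- The outermost derivatives are kept apart so that integration by parts can move them to the other
factor. Then `a`, which already contains `σ_ssss`, is differentiated at most `m` times, and nothing
beyond order `m + 4` appears. -/
lemma derivSpeed_add_two (D : Derivation ℝ SmoothPeriodic SmoothPeriodic)
    (u a G : SmoothPeriodic) (m : ℕ) :
    derivSpeed D u a G (m + 2) = D (D ((⇑D)^[m] G)) - D ((⇑D)^[m] (a * D u)) -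
      commutatorRemainder D u a m := by
  induction m with
  | zero =>
    simp only [derivSpeed, commutatorRemainder, Function.iterate_zero, id, Function.iterate_succ,
      Function.comp, zero_add, map_sub]
  | succ m ih =>
    rw [show m + 1 + 2 = (m + 2) + 1 from rfl, derivSpeed, ih, commutatorRemainder,
      Function.iterate_succ_apply' _ m G, Function.iterate_succ_apply' _ m (a * D u)]
    simp only [map_sub]
    ring

lemma iterate_deriv_leading (D : Derivation ℝ SmoothPeriodic SmoothPeriodic)
    (u : SmoothPeriodic) (m : ℕ) :
    (⇑D)^[m] (u * (⇑D)^[4] u) = u * (⇑D)^[m + 4] u + leibnizRemainder D u m := by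
  induction m with
  | zero => simp [leibnizRemainder]
  | succ m ih =>
    rw [Function.iterate_succ_apply', ih, map_add, deriv_mul_eq, leibnizRemainder,
      show m + 1 + 4 = (m + 4) + 1 from rfl, Function.iterate_succ_apply' _ (m + 4)]
    simp only [zero_add, Function.iterate_one]
    ring

namespace Scaled

variable {m : ℕ} {K P M : ℝ} {D : Derivation ℝ SmoothPeriodic SmoothPeriodic}
  {I : SmoothPeriodic →ₗ[ℝ] ℝ} {u v a G : SmoothPeriodic} {e μ : ℝ}

-- Each step of the recursion spends one derivative, so the remainder of index `k` is controlled up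
-- to order `m - k`. The new term pairs the sup norm of a derivative of `u` with the `L²` norm of
-- `a`.
variable (m K P M) in
lemma exists_l2Bound_commutatorRemainder (hK : 0 ≤ K) (k : ℕ) : ∃ C : ℝ, 0 ≤ C ∧
    ∀ {D : Derivation ℝ SmoothPeriodic SmoothPeriodic}
    {I : SmoothPeriodic →ₗ[ℝ] ℝ} {u v a G : SmoothPeriodic} {e μ : ℝ},
    Scaled m K P M D I u v a G e μ → ∀ J, k + J = m →
      L2Bound D I (μ ^ 2) J (C * e ^ 2 * μ * (μ ^ 2) ^ (k + 4)) (commutatorRemainder D u a k) := by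
  obtain ⟨C₁, hC₁, ha⟩ := exists_l2Bound_stretch m K P M hK
  induction k with
  | zero =>
    refine ⟨2 ^ m * 2 * C₁, by positivity, fun {D I u v a G e μ} s J hJ => ?_⟩
    obtain rfl : J = m := by omega
    rw [commutatorRemainder, mul_comm a]
    refine (L2Bound.mul s.calc' (sq_nonneg μ) (s.supBound (k := 1) (by omega)) (ha s)).weaken
      (sq_nonneg μ) le_rfl (le_of_eq ?_)
    ring
  | succ k ih =>
    obtain ⟨C, hC, hQ⟩ := ih
    refine ⟨C + 2 ^ m * 2 * C₁, by positivity, fun {D I u v a G e μ} s J hJ => ?_⟩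
    rw [commutatorRemainder, mul_comm a]
    have h1 := (hQ s (J + 1) (by omega)).deriv
    have h2 := L2Bound.mul s.calc' (sq_nonneg μ)
      (s.supBound (k := k + 2) (J := J) (by omega)) ((ha s).weaken (sq_nonneg μ) (by omega) le_rfl)
    refine (h1.add s.calc' h2).weaken (sq_nonneg μ) le_rfl ?_
    have he := s.e_nonneg
    have hμ := s.μ_pos
    have h3 : (2 : ℝ) ^ J ≤ 2 ^ m := pow_le_pow_right₀ one_le_two (by omega)
    calc C * e ^ 2 * μ * (μ ^ 2) ^ (k + 4) * μ ^ 2 +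
          2 ^ J * (2 * e * μ * (μ ^ 2) ^ (k + 2)) * (C₁ * e * (μ ^ 2) ^ 3)
        ≤ C * e ^ 2 * μ * (μ ^ 2) ^ (k + 4) * μ ^ 2 +
          2 ^ m * (2 * e * μ * (μ ^ 2) ^ (k + 2)) * (C₁ * e * (μ ^ 2) ^ 3) := by gcongr
      _ = _ := by ring

lemma l2Bound_leibnizRemainder (s : Scaled m K P M D I u v a G e μ) (k : ℕ) :
    ∀ J, k + J = m →
      L2Bound D I (μ ^ 2) J (k * 2 ^ (m + 1) * e ^ 2 * μ * (μ ^ 2) ^ (k + 2))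
        (leibnizRemainder D u k) := by
  induction k with
  | zero =>
    intro J _ j _
    have : (⇑D)^[j] 0 = 0 := iterate_map_zero D j
    simp [leibnizRemainder, this, l2norm]
  | succ k ih =>
    intro J hJ
    have h1 := (ih (J + 1) (by omega)).deriv
    have h2 := L2Bound.mul s.calc' (sq_nonneg μ) (s.supBound (k := 0) (J := J) (by omega))
      (s.l2Bound (k := k + 3) (J := J) (by omega))
    rw [leibnizRemainder]
    refine (h1.add s.calc' h2).weaken (sq_nonneg μ) le_rfl ?_
    have he := s.e_nonneg
    have hμ := s.μ_pos
    have h3 : (2 : ℝ) ^ J ≤ 2 ^ m := pow_le_pow_right₀ one_le_two (by omega)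
    calc k * 2 ^ (m + 1) * e ^ 2 * μ * (μ ^ 2) ^ (k + 2) * μ ^ 2 +
          2 ^ J * (2 * e * μ * (μ ^ 2) ^ 0) * (e * (μ ^ 2) ^ (k + 3))
        ≤ k * 2 ^ (m + 1) * e ^ 2 * μ * (μ ^ 2) ^ (k + 2) * μ ^ 2 +
          2 ^ m * (2 * e * μ * (μ ^ 2) ^ 0) * (e * (μ ^ 2) ^ (k + 3)) := by gcongr
      _ = _ := by push_cast; ring

/-- These are the terms of `3 G` without `u σ_ssss`. The linear one, `-4 σ_ss`, lacks a factor `μ³`,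
supplied by `1 ≤ (P μ) (P μ²)`. -/
lemma l2norm_lower_order (s : Scaled m K P M D I u v a G e μ) :
    l2norm I ((⇑D)^[m] ((3 : ℝ) • ((⇑D)^[0 + 1] u * (⇑D)^[2 + 1] u) +
      (⇑D)^[1 + 1] u * (⇑D)^[1 + 1] u + (-4 : ℝ) • (⇑D)^[1 + 1] u)) ≤
      (2 ^ m * 8 * M + 4 * P ^ 2) * e * μ * (μ ^ 2) ^ (m + 2) := by
  have hρ := sq_nonneg μ
  have he := s.e_nonneg
  have hμ := s.μ_pos
  have h1 := (L2Bound.mul s.calc' hρ (s.supBound (k := 0) (J := m) (by omega))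
    (s.l2Bound (k := 2) (J := m) (by omega))).smul 3
  have h2 := L2Bound.mul s.calc' hρ (s.supBound (k := 1) (J := m) (by omega))
    (s.l2Bound (k := 1) (J := m) (by omega))
  have h3 := (s.l2Bound (k := 1) (J := m) (by omega)).smul (-4)
  refine (((h1.add s.calc' h2).add s.calc' h3) m le_rfl).trans ?_
  have b1 : 2 ^ m * 8 * e * (e * μ * (μ ^ 2) ^ 2) ≤ 2 ^ m * 8 * M * (e * μ * (μ ^ 2) ^ 2) := by
    gcongr; exact s.e_le
  have b2 : 1 ≤ P * μ * (P * μ ^ 2) := one_le_mul_of_one_le_of_one_le s.one_le s.one_le_sq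
  have b3 : 4 * (e * μ ^ 2) * 1 ≤ 4 * (e * μ ^ 2) * (P * μ * (P * μ ^ 2)) := by gcongr
  rw [show |(3 : ℝ)| = 3 by norm_num, show |(-4 : ℝ)| = 4 by norm_num]
  calc _ = (2 ^ m * 8 * e * (e * μ * (μ ^ 2) ^ 2) + 4 * (e * μ ^ 2) * 1) * (μ ^ 2) ^ m := by ring
    _ ≤ (2 ^ m * 8 * M * (e * μ * (μ ^ 2) ^ 2) + 4 * (e * μ ^ 2) * (P * μ * (P * μ ^ 2)))
        * (μ ^ 2) ^ m := by gcongr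
    _ = _ := by ring

/-- Two derivatives are moved off `G` and one off `a σ_s`. The leading part `-u σ_ssss` of `3 G`
then produces the only term of definite sign, the dissipation. -/
lemma integral_energyDeriv_eq (s : Scaled m K P M D I u v a G e μ) :
    3 * I (2 * (⇑D)^[m + 2] u * derivSpeed D u a G (m + 2) + a * ((⇑D)^[m + 2] u) ^ 2) =
      -2 * I (u * ((⇑D)^[m + 4] u * (⇑D)^[m + 4] u))
      - 2 * I ((⇑D)^[m + 4] u * leibnizRemainder D u m)
      + 2 * I ((⇑D)^[m + 4] u * (⇑D)^[m] ((3 : ℝ) • ((⇑D)^[0 + 1] u * (⇑D)^[2 + 1] u) +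
        (⇑D)^[1 + 1] u * (⇑D)^[1 + 1] u + (-4 : ℝ) • (⇑D)^[1 + 1] u))
      + 6 * I ((⇑D)^[m + 3] u * (⇑D)^[m] ((⇑D)^[0 + 1] u * a))
      - 6 * I ((⇑D)^[m + 2] u * commutatorRemainder D u a m)
      + 3 * I ((⇑D)^[m + 2] u * ((⇑D)^[m + 2] u * a)) := by
  set w := (⇑D)^[m + 2] u with hw
  have hw1 : D w = (⇑D)^[m + 3] u := (Function.iterate_succ_apply' _ _ _).symm
  have hw2 : D (D w) = (⇑D)^[m + 4] u := by rw [hw1]; exact (Function.iterate_succ_apply' _ _ _).symm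
  set R := (⇑D)^[m] ((3 : ℝ) • ((⇑D)^[0 + 1] u * (⇑D)^[2 + 1] u) +
        (⇑D)^[1 + 1] u * (⇑D)^[1 + 1] u + (-4 : ℝ) • (⇑D)^[1 + 1] u) with hR
  have hG : (3 : ℝ) • (⇑D)^[m] G = (-1 : ℝ) • (u * (⇑D)^[m + 4] u + leibnizRemainder D u m) + R := by
    rw [← iterate_deriv_leading, ← iterate_deriv_smul, ← iterate_deriv_smul, hR,
      ← iterate_deriv_add]
    congr 1
    ext x
    have := congrArg (fun f : SmoothPeriodic => f x) s.data.speed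
    change 3 * G x = -(u x * (D (D (D (D u)))) x) + 3 * ((D u) x * (D (D (D u))) x)
      + (D (D u)) x ^ 2 - 4 * (D (D u)) x at this
    change 3 * G x = -1 * (u x * (D (D (D (D u)))) x) + (3 * ((D u) x * (D (D (D u))) x)
      + (D (D u)) x * (D (D u)) x + -4 * (D (D u)) x)
    linarith
  have hGI : 3 * I (D (D w) * (⇑D)^[m] G) = -I (u * ((⇑D)^[m + 4] u * (⇑D)^[m + 4] u))
      - I ((⇑D)^[m + 4] u * leibnizRemainder D u m) + I ((⇑D)^[m + 4] u * R) := by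
    have h1 : 3 * I (D (D w) * (⇑D)^[m] G) = I (D (D w) * ((3 : ℝ) • (⇑D)^[m] G)) := by
      rw [mul_smul_comm, map_smul, smul_eq_mul]
    rw [h1, hG, hw2]
    have h2 : (⇑D)^[m + 4] u * ((-1 : ℝ) • (u * (⇑D)^[m + 4] u + leibnizRemainder D u m) + R)
        = (-1 : ℝ) • (u * ((⇑D)^[m + 4] u * (⇑D)^[m + 4] u))
          + (-1 : ℝ) • ((⇑D)^[m + 4] u * leibnizRemainder D u m) + (⇑D)^[m + 4] u * R := by
      simp only [neg_one_smul]; ring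
    rw [h2]
    simp only [map_add, map_smul, smul_eq_mul]
    ring
  have e1 : I (w * D (D ((⇑D)^[m] G))) = I (D (D w) * (⇑D)^[m] G) := by
    rw [s.calc'.integral_mul_deriv, s.calc'.integral_mul_deriv, neg_neg]
  have e2 : I (w * D ((⇑D)^[m] (a * D u))) = -I ((⇑D)^[m + 3] u * (⇑D)^[m] (D u * a)) := by
    rw [s.calc'.integral_mul_deriv, hw1, mul_comm a]
  have e3 : 2 * w * derivSpeed D u a G (m + 2) + a * w ^ 2 =
      (2 : ℝ) • (w * D (D ((⇑D)^[m] G))) + (-2 : ℝ) • (w * D ((⇑D)^[m] (a * D u))) +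
      (-2 : ℝ) • (w * commutatorRemainder D u a m) + w * (w * a) := by
    rw [derivSpeed_add_two, neg_smul, neg_smul]
    simp only [two_smul]
    ring
  rw [e3]
  simp only [map_add, map_smul, smul_eq_mul]
  rw [e1, e2]
  simp only [zero_add, Function.iterate_one]
  linarith

lemma sum_bound {z i₀ i₁ i₂ i₃ i₄ i₅ k₁ k₂ k₃ k₄ k₅ X : ℝ} (h₀ : z ≤ i₀) (h₁ : |i₁| ≤ k₁ * X)
    (h₂ : |i₂| ≤ k₂ * X) (h₃ : |i₃| ≤ k₃ * X) (h₄ : |i₄| ≤ k₄ * X) (h₅ : |i₅| ≤ k₅ * X) :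
    -2 * i₀ - 2 * i₁ + 2 * i₂ + 6 * i₃ - 6 * i₄ + 3 * i₅ ≤
      -2 * z + (2 * k₁ + 2 * k₂ + 6 * k₃ + 6 * k₄ + 3 * k₅) * X := by
  rw [abs_le] at *
  linarith [h₁.1, h₂.2, h₃.2, h₄.1, h₅.2]

lemma le_of_three_mul_le {Z z Y T : ℝ} (h : 3 * Z ≤ -2 * z + Y) (hz : 0 ≤ z) (hT : 0 ≤ T)
    (hY : Y ≤ T ∨ Y ≤ z) : Z ≤ T := by
  rcases hY with hY | hY <;> linarith

variable (m K P M) in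
/-- Higher order energy estimate for a scaled support function. -/
lemma exists_energyDeriv_le (hK : 0 < K) (hM : 0 ≤ M) : ∃ C : ℝ, 0 ≤ C ∧
    ∀ {D : Derivation ℝ SmoothPeriodic SmoothPeriodic}
    {I : SmoothPeriodic →ₗ[ℝ] ℝ} {u v a G : SmoothPeriodic} {e μ : ℝ},
    Scaled m K P M D I u v a G e μ → l2norm I ((⇑D)^[m + 4] u) = e * (μ ^ 2) ^ (m + 3) →
    I (2 * (⇑D)^[m + 2] u * derivSpeed D u a G (m + 2) + a * ((⇑D)^[m + 2] u) ^ 2)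
      ≤ C * e ^ 2 := by
  obtain ⟨C₁, hC₁, ha⟩ := exists_l2Bound_stretch m K P M hK.le
  obtain ⟨C₂, hC₂, hQ⟩ := exists_l2Bound_commutatorRemainder m K P M hK.le m
  set C₃ : ℝ := 2 * (m * 2 ^ (m + 1) * M) + 2 * (2 ^ m * 8 * M + 4 * P ^ 2)
    + 6 * (2 ^ m * 2 * C₁ * M) + 6 * (C₂ * M) + 3 * (2 * C₁ * M) with hC₃
  have hC₃0 : 0 ≤ C₃ := by positivity
  -- This is the largest value of `C₃ μ ^ (4 * m + 11)` in the regime `μ ≤ K C₃`.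
  refine ⟨C₃ * (K * C₃) ^ (4 * m + 11), by positivity, fun {D I u v a G e μ} s htop => ?_⟩
  have he := s.e_nonneg
  have hμ := s.μ_pos
  have h := s.calc'
  have hρ := sq_nonneg μ
  set w := (⇑D)^[m + 4] u with hw
  have hD : l2norm I w = e * μ ^ (2 * m + 6) := by rw [htop]; ring
  have t0 : K⁻¹ * (e * μ ^ (2 * m + 6)) ^ 2 ≤ I (u * (w * w)) := by
    rw [← hD, h.l2norm_sq]
    have := h.integral_mono (f := K⁻¹ • (w * w)) (k := u * (w * w)) fun x => by
      simp only [SmoothPeriodic.smul_apply, SmoothPeriodic.mul_apply]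
      have h1 : K⁻¹ ≤ u x := by
        have := s.inv_le x
        rw [s.data.inv_apply] at this
        exact inv_le_of_inv_le₀ (s.data.pos x) this
      exact mul_le_mul_of_nonneg_right h1 (mul_self_nonneg _)
    simpa using this
  have N1 : l2norm I (leibnizRemainder D u m) ≤ m * 2 ^ (m + 1) * e ^ 2 * μ * (μ ^ 2) ^ (m + 2) := by
    simpa using s.l2Bound_leibnizRemainder m 0 (by omega) 0 le_rfl
  have N2 := s.l2norm_lower_order
  have N3 : l2norm I ((⇑D)^[m] ((⇑D)^[0 + 1] u * a)) ≤
      2 ^ m * (2 * e * μ) * (C₁ * e * (μ ^ 2) ^ 3) * (μ ^ 2) ^ m := by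
    simpa using (L2Bound.mul h hρ (s.supBound (k := 0) (J := m) (by omega)) (ha s)) m le_rfl
  have N4 : l2norm I (commutatorRemainder D u a m) ≤ C₂ * e ^ 2 * μ * (μ ^ 2) ^ (m + 4) := by
    simpa using hQ s 0 (by omega) 0 le_rfl
  have N5 : l2norm I ((⇑D)^[m + 2] u * a) ≤ 2 * e * μ * (μ ^ 2) ^ (m + 1) * (C₁ * e * (μ ^ 2) ^ 3) := by
    have h1 := fun x => s.sup_le (m + 1) (by omega) x
    have h2 : l2norm I a ≤ C₁ * e * (μ ^ 2) ^ 3 := by simpa using ha s 0 (by omega)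
    refine (h.l2norm_mul_le h1).trans ?_
    gcongr
  have M2 : l2norm I ((⇑D)^[m + 2] u) ≤ e * (μ ^ 2) ^ (m + 1) := s.l2_le (m + 1) (by omega)
  have M3 : l2norm I ((⇑D)^[m + 3] u) ≤ e * (μ ^ 2) ^ (m + 2) := s.l2_le (m + 2) (by omega)
  set X : ℝ := e ^ 2 * μ ^ (4 * m + 11) with hX
  have hX0 : 0 ≤ X := by positivity
  have bound : ∀ (f g : SmoothPeriodic) (p q : ℝ), l2norm I f ≤ p → l2norm I g ≤ q →
      |I (f * g)| ≤ p * q := fun f g p q hp hq =>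
    (h.abs_integral_mul_le f g).trans
      (mul_le_mul hp hq (Real.sqrt_nonneg _) ((Real.sqrt_nonneg _).trans hp))
  have eM : ∀ c : ℝ, 0 ≤ c → c * e * X ≤ c * M * X := fun c hc => by
    gcongr; exact s.e_le
  have T1 : |I (w * leibnizRemainder D u m)| ≤ m * 2 ^ (m + 1) * e * X :=
    (bound _ _ _ _ hD.le N1).trans (le_of_eq (by rw [hX]; ring))
  have T2 := (bound _ _ _ _ hD.le N2).trans
    (le_of_eq (b := (2 ^ m * 8 * M + 4 * P ^ 2) * X) (by rw [hX]; ring))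
  have T3 := (bound _ _ _ _ M3 N3).trans
    (le_of_eq (b := 2 ^ m * 2 * C₁ * e * X) (by rw [hX]; ring))
  have T4 := (bound _ _ _ _ M2 N4).trans
    (le_of_eq (b := C₂ * e * X) (by rw [hX]; ring))
  have T5 := (bound _ _ _ _ M2 N5).trans
    (le_of_eq (b := 2 * C₁ * e * X) (by rw [hX]; ring))
  have hmain := s.integral_energyDeriv_eq
  have hle : 3 * I (2 * (⇑D)^[m + 2] u * derivSpeed D u a G (m + 2) + a * ((⇑D)^[m + 2] u) ^ 2)
      ≤ -2 * (K⁻¹ * (e * μ ^ (2 * m + 6)) ^ 2) + C₃ * X := by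
    refine (le_of_eq hmain).trans ?_
    rw [hC₃]
    exact sum_bound t0 (T1.trans (eM (m * 2 ^ (m + 1)) (by positivity))) T2
      (T3.trans (eM (2 ^ m * 2 * C₁) (by positivity))) (T4.trans (eM C₂ hC₂))
      (T5.trans (eM (2 * C₁) (by positivity)))
  have htarget : 0 ≤ C₃ * (K * C₃) ^ (4 * m + 11) * e ^ 2 := by positivity
  refine le_of_three_mul_le hle (by positivity) htarget ?_
  -- The dissipation `K⁻¹ μ X` beats the errors `C₃ X` once `μ ≥ K C₃`; below this threshold the
  -- errors themselves are bounded.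
  rcases le_total μ (K * C₃) with hcase | hcase
  · left
    calc C₃ * X = C₃ * μ ^ (4 * m + 11) * e ^ 2 := by rw [hX]; ring
      _ ≤ _ := by gcongr
  · right
    have : C₃ ≤ K⁻¹ * μ := by
      rw [inv_mul_eq_div, le_div_iff₀ hK, mul_comm]; exact hcase
    calc C₃ * X ≤ K⁻¹ * μ * X := by gcongr
      _ = _ := by rw [hX]; ring

end Scaled

/-- Higher order energy estimate: the rate of change of the energy of order `m + 2` is bounded by
the first energy, with a constant that only depends on bounds for the support function, the
length and the first energy. -/
theorem exists_energyDeriv_le (m : ℕ) (K L M : ℝ) (hK : 0 < K) (hL : 0 ≤ L) (hM : 0 ≤ M) :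
    ∃ C : ℝ, 0 ≤ C ∧ ∀ {D : Derivation ℝ SmoothPeriodic SmoothPeriodic}
    {I : SmoothPeriodic →ₗ[ℝ] ℝ} {u v a G : SmoothPeriodic}, ArcCalculus D I →
    SupportData D u v a G → (∀ x, v x ≤ K) → I 1 ≤ L → I (D u ^ 2) ≤ M ^ 2 →
    I (2 * (⇑D)^[m + 2] u * derivSpeed D u a G (m + 2) + a * ((⇑D)^[m + 2] u) ^ 2)
      ≤ C * I (D u ^ 2) := by
  obtain ⟨C, hC, hmain⟩ := Scaled.exists_energyDeriv_le m K (2 * L + 2) M hK hM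
  refine ⟨C, hC, fun {D I u v a G} h S hv hI hE => ?_⟩
  set b : ℕ → ℝ := fun k => l2norm I ((⇑D)^[k + 1] u) with hb
  have hsucc : ∀ k, (⇑D)^[k + 1] u = D ((⇑D)^[k] u) := fun k => Function.iterate_succ_apply' _ _ _
  have hb0 : b 0 ^ 2 = I (D u ^ 2) := by rw [hb, h.l2norm_sq, sq]; rfl
  -- The end point has index `m + 3`, that is order `m + 4`, so the dissipated norm is known
  -- exactly.
  obtain ⟨μ, hμ, hone, hle, htop⟩ := exists_geometric_majorant (m + 2) b
    (fun k => Real.sqrt_nonneg _)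
    (fun k => by
      simp only [hb]
      rw [hsucc (k + 1), hsucc (k + 2), hsucc (k + 1)]
      exact h.l2norm_deriv_sq_le _)
    -- Poincaré's inequality gives `2 L`; the summand 1 keeps the factor positive.
    (2 * L + 1) (by linarith)
    (fun k => by
      simp only [hb]
      rw [hsucc (k + 1), hsucc k]
      refine (h.l2norm_deriv_le _).trans ?_
      gcongr
      · exact Real.sqrt_nonneg _
      · linarith)
  have hsq : 1 ≤ (2 * L + 2) * μ ^ 2 := by linarith
  have s : Scaled m K (2 * L + 2) M D I u v a G (b 0) μ := by
    refine ⟨h, S, hv, Real.sqrt_nonneg _, abs_le_of_sq_le_sq' (by rwa [hb0]) hM |>.2, hμ, ?_, hsq,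
      ?_, ?_⟩
    · by_contra hcon
      push Not at hcon
      have : (2 * L + 2) * μ * ((2 * L + 2) * μ) < 1 * 1 := by gcongr
      nlinarith [sq_nonneg μ]
    · intro k hk x
      have h1 := h.sq_apply_deriv_le ((⇑D)^[k] u) x
      rw [← hsucc, ← hsucc] at h1
      have h2 := hle k (by omega)
      have h3 := hle (k + 1) (by omega)
      have h0 : 0 ≤ b 0 := Real.sqrt_nonneg _
      refine abs_le_of_sq_le_sq (h1.trans ?_) (by positivity)
      calc 2 * b k * b (k + 1) ≤ 2 * (b 0 * μ ^ (2 * k)) * (b 0 * μ ^ (2 * (k + 1))) := by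
            gcongr; exact Real.sqrt_nonneg _
        _ = 2 * (b 0 ^ 2 * μ ^ (4 * k + 2)) := by ring
        _ ≤ 4 * (b 0 ^ 2 * μ ^ (4 * k + 2)) := by
            have : 0 ≤ b 0 ^ 2 * μ ^ (4 * k + 2) := by positivity
            linarith
        _ = _ := by ring
    · intro k hk
      rw [← pow_mul]
      exact hle k hk
  have := hmain s (by rw [← pow_mul]; exact htop)
  rwa [hb0] at this

/-! ### The turning number of an embedded convex curve -/

/-- A left-turning arc with total turning `2π` that ends on its initial tangent line, ahead of its
initial point, crosses itself. -/
lemma exists_crossing {X Y ρ : ℝ → ℝ} (hρ : ∀ t, 0 < ρ t)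
    (hX : ∀ t, HasDerivAt X (ρ t * Real.cos t) t) (hY : ∀ t, HasDerivAt Y (ρ t * Real.sin t) t)
    (hY0 : Y (2 * Real.pi) = Y 0) (hX0 : X 0 < X (2 * Real.pi)) :
    ∃ s t, 0 ≤ s ∧ s < t ∧ t < s + 2 * Real.pi ∧ X s = X t ∧ Y s = Y t := by
  have hπ := Real.pi_pos
  have cX : Continuous X := continuous_iff_continuousAt.2 fun t => (hX t).continuousAt
  have cY : Continuous Y := continuous_iff_continuousAt.2 fun t => (hY t).continuousAt
  have up : StrictMonoOn Y (Icc 0 Real.pi) := by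
    refine strictMonoOn_of_deriv_pos (convex_Icc _ _) cY.continuousOn fun t ht => ?_
    rw [interior_Icc] at ht
    rw [(hY t).deriv]
    exact mul_pos (hρ t) (Real.sin_pos_of_mem_Ioo ht)
  have down : StrictAntiOn Y (Icc Real.pi (2 * Real.pi)) := by
    refine strictAntiOn_of_deriv_neg (convex_Icc _ _) cY.continuousOn fun t ht => ?_
    rw [interior_Icc] at ht
    rw [(hY t).deriv]
    refine mul_neg_of_pos_of_neg (hρ t) ?_
    have := Real.sin_pos_of_mem_Ioo (x := t - Real.pi) ⟨by linarith [ht.1], by linarith [ht.2]⟩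
    rw [Real.sin_sub_pi] at this
    linarith
  have left : StrictAntiOn X (Icc (Real.pi / 2) (Real.pi + Real.pi / 2)) := by
    refine strictAntiOn_of_deriv_neg (convex_Icc _ _) cX.continuousOn fun t ht => ?_
    rw [interior_Icc] at ht
    rw [(hX t).deriv]
    exact mul_neg_of_pos_of_neg (hρ t) (Real.cos_neg_of_pi_div_two_lt_of_lt ht.1 ht.2)
  have hYle : ∀ s ∈ Icc 0 Real.pi, Y s ∈ Icc (Y 0) (Y Real.pi) := fun s hs =>
    ⟨up.monotoneOn ⟨le_rfl, hπ.le⟩ hs hs.1, up.monotoneOn hs ⟨hπ.le, le_rfl⟩ hs.2⟩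
  have hYle' : ∀ t ∈ Icc Real.pi (2 * Real.pi), Y t ∈ Icc (Y 0) (Y Real.pi) := fun t ht =>
    ⟨hY0 ▸ down.antitoneOn ht ⟨by linarith, le_rfl⟩ ht.2,
      down.antitoneOn ⟨le_rfl, by linarith⟩ ht ht.1⟩
  -- On the descending branch `-Y` is an order isomorphism of intervals, so its inverse is
  -- automatically continuous.
  let g : Icc Real.pi (2 * Real.pi) → Icc (-Y Real.pi) (-Y 0) := fun t =>
    ⟨-Y t, neg_le_neg (hYle' t t.2).2, neg_le_neg (hYle' t t.2).1⟩
  have gmono : StrictMono g := fun a b hab => by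
    change -Y a < -Y b
    exact neg_lt_neg (down a.2 b.2 hab)
  have gsurj : Function.Surjective g := by
    rintro ⟨v, hv⟩
    have := intermediate_value_Icc' (a := Real.pi) (b := 2 * Real.pi) (by linarith)
      cY.continuousOn (show -v ∈ Icc _ _ from ⟨by rw [hY0]; linarith [hv.2], by linarith [hv.1]⟩)
    obtain ⟨t, ht, htv⟩ := this
    exact ⟨⟨t, ht⟩, Subtype.ext (by change -Y t = v; rw [htv, neg_neg])⟩
  let e := gmono.orderIsoOfSurjective g gsurj
  have he : ∀ v, -Y (e.symm v) = v := fun v => congrArg Subtype.val (e.apply_symm_apply v)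
  -- the point on the descending branch at a given height
  obtain ⟨b, hb, hbπ, hfb⟩ : ∃ b ∈ Icc (Real.pi / 2) Real.pi, b < Real.pi ∧
      ∀ t ∈ Icc Real.pi (2 * Real.pi), Y t = Y b → X t ≤ X b := by
    have mono : ∀ s ∈ Icc (Real.pi / 2) Real.pi, ∀ t ∈ Icc Real.pi (Real.pi + Real.pi / 2),
        X t ≤ X s := fun s hs t ht =>
      left.antitoneOn ⟨hs.1, by linarith [hs.2]⟩ ⟨by linarith [ht.1], ht.2⟩ (hs.2.trans ht.1)
    -- `X` decreases from `π/2` to `3π/2`, so `b` only has to be matched with a point not beyond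
    -- `3π/2`. The choice `b = π/2` works unless its height is too low; then `b` is taken at the
    -- height of `3π/2`.
    rcases le_total (Y (Real.pi + Real.pi / 2)) (Y (Real.pi / 2)) with hc | hc
    · refine ⟨Real.pi / 2, ⟨le_rfl, by linarith⟩, by linarith, fun t ht hYt => ?_⟩
      refine mono _ ⟨le_rfl, by linarith⟩ t ⟨ht.1, ?_⟩
      by_contra hcon
      push Not at hcon
      have := down ⟨by linarith, by linarith⟩ ht hcon
      linarith
    · have hlt := down (a := Real.pi) ⟨le_rfl, by linarith⟩
        (b := Real.pi + Real.pi / 2) ⟨by linarith, by linarith⟩ (by linarith)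
      obtain ⟨s, hs, hYs⟩ := intermediate_value_Icc (a := Real.pi / 2) (b := Real.pi) (by linarith)
        cY.continuousOn ⟨hc, hlt.le⟩
      refine ⟨s, hs, lt_of_le_of_ne hs.2 fun h => ?_, fun t ht hYt => ?_⟩
      · rw [h] at hYs; linarith
      · have : t = Real.pi + Real.pi / 2 :=
          down.injOn ht ⟨by linarith, by linarith⟩ (hYt.trans hYs)
        rw [this]
        exact mono s hs _ ⟨by linarith, le_rfl⟩
  have hb0 : 0 ≤ b := by linarith [hb.1]
  have hmem : ∀ s : Icc 0 b, (s : ℝ) ∈ Icc 0 Real.pi := fun s => ⟨s.2.1, s.2.2.trans hb.2⟩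
  let q : Icc 0 b → Icc Real.pi (2 * Real.pi) := fun s =>
    e.symm ⟨-Y s, neg_le_neg (hYle s (hmem s)).2, neg_le_neg (hYle s (hmem s)).1⟩
  have hq : ∀ s, Y (q s) = Y s := fun s => neg_injective (he _)
  have cq : Continuous q := e.symm.continuous.comp
    (Continuous.subtype_mk (cY.comp continuous_subtype_val).neg _)
  -- The horizontal gap between the branches at equal height: negative at 0, nonnegative at `b`, and
  -- zero at a crossing.
  let f : Icc 0 b → ℝ := fun s => X s - X (q s)
  have cf : Continuous f := (cX.comp continuous_subtype_val).sub
    (cX.comp (continuous_subtype_val.comp cq))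
  have : PreconnectedSpace (Icc 0 b) := isPreconnected_iff_preconnectedSpace.1 isPreconnected_Icc
  have hq0 : ∀ s : Icc 0 b, (s : ℝ) = 0 → (q s : ℝ) = 2 * Real.pi := fun s hs =>
    down.injOn (q s).2 ⟨by linarith, le_rfl⟩ (by rw [hq, hs, hY0])
  obtain ⟨s, hs⟩ : (0 : ℝ) ∈ range f := by
    refine mem_range_of_exists_le_of_exists_ge cf ⟨⟨0, le_rfl, hb0⟩, ?_⟩ ⟨⟨b, hb0, le_rfl⟩, ?_⟩
    · change X 0 - X (q _) ≤ 0
      rw [hq0 _ rfl]; linarith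
    · change 0 ≤ X b - X (q _)
      linarith [hfb _ (q ⟨b, hb0, le_rfl⟩).2 (hq _)]
  have hs' : X s - X (q s) = 0 := hs
  refine ⟨s, q s, s.2.1, (s.2.2.trans_lt hbπ).trans_le (q s).2.1, ?_, by linarith, (hq s).symm⟩
  rcases s.2.1.eq_or_lt with h0 | h0
  · rw [hq0 s h0.symm, ← h0] at hs'
    linarith
  · linarith [(q s).2.2]

/-- A closed curve parametrised by its tangent angle, with total turning `2πk`, which does not
cross itself, has turning number one. -/
lemma turning_eq_one {X Y ρ : ℝ → ℝ} {k : ℕ} (hk : 1 ≤ k) (hρ : ∀ t, 0 < ρ t)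
    (hX : ∀ t, HasDerivAt X (ρ t * Real.cos t) t) (hY : ∀ t, HasDerivAt Y (ρ t * Real.sin t) t)
    (pX : ∀ t, X (t + k * (2 * Real.pi)) = X t) (pY : ∀ t, Y (t + k * (2 * Real.pi)) = Y t)
    (hinj : ∀ s t, s < t → t < s + k * (2 * Real.pi) → X s = X t → Y s ≠ Y t) : k = 1 := by
  by_contra hk1
  have hk2 : 2 ≤ k := by omega
  have hk2' : (2 : ℝ) ≤ k := by exact_mod_cast hk2
  have hπ := Real.pi_pos
  -- `h` and `p` are the normal and tangential components of the position at tangent angle `t`.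
  -- Tangent lines at `t` and `t + 2π` are parallel, and coincide when `h` agrees there.
  set h : ℝ → ℝ := fun t => Real.cos t * Y t - Real.sin t * X t with hh
  set p : ℝ → ℝ := fun t => Real.cos t * X t + Real.sin t * Y t with hp
  have hder : ∀ t, HasDerivAt h (-p t) t := fun t => by
    have := ((Real.hasDerivAt_cos t).mul (hY t)).sub ((Real.hasDerivAt_sin t).mul (hX t))
    refine this.congr_deriv ?_
    simp only [hp]; ring
  have hper : ∀ t, h (t + k * (2 * Real.pi)) = h t := fun t => by
    simp only [hh, pX, pY, Real.cos_add_nat_mul_two_pi, Real.sin_add_nat_mul_two_pi]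
  have ch : Continuous h := continuous_iff_continuousAt.2 fun t => (hder t).continuousAt
  have inter : ∀ t, h (t + 2 * Real.pi) = h t → p (t + 2 * Real.pi) ≠ p t := by
    intro t h1 h2
    simp only [hh, hp, Real.cos_add_two_pi, Real.sin_add_two_pi] at h1 h2
    have hc := Real.cos_sq_add_sin_sq t
    have e1 : X t = X (t + 2 * Real.pi) := by
      linear_combination (X (t + 2 * Real.pi) - X t) * hc + Real.sin t * h1 - Real.cos t * h2
    have e2 : Y t = Y (t + 2 * Real.pi) := by
      linear_combination (Y (t + 2 * Real.pi) - Y t) * hc - Real.cos t * h1 - Real.sin t * h2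
    exact hinj t (t + 2 * Real.pi) (by linarith) (by nlinarith) e1 e2
  set d : ℝ → ℝ := fun t => h (t + 2 * Real.pi) - h t with hd
  have cd : Continuous d := (ch.comp (continuous_add_const _)).sub ch
  have dder : ∀ t, HasDerivAt d (-(p (t + 2 * Real.pi) - p t)) t := fun t => by
    refine (((hder (t + 2 * Real.pi)).comp_add_const t (2 * Real.pi)).sub (hder t)).congr_deriv ?_
    ring
  -- a minimum of `h`
  have hpos : 0 < k * (2 * Real.pi) := by positivity
  obtain ⟨t₀, ht₀⟩ : ∃ t₀, ∀ t, h t₀ ≤ h t := by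
    obtain ⟨x, -, hx⟩ := isCompact_Icc.exists_isMinOn (s := Icc 0 (k * (2 * Real.pi)))
      (nonempty_Icc.2 hpos.le) ch.continuousOn
    refine ⟨x, fun y => ?_⟩
    obtain ⟨z, hz, hyz⟩ := (show Function.Periodic h _ from hper).exists_mem_Ico₀ hpos y
    rw [hyz]
    exact hx (Ico_subset_Icc_self hz)
  have hmin : ∀ t, h t = h t₀ → p t = 0 := fun t ht => by
    have : IsLocalMin h t := Filter.Eventually.of_forall fun s => by rw [ht]; exact ht₀ s
    have := this.hasDerivAt_eq_zero (hder t)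
    linarith
  have hd0 : 0 < d t₀ := by
    refine lt_of_le_of_ne (sub_nonneg.2 (ht₀ _)) fun h0 => ?_
    have h1 : h (t₀ + 2 * Real.pi) = h t₀ := by simp only [hd] at h0; linarith
    exact inter t₀ h1 (by rw [hmin _ h1, hmin _ rfl])
  -- If `d` stayed positive, `h` would increase along `t₀ + 2πj`, against its period `2πk`.
  obtain ⟨t₂, ht₂, hdt₂⟩ : ∃ t₂, t₀ ≤ t₂ ∧ d t₂ ≤ 0 := by
    by_contra hcon
    push Not at hcon
    have : ∀ j : ℕ, 1 ≤ j → h t₀ < h (t₀ + j * (2 * Real.pi)) := by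
      intro j hj
      induction j, hj using Nat.le_induction with
      | base =>
        have := hcon t₀ le_rfl
        simp only [hd] at this
        simpa using this
      | succ j hj ih =>
        have := hcon (t₀ + j * (2 * Real.pi)) (by
          have : 0 ≤ (j : ℝ) * (2 * Real.pi) := by positivity
          linarith)
        simp only [hd] at this
        have e : t₀ + ((j + 1 : ℕ) : ℝ) * (2 * Real.pi) = t₀ + j * (2 * Real.pi) + 2 * Real.pi := by
          push_cast; ring
        rw [e]
        linarith
    have := this k hk
    rw [hper] at this
    exact lt_irrefl _ this
  -- the first common tangent
  set S : Set ℝ := {t | t₀ ≤ t ∧ d t ≤ 0} with hS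
  have Sne : S.Nonempty := ⟨t₂, ht₂, hdt₂⟩
  have Sbdd : BddBelow S := ⟨t₀, fun t ht => ht.1⟩
  have Sclosed : IsClosed S := isClosed_Ici.inter (isClosed_le cd continuous_const)
  set t₁ := sInf S with ht₁
  obtain ⟨h01, hd1⟩ := Sclosed.csInf_mem Sne Sbdd
  have hbefore : ∀ t, t₀ ≤ t → t < t₁ → 0 < d t := fun t h1 h2 => by
    by_contra hcon
    exact absurd (csInf_le Sbdd ⟨h1, not_lt.1 hcon⟩) (not_le.2 h2)
  have hlt : t₀ < t₁ := lt_of_le_of_ne h01 fun h => by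
    rw [← ht₁, ← h] at hd1; linarith
  have hev : ∀ᶠ t in nhdsWithin t₁ (Iio t₁), 0 < d t := by
    filter_upwards [Ioo_mem_nhdsLT hlt] with t ht using hbefore t ht.1.le ht.2
  have hd1' : d t₁ = 0 := le_antisymm hd1
    (ge_of_tendsto ((cd.tendsto t₁).mono_left nhdsWithin_le_nhds) (hev.mono fun t ht => ht.le))
  -- `d` is positive just before its first zero, so its derivative there is nonpositive. This places
  -- the later contact point ahead of the earlier one, as `exists_crossing` requires.
  have hp1 : 0 ≤ p (t₁ + 2 * Real.pi) - p t₁ := by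
    have h1 := (dder t₁).hasDerivWithinAt (s := Iio t₁)
    rw [hasDerivWithinAt_iff_tendsto_slope' (by simp)] at h1
    have : -(p (t₁ + 2 * Real.pi) - p t₁) ≤ 0 := by
      refine le_of_tendsto h1 ?_
      filter_upwards [hev, self_mem_nhdsWithin] with t ht htt
      rw [slope_def_field, hd1', sub_zero]
      exact div_nonpos_of_nonneg_of_nonpos ht.le (by linarith [mem_Iio.1 htt])
    linarith
  have hheq : h (t₁ + 2 * Real.pi) = h t₁ := by simp only [hd] at hd1'; linarith
  have hplt : p t₁ < p (t₁ + 2 * Real.pi) :=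
    lt_of_le_of_ne (by linarith) (inter t₁ hheq).symm
  -- rotate the common tangent into horizontal position
  obtain ⟨s, t, -, hst, hts, hXst, hYst⟩ := exists_crossing
    (X := fun t => Real.cos t₁ * X (t₁ + t) + Real.sin t₁ * Y (t₁ + t))
    (Y := fun t => Real.cos t₁ * Y (t₁ + t) - Real.sin t₁ * X (t₁ + t))
    (ρ := fun t => ρ (t₁ + t)) (fun t => hρ _)
    (fun t => by
      refine ((((hX (t₁ + t)).comp_const_add t₁ t).const_mul _).add
        (((hY (t₁ + t)).comp_const_add t₁ t).const_mul _)).congr_deriv ?_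
      rw [Real.cos_add, Real.sin_add]
      linear_combination ρ (t₁ + t) * Real.cos t * Real.cos_sq_add_sin_sq t₁)
    (fun t => by
      refine ((((hY (t₁ + t)).comp_const_add t₁ t).const_mul _).sub
        (((hX (t₁ + t)).comp_const_add t₁ t).const_mul _)).congr_deriv ?_
      rw [Real.cos_add, Real.sin_add]
      linear_combination ρ (t₁ + t) * Real.sin t * Real.cos_sq_add_sin_sq t₁)
    (by
      simp only [hh, Real.cos_add_two_pi, Real.sin_add_two_pi] at hheq
      simpa using hheq)
    (by
      simp only [hp, Real.cos_add_two_pi, Real.sin_add_two_pi] at hplt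
      simpa using hplt)
  have hc := Real.cos_sq_add_sin_sq t₁
  refine hinj (t₁ + s) (t₁ + t) (by linarith) (by nlinarith) ?_ ?_
  · linear_combination (X (t₁ + t) - X (t₁ + s)) * hc + Real.cos t₁ * hXst - Real.sin t₁ * hYst
  · linear_combination (Y (t₁ + t) - Y (t₁ + s)) * hc + Real.sin t₁ * hXst + Real.cos t₁ * hYst

/-! ### The tangent angle -/

lemma hasDerivAt_coord {f : ℝ → Plane} {f' : Plane} {x : ℝ} (h : HasDerivAt f f' x) (i : Fin 2) :
    HasDerivAt (fun y => f y i) (f' i) x :=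
  (EuclideanSpace.proj (𝕜 := ℝ) i).hasFDerivAt.comp_hasDerivAt x h

namespace IsStrictlyConvexCurve

variable {γ : ℝ → Plane}

lemma hasDerivAt (h : IsStrictlyConvexCurve γ) (x : ℝ) : HasDerivAt γ (deriv γ x) x :=
  (h.smooth.differentiable (by simp) x).hasDerivAt

lemma smooth_deriv (h : IsStrictlyConvexCurve γ) : ContDiff ℝ ∞ (deriv γ) :=
  (contDiff_infty_iff_deriv.1 h.smooth).2

lemma hasDerivAt_deriv (h : IsStrictlyConvexCurve γ) (x : ℝ) :
    HasDerivAt (deriv γ) (deriv (deriv γ) x) x :=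
  (h.smooth_deriv.differentiable (by simp) x).hasDerivAt

lemma periodic_deriv (h : IsStrictlyConvexCurve γ) : Function.Periodic (deriv γ) (2 * Real.pi) := by
  intro x
  rw [← deriv_comp_add_const]
  congr 1
  exact funext h.periodic

lemma injective_of_lt (h : IsStrictlyConvexCurve γ) {s t : ℝ} (hst : s < t)
    (hts : t < s + 2 * Real.pi) : γ s ≠ γ t := by
  intro heq
  have hp : 0 < 2 * Real.pi := by positivity
  obtain ⟨n, hn, -⟩ := existsUnique_sub_zsmul_mem_Ico hp s 0
  rw [zero_add] at hn
  have key : ∀ x : ℝ, ∀ n : ℤ, γ (x - n • (2 * Real.pi)) = γ x := fun x n =>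
    h.periodic.sub_zsmul_eq n
  rcases lt_or_ge (t - n • (2 * Real.pi)) (2 * Real.pi) with hc | hc
  · have := h.embedded hn ⟨by linarith [hn.1], hc⟩ (by rw [key, key, heq])
    linarith
  · have e : t - (n + 1) • (2 * Real.pi) = t - n • (2 * Real.pi) - 2 * Real.pi := by
      rw [add_smul, one_smul]; ring
    have := h.embedded hn (x₂ := t - (n + 1) • (2 * Real.pi))
      (by rw [e]; exact ⟨by linarith, by linarith [hn.2]⟩) (by rw [key, key, heq])
    rw [e] at this
    linarith

/-- The tangent angle of an embedded strictly convex closed curve. -/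
lemma exists_angle (h : IsStrictlyConvexCurve γ) : ∃ θ R : ℝ → ℝ, (∀ x, 0 < R x) ∧
    (∀ x, deriv γ x 0 = R x * Real.cos (θ x)) ∧ (∀ x, deriv γ x 1 = R x * Real.sin (θ x)) ∧
    StrictMono θ ∧ Continuous θ ∧ ∀ x, θ (x + 2 * Real.pi) = θ x + 2 * Real.pi := by
  have hπ := Real.pi_pos
  have hX1 := fun x => hasDerivAt_coord (h.hasDerivAt_deriv x) 0
  have hY1 := fun x => hasDerivAt_coord (h.hasDerivAt_deriv x) 1
  set X₁ : ℝ → ℝ := fun x => deriv γ x 0 with hX₁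
  set Y₁ : ℝ → ℝ := fun x => deriv γ x 1 with hY₁
  set X₂ : ℝ → ℝ := fun x => deriv (deriv γ) x 0 with hX₂
  set Y₂ : ℝ → ℝ := fun x => deriv (deriv γ) x 1 with hY₂
  have hΔ : ∀ x, 0 < X₁ x * Y₂ x - Y₁ x * X₂ x := h.convex
  have c2 : Continuous (deriv (deriv γ)) :=
    ((contDiff_infty_iff_deriv.1 h.smooth_deriv).2).continuous
  have cX₂ : Continuous X₂ := (EuclideanSpace.proj (𝕜 := ℝ) (0 : Fin 2)).continuous.comp c2
  have cY₂ : Continuous Y₂ := (EuclideanSpace.proj (𝕜 := ℝ) (1 : Fin 2)).continuous.comp c2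
  set Z : ℝ → ℂ := fun x => (X₁ x : ℂ) + Y₁ x * Complex.I with hZ
  set Z' : ℝ → ℂ := fun x => (X₂ x : ℂ) + Y₂ x * Complex.I with hZ'
  have hZd : ∀ x, HasDerivAt Z (Z' x) x := fun x =>
    (hX1 x).ofReal_comp.add ((hY1 x).ofReal_comp.mul_const _)
  have cZ : Continuous Z := continuous_iff_continuousAt.2 fun x => (hZd x).continuousAt
  have cZ' : Continuous Z' := by fun_prop
  have Zre : ∀ x, (Z x).re = X₁ x := fun x => by simp [hZ]
  have Zim : ∀ x, (Z x).im = Y₁ x := fun x => by simp [hZ]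
  have Zre' : ∀ x, (Z' x).re = X₂ x := fun x => by simp [hZ']
  have Zim' : ∀ x, (Z' x).im = Y₂ x := fun x => by simp [hZ']
  have Zne : ∀ x, Z x ≠ 0 := fun x h0 => by
    have h1 := Zre x
    have h2 := Zim x
    rw [h0] at h1 h2
    have := hΔ x
    rw [← h1, ← h2] at this
    simp at this
  have Zper : ∀ x, Z (x + 2 * Real.pi) = Z x := fun x => by
    simp only [hZ, hX₁, hY₁, h.periodic_deriv x]
  have cq : Continuous fun x => Z' x / Z x := cZ'.div cZ Zne
  -- A logarithm of `Z / Z 0`, obtained by integrating `Z' / Z` so that no branch of the argument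
  -- has to be chosen.
  set Λ : ℝ → ℂ := fun x => ∫ y in (0 : ℝ)..x, Z' y / Z y with hΛ
  have hΛd : ∀ x, HasDerivAt Λ (Z' x / Z x) x := fun x =>
    intervalIntegral.integral_hasDerivAt_right (cq.intervalIntegrable _ _)
      (cq.stronglyMeasurableAtFilter _ _) cq.continuousAt
  have hZexp : ∀ x, Z x = Z 0 * Complex.exp (Λ x) := by
    have hconst : ∀ x, HasDerivAt (fun x => Z x * Complex.exp (-Λ x)) 0 x := fun x => by
      refine ((hZd x).mul (hΛd x).neg.cexp).congr_deriv ?_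
      have := Zne x
      simp only [Pi.neg_apply]
      field_simp
      ring
    intro x
    have h1 := is_const_of_deriv_eq_zero (fun y => (hconst y).differentiableAt)
      (fun y => (hconst y).deriv) x 0
    have h0 : Λ 0 = 0 := by simp [hΛ]
    simp only [h0, neg_zero, Complex.exp_zero, mul_one] at h1
    rw [← h1, mul_assoc, ← Complex.exp_add]
    simp
  set θ : ℝ → ℝ := fun x => (Z 0).arg + (Λ x).im with hθ
  set R : ℝ → ℝ := fun x => ‖Z 0‖ * Real.exp (Λ x).re with hR
  have hRpos : ∀ x, 0 < R x := fun x => mul_pos (norm_pos_iff.2 (Zne 0)) (Real.exp_pos _)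
  have hpolar : ∀ x, Z x = R x * Complex.exp (θ x * Complex.I) := fun x => by
    rw [hZexp x, ← Complex.norm_mul_exp_arg_mul_I (Z 0)]
    simp only [hR, hθ]
    push_cast
    rw [mul_assoc, mul_assoc, ← Complex.exp_add, ← Complex.exp_add]
    congr 2
    conv_lhs => rw [← Complex.re_add_im (Λ x)]
    ring
  have hX : ∀ x, X₁ x = R x * Real.cos (θ x) := fun x => by
    rw [← Zre, hpolar, Complex.re_ofReal_mul, Complex.exp_ofReal_mul_I_re]
  have hY : ∀ x, Y₁ x = R x * Real.sin (θ x) := fun x => by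
    rw [← Zim, hpolar, Complex.im_ofReal_mul, Complex.exp_ofReal_mul_I_im]
  have hθd : ∀ x, HasDerivAt θ ((Z' x / Z x).im) x := fun x =>
    (Complex.imCLM.hasFDerivAt.comp_hasDerivAt x (hΛd x)).const_add _
  have hθpos : ∀ x, 0 < (Z' x / Z x).im := fun x => by
    rw [Complex.div_im, Zre, Zim, Zre', Zim', ← sub_div]
    exact div_pos (by linarith [hΔ x]) (Complex.normSq_pos.2 (Zne x))
  have hθmono : StrictMono θ := strictMono_of_deriv_pos fun x => by
    rw [(hθd x).deriv]; exact hθpos x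
  have cθ : Continuous θ := continuous_iff_continuousAt.2 fun x => (hθd x).continuousAt
  -- total turning
  have hqper : Function.Periodic (fun x => Z' x / Z x) (2 * Real.pi) := fun x => by
    have h1 : Z' (x + 2 * Real.pi) = Z' x := by
      have h2 : HasDerivAt Z (Z' (x + 2 * Real.pi)) x := by
        have := (hZd (x + 2 * Real.pi)).comp_add_const x (2 * Real.pi)
        exact this.congr_of_eventuallyEq (Filter.Eventually.of_forall fun y => (Zper y).symm)
      exact h2.unique (hZd x)
    simp only [h1, Zper]
  have hΛper : ∀ x, Λ (x + 2 * Real.pi) = Λ x + Λ (2 * Real.pi) := fun x => by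
    simp only [hΛ]
    rw [← intervalIntegral.integral_add_adjacent_intervals (cq.intervalIntegrable 0 x)
      (cq.intervalIntegrable x _), hqper.intervalIntegral_add_eq x 0, zero_add]
  have hexp1 : Complex.exp (Λ (2 * Real.pi)) = 1 := by
    have h1 := hZexp (2 * Real.pi)
    have h2 := Zper 0
    rw [zero_add] at h2
    rw [h2] at h1
    exact mul_left_cancel₀ (Zne 0) (by rw [← h1, mul_one])
  obtain ⟨n, hn⟩ := Complex.exp_eq_one_iff.1 hexp1
  have hθn : ∀ x, θ (x + 2 * Real.pi) = θ x + n * (2 * Real.pi) := fun x => by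
    simp only [hθ, hΛper, Complex.add_im, hn]
    simp
    ring
  have hnpos : 0 < n := by
    have h1 := hθmono (show (0 : ℝ) < 0 + 2 * Real.pi by positivity)
    rw [hθn 0] at h1
    have h2 : (0 : ℝ) < n * (2 * Real.pi) := by linarith
    exact_mod_cast pos_of_mul_pos_left h2 (by positivity)
  obtain ⟨k, rfl⟩ := Int.eq_ofNat_of_zero_le hnpos.le
  have hk : 1 ≤ k := by exact_mod_cast hnpos
  have hθk : ∀ x, θ (x + 2 * Real.pi) = θ x + k * (2 * Real.pi) := by simpa using hθn
  have hθmul : ∀ (j : ℕ), θ (j * (2 * Real.pi)) = θ 0 + j * (k * (2 * Real.pi)) ∧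
      θ (-(j * (2 * Real.pi))) = θ 0 - j * (k * (2 * Real.pi)) := by
    intro j
    induction j with
    | zero => simp
    | succ j ih =>
      constructor
      · have := hθk (j * (2 * Real.pi))
        push_cast
        rw [add_mul, one_mul, this, ih.1]; ring
      · have := hθk (-((j + 1 : ℝ) * (2 * Real.pi)))
        rw [show -((j + 1 : ℝ) * (2 * Real.pi)) + 2 * Real.pi = -(j * (2 * Real.pi)) by ring,
          ih.2] at this
        push_cast
        linarith
  have hk' : (1 : ℝ) ≤ k := by exact_mod_cast hk
  have hθsurj : Function.Surjective θ := by
    intro y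
    obtain ⟨j, hj⟩ := exists_nat_gt (|y - θ 0| / (2 * Real.pi))
    rw [div_lt_iff₀ (by positivity)] at hj
    have h1 : (j : ℝ) * (2 * Real.pi) ≤ j * (k * (2 * Real.pi)) := by
      have : 0 ≤ (j : ℝ) * (2 * Real.pi) := by positivity
      nlinarith
    refine mem_range_of_exists_le_of_exists_ge cθ ⟨-(j * (2 * Real.pi)), ?_⟩
      ⟨j * (2 * Real.pi), ?_⟩
    · rw [(hθmul j).2]; linarith [neg_abs_le (y - θ 0)]
    · rw [(hθmul j).1]; linarith [le_abs_self (y - θ 0)]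
  -- Reparametrisation by the tangent angle brings the curve into the form of `turning_eq_one`.
  let e := hθmono.orderIsoOfSurjective θ hθsurj
  set ψ : ℝ → ℝ := fun t => e.symm t with hψ
  have hθψ : ∀ t, θ (ψ t) = t := e.apply_symm_apply
  have hψθ : ∀ x, ψ (θ x) = x := e.symm_apply_apply
  have hψmono : StrictMono ψ := e.symm.strictMono
  have hψd : ∀ t, HasDerivAt ψ ((Z' (ψ t) / Z (ψ t)).im)⁻¹ t := fun t =>
    HasDerivAt.of_local_left_inverse e.symm.continuous.continuousAt (hθd (ψ t))
      (hθpos _).ne' (Filter.Eventually.of_forall hθψ)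
  have hψk : ∀ t, ψ (t + k * (2 * Real.pi)) = ψ t + 2 * Real.pi := fun t => by
    apply hθmono.injective
    rw [hθψ, hθk, hθψ]
  have hcoord := fun t i => (hasDerivAt_coord (h.hasDerivAt (ψ t)) i).comp t (hψd t)
  have hk1 : k = 1 := turning_eq_one (X := fun t => γ (ψ t) 0) (Y := fun t => γ (ψ t) 1)
    (ρ := fun t => R (ψ t) * ((Z' (ψ t) / Z (ψ t)).im)⁻¹) hk
    (fun t => mul_pos (hRpos _) (inv_pos.2 (hθpos _)))
    (fun t => (hcoord t 0).congr_deriv (by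
      change X₁ (ψ t) * _ = _
      rw [hX, hθψ]; ring))
    (fun t => (hcoord t 1).congr_deriv (by
      change Y₁ (ψ t) * _ = _
      rw [hY, hθψ]; ring))
    (fun t => by simp only [hψk, h.periodic (ψ t)])
    (fun t => by simp only [hψk, h.periodic (ψ t)])
    (fun s t hst hts hx hy => by
      refine h.injective_of_lt (hψmono hst) (by rw [← hψk]; exact hψmono hts) ?_
      ext i
      fin_cases i
      · exact hx
      · exact hy)
  exact ⟨θ, R, hRpos, hX, hY, hθmono, cθ, fun x => by simpa [hk1] using hθk x⟩

end IsStrictlyConvexCurve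

/-! ### Supporting lines of an origin-symmetric convex curve -/

lemma bracket_swap (u v : Plane) : bracket u v = -bracket v u := by
  simp only [bracket]; ring

lemma bracket_self (u : Plane) : bracket u u = 0 := by
  simp only [bracket]; ring

lemma bracket_neg_right (u v : Plane) : bracket u (-v) = -bracket u v := by
  simp only [bracket, PiLp.neg_apply]; ring

lemma bracket_neg_left (u v : Plane) : bracket (-u) v = -bracket u v := by
  simp only [bracket, PiLp.neg_apply]; ring

lemma bracket_plucker (p q u v : Plane) :
    bracket p q * bracket u v = bracket u q * bracket p v - bracket p u * bracket v q := by
  simp only [bracket]; ring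

lemma hasDerivAt_bracket {f k : ℝ → Plane} {f' k' : Plane} {x : ℝ} (hf : HasDerivAt f f' x)
    (hk : HasDerivAt k k' x) :
    HasDerivAt (fun y => bracket (f y) (k y)) (bracket f' (k x) + bracket (f x) k') x := by
  have := ((hasDerivAt_coord hf 0).mul (hasDerivAt_coord hk 1)).sub
    ((hasDerivAt_coord hf 1).mul (hasDerivAt_coord hk 0))
  refine this.congr_deriv ?_
  simp only [bracket]; ring

lemma hasDerivAt_bracket_right (p : Plane) {k : ℝ → Plane} {k' : Plane} {x : ℝ}
    (hk : HasDerivAt k k' x) : HasDerivAt (fun y => bracket p (k y)) (bracket p k') x := by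
  refine (hasDerivAt_bracket (hasDerivAt_const x p) hk).congr_deriv ?_
  simp [bracket]

lemma hasDerivAt_bracket_left (p : Plane) {k : ℝ → Plane} {k' : Plane} {x : ℝ}
    (hk : HasDerivAt k k' x) : HasDerivAt (fun y => bracket (k y) p) (bracket k' p) x := by
  refine (hasDerivAt_bracket hk (hasDerivAt_const x p)).congr_deriv ?_
  simp [bracket]

/-- A function with values in `[-N, N]` which first increases and then decreases has total
variation at most `4 N`. -/
lemma integral_abs_deriv_le {f f' : ℝ → ℝ} {a m b N : ℝ} (hf : ∀ x, HasDerivAt f (f' x) x)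
    (cf' : Continuous f') (ham : a ≤ m) (hmb : m ≤ b) (hN : ∀ x, |f x| ≤ N)
    (h1 : ∀ x ∈ Ioo a m, 0 ≤ f' x) (h2 : ∀ x ∈ Ioo m b, f' x ≤ 0) :
    ∫ x in a..b, |f' x| ≤ 4 * N := by
  have ci : ∀ p q, IntervalIntegrable f' MeasureTheory.volume p q := fun p q =>
    cf'.intervalIntegrable p q
  have ci' : ∀ p q, IntervalIntegrable (fun x => |f' x|) MeasureTheory.volume p q := fun p q =>
    cf'.abs.intervalIntegrable p q
  have i1 : ∫ x in a..m, |f' x| = f m - f a := by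
    rw [← intervalIntegral.integral_eq_sub_of_hasDerivAt (fun x _ => hf x) (ci a m),
      intervalIntegral.integral_of_le ham, intervalIntegral.integral_of_le ham,
      MeasureTheory.integral_Ioc_eq_integral_Ioo, MeasureTheory.integral_Ioc_eq_integral_Ioo]
    exact MeasureTheory.setIntegral_congr_fun measurableSet_Ioo fun x hx => abs_of_nonneg (h1 x hx)
  have i2 : ∫ x in m..b, |f' x| = -(f b - f m) := by
    rw [← intervalIntegral.integral_eq_sub_of_hasDerivAt (fun x _ => hf x) (ci m b),
      ← intervalIntegral.integral_neg,
      intervalIntegral.integral_of_le hmb, intervalIntegral.integral_of_le hmb,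
      MeasureTheory.integral_Ioc_eq_integral_Ioo, MeasureTheory.integral_Ioc_eq_integral_Ioo]
    exact MeasureTheory.setIntegral_congr_fun measurableSet_Ioo fun x hx => abs_of_nonpos (h2 x hx)
  rw [← intervalIntegral.integral_add_adjacent_intervals (ci' a m) (ci' m b), i1, i2]
  have := abs_le.1 (hN m)
  have := abs_le.1 (hN a)
  have := abs_le.1 (hN b)
  linarith

namespace IsStrictlyConvexCurve

variable {γ : ℝ → Plane}

lemma continuous_deriv (h : IsStrictlyConvexCurve γ) : Continuous (deriv γ) :=
  h.smooth_deriv.continuous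

lemma continuous_deriv_deriv (h : IsStrictlyConvexCurve γ) : Continuous (deriv (deriv γ)) :=
  (contDiff_infty_iff_deriv.1 h.smooth_deriv).2.continuous

/-- The tangent angle increases by exactly `2π` over a period, so the sine of its increment changes
sign once, at the half turn. -/
lemma exists_half_turn (h : IsStrictlyConvexCurve γ) (a : ℝ) :
    ∃ m ∈ Ioo a (a + 2 * Real.pi), (∀ x ∈ Ioo a m, 0 < bracket (deriv γ a) (deriv γ x)) ∧
      ∀ x ∈ Ioo m (a + 2 * Real.pi), bracket (deriv γ a) (deriv γ x) < 0 := by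
  obtain ⟨θ, R, hR, hX, hY, hmono, cθ, hper⟩ := h.exists_angle
  have hπ := Real.pi_pos
  have key : ∀ x, bracket (deriv γ a) (deriv γ x) = R a * R x * Real.sin (θ x - θ a) := fun x => by
    simp only [bracket]
    rw [hX, hY, hX, hY, Real.sin_sub]; ring
  obtain ⟨m, hm, hθm⟩ := intermediate_value_Ioo (a := a) (b := a + 2 * Real.pi) (by linarith)
    cθ.continuousOn (show θ a + Real.pi ∈ Ioo _ _ by
      rw [hper]; exact ⟨by linarith, by linarith⟩)
  refine ⟨m, hm, fun x hx => ?_, fun x hx => ?_⟩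
  · rw [key]
    have h1 := hmono hx.1
    have h2 := hmono hx.2
    exact mul_pos (mul_pos (hR _) (hR _)) (Real.sin_pos_of_pos_of_lt_pi (by linarith) (by linarith))
  · rw [key]
    have h1 := hmono hx.1
    have h2 := hmono hx.2
    rw [hper] at h2
    refine mul_neg_of_pos_of_neg (mul_pos (hR _) (hR _)) ?_
    have := Real.sin_pos_of_pos_of_lt_pi (x := θ x - θ a - Real.pi) (by linarith) (by linarith)
    rw [Real.sin_sub_pi] at this
    linarith

/-- The height over the tangent line at `a` rises for half a turn and then falls back to its initial
value, so it is strictly larger in between. -/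
lemma bracket_tangent_lt (h : IsStrictlyConvexCurve γ) {a b : ℝ} (hab : γ b ≠ γ a) :
    bracket (deriv γ a) (γ a) < bracket (deriv γ a) (γ b) := by
  have hπ := Real.pi_pos
  obtain ⟨c, hc, hbc⟩ := h.periodic.exists_mem_Ico (by positivity) b a
  rw [hbc] at hab ⊢
  have hca : a < c := lt_of_le_of_ne hc.1 fun he => hab (by rw [he])
  obtain ⟨m, hm, h1, h2⟩ := h.exists_half_turn a
  set f : ℝ → ℝ := fun x => bracket (deriv γ a) (γ x) with hf
  have hfd : ∀ x, HasDerivAt f (bracket (deriv γ a) (deriv γ x)) x := fun x =>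
    hasDerivAt_bracket_right _ (h.hasDerivAt x)
  have cf : Continuous f := continuous_iff_continuousAt.2 fun x => (hfd x).continuousAt
  have up : StrictMonoOn f (Icc a m) := strictMonoOn_of_deriv_pos (convex_Icc _ _) cf.continuousOn
    fun x hx => by rw [interior_Icc] at hx; rw [(hfd x).deriv]; exact h1 x hx
  have down : StrictAntiOn f (Icc m (a + 2 * Real.pi)) :=
    strictAntiOn_of_deriv_neg (convex_Icc _ _) cf.continuousOn
    fun x hx => by rw [interior_Icc] at hx; rw [(hfd x).deriv]; exact h2 x hx
  rcases le_total c m with hcm | hcm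
  · exact up ⟨le_rfl, hm.1.le⟩ ⟨hca.le, hcm⟩ hca
  · have : f (a + 2 * Real.pi) < f c := down ⟨hcm, hc.2.le⟩ ⟨hm.2.le, le_rfl⟩ hc.2
    simp only [hf, h.periodic a] at this
    exact this

lemma bracket_tangent_le (h : IsStrictlyConvexCurve γ) (a b : ℝ) :
    bracket (deriv γ a) (γ a) ≤ bracket (deriv γ a) (γ b) := by
  by_cases hab : γ b = γ a
  · rw [hab]
  · exact (h.bracket_tangent_lt hab).le

/-- Otherwise a point and its antipode would both lie strictly on the same side of a line through
the origin. -/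
lemma ne_zero (h : IsStrictlyConvexCurve γ) (hs : IsOriginSymmetric γ) (a : ℝ) : γ a ≠ 0 := by
  intro h0
  have hπ := Real.pi_pos
  have hb := h.injective_of_lt (s := a) (t := a + Real.pi) (by linarith) (by linarith)
  obtain ⟨c, hc⟩ := hs (a + Real.pi)
  have h1 := h.bracket_tangent_lt hb.symm
  have h2 := h.bracket_tangent_lt (a := a) (b := c) (by
    intro he
    rw [hc, h0, neg_eq_zero] at he
    exact hb (by rw [h0, he]))
  rw [hc, bracket_neg_right] at h2
  have : bracket (deriv γ a) (γ a) = 0 := by rw [h0]; simp [bracket]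
  linarith

lemma bracket_pos (h : IsStrictlyConvexCurve γ) (hs : IsOriginSymmetric γ) (a : ℝ) :
    0 < bracket (γ a) (deriv γ a) := by
  obtain ⟨b, hb⟩ := hs a
  have hne : γ b ≠ γ a := fun he => h.ne_zero hs a (by
    have h2 : γ a = -γ a := he.symm.trans hb
    ext i
    have := congrArg (fun p : Plane => p i) h2
    simp only [PiLp.neg_apply] at this
    simp only [PiLp.zero_apply]
    linarith)
  have := h.bracket_tangent_lt hne
  rw [hb, bracket_neg_right, bracket_swap] at this
  linarith

lemma abs_bracket_tangent_le (h : IsStrictlyConvexCurve γ) (hs : IsOriginSymmetric γ) (a b : ℝ) :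
    |bracket (deriv γ a) (γ b)| ≤ bracket (γ a) (deriv γ a) := by
  obtain ⟨c, hc⟩ := hs b
  have h1 := h.bracket_tangent_le a b
  have h2 := h.bracket_tangent_le a c
  rw [hc, bracket_neg_right] at h2
  rw [bracket_swap (γ a), abs_le]
  constructor <;> linarith

lemma abs_bracket_tangent_lt (h : IsStrictlyConvexCurve γ) (hs : IsOriginSymmetric γ) {a b : ℝ}
    (h1 : γ b ≠ γ a) (h2 : γ b ≠ -γ a) :
    |bracket (deriv γ a) (γ b)| < bracket (γ a) (deriv γ a) := by
  obtain ⟨c, hc⟩ := hs b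
  have h1 := h.bracket_tangent_lt h1
  have h2 := h.bracket_tangent_lt (a := a) (b := c) (by
    rw [hc]; intro he; exact h2 (by rw [← he, neg_neg]))
  rw [hc, bracket_neg_right] at h2
  rw [bracket_swap (γ a), abs_lt]
  constructor <;> linarith

/-- If the two positions were parallel, the product of the values `[γ, γ_x]` at `a` and `b` would
equal a product of two numbers strictly smaller in absolute value. -/
lemma bracket_ne_zero (h : IsStrictlyConvexCurve γ) (hs : IsOriginSymmetric γ) {a b : ℝ}
    (h1 : γ b ≠ γ a) (h2 : γ b ≠ -γ a) : bracket (γ a) (γ b) ≠ 0 := by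
  intro h0
  have ha := h.bracket_pos hs a
  have hb := h.bracket_pos hs b
  have k1 := h.abs_bracket_tangent_lt hs h1 h2
  have k2 := h.abs_bracket_tangent_lt hs (a := b) (b := a) h1.symm
    (fun he => h2 (by rw [he, neg_neg]))
  have p : bracket (γ a) (deriv γ a) * bracket (γ b) (deriv γ b)
      = bracket (deriv γ a) (γ b) * bracket (deriv γ b) (γ a) := by
    simp only [bracket] at h0 ⊢
    linear_combination (deriv γ a 0 * deriv γ b 1 - deriv γ a 1 * deriv γ b 0) * h0
  have := mul_lt_mul'' k1 k2 (abs_nonneg _) (abs_nonneg _)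
  rw [← abs_mul, ← p, abs_of_pos (mul_pos ha hb)] at this
  exact lt_irrefl _ this

/-- Along the arc from a point to its antipode the position vector stays on one side. -/
lemma bracket_pos_of_antipode (h : IsStrictlyConvexCurve γ) (hs : IsOriginSymmetric γ)
    {q q' : ℝ} (hq' : γ q' = -γ q) (hlt : q' ≤ q + 2 * Real.pi) {x : ℝ} (hx : x ∈ Ioo q q') :
    0 < bracket (γ q) (γ x) := by
  have hne : ∀ y ∈ Ioo q q', bracket (γ q) (γ y) ≠ 0 := fun y hy =>
    h.bracket_ne_zero hs (h.injective_of_lt hy.1 (hy.2.trans_le hlt)).symm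
      (hq' ▸ h.injective_of_lt hy.2 (by linarith [hy.1]))
  have hd : ∀ y, HasDerivAt (fun y => bracket (γ q) (γ y)) (bracket (γ q) (deriv γ y)) y := fun y =>
    hasDerivAt_bracket_right _ (h.hasDerivAt y)
  have hc : Continuous fun y => bracket (γ q) (γ y) :=
    continuous_iff_continuousAt.2 fun y => (hd y).continuousAt
  by_contra hcon
  have hxneg : bracket (γ q) (γ x) < 0 := lt_of_le_of_ne (not_lt.1 hcon) (hne x hx)
  -- The bracket vanishes at `q` with positive slope, so a later negative value would force a zero
  -- inside the arc.
  have hslope := ((hasDerivAt_iff_tendsto_slope.1 (hd q)).eventually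
    (eventually_gt_nhds (h.bracket_pos hs q))).filter_mono
    (nhdsWithin_mono q (fun y (hy : y ∈ Ioi q) => ne_of_gt hy))
  obtain ⟨y, hy, hyx⟩ := (hslope.and (Ioo_mem_nhdsGT hx.1)).exists
  rw [slope_def_field, bracket_self, sub_zero] at hy
  have hypos : 0 < bracket (γ q) (γ y) := by
    have : 0 < y - q := by linarith [hyx.1]
    exact (div_pos_iff_of_pos_right this).1 hy
  obtain ⟨z, hz, hz0⟩ := intermediate_value_Icc' hyx.2.le hc.continuousOn
    (show (0 : ℝ) ∈ Icc _ _ from ⟨hxneg.le, hypos.le⟩)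
  exact hne z ⟨hyx.1.trans_le hz.1, hz.2.trans_lt hx.2⟩ hz0

end IsStrictlyConvexCurve

/-! ### A weak Blaschke-Santaló inequality -/

namespace IsStrictlyConvexCurve

variable {γ : ℝ → Plane}

lemma continuous_bracket {f k : ℝ → Plane} (hf : Continuous f) (hk : Continuous k) :
    Continuous fun x => bracket (f x) (k x) := by
  unfold bracket
  fun_prop

/-- The largest parallelogram spanned by two points of the curve provides the frame in which both
areas are estimated. -/
lemma exists_forall_bracket_le (h : IsStrictlyConvexCurve γ) :
    ∃ p q, ∀ x y, bracket (γ x) (γ y) ≤ bracket (γ p) (γ q) := by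
  have hp : 0 < 2 * Real.pi := by positivity
  have hc : Continuous fun z : ℝ × ℝ => bracket (γ z.1) (γ z.2) := by
    have := h.smooth.continuous
    unfold bracket
    fun_prop
  obtain ⟨⟨p, q⟩, -, hpq⟩ := (isCompact_Icc.prod isCompact_Icc).exists_isMaxOn
    (s := Icc 0 (2 * Real.pi) ×ˢ Icc 0 (2 * Real.pi))
    ⟨(0, 0), ⟨le_rfl, hp.le⟩, ⟨le_rfl, hp.le⟩⟩ hc.continuousOn
  refine ⟨p, q, fun x y => ?_⟩
  obtain ⟨x', hx', hx⟩ := h.periodic.exists_mem_Ico₀ hp x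
  obtain ⟨y', hy', hy⟩ := h.periodic.exists_mem_Ico₀ hp y
  rw [hx, hy]
  exact hpq (mk_mem_prod (Ico_subset_Icc_self hx') (Ico_subset_Icc_self hy'))

lemma exists_eq_smul_of_bracket_eq_zero {u v : Plane} (hu : u ≠ 0) (h0 : bracket u v = 0) :
    ∃ c : ℝ, v = c • u := by
  simp only [bracket] at h0
  by_cases hu0 : u 0 = 0
  · have hu1 : u 1 ≠ 0 := fun hu1 => hu (by ext i; fin_cases i <;> simpa)
    refine ⟨v 1 / u 1, ?_⟩
    ext i
    fin_cases i
    · simp only [hu0, zero_mul, zero_sub, neg_eq_zero, mul_eq_zero, hu1, false_or] at h0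
      simp [hu0, h0]
    · simp [hu1]
  · refine ⟨v 0 / u 0, ?_⟩
    ext i
    fin_cases i
    · simp [hu0]
    · simp only [Fin.mk_one, PiLp.smul_apply, smul_eq_mul]
      field_simp
      linarith

/-- Total variation of a coordinate along the curve, in a direction that occurs as a tangent. -/
lemma integral_abs_bracket_deriv_le (h : IsStrictlyConvexCurve γ) {q : Plane} {p N : ℝ}
    (hq : bracket (deriv γ p) q = 0) (hN : ∀ x, |bracket q (γ x)| ≤ N) :
    ∫ x in (0 : ℝ)..(2 * Real.pi), |bracket q (deriv γ x)| ≤ 4 * N := by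
  have hne : deriv γ p ≠ 0 := fun h0 => by
    have := h.convex p
    rw [h0] at this
    simp [bracket] at this
  obtain ⟨c, rfl⟩ := exists_eq_smul_of_bracket_eq_zero hne hq
  have hsm : ∀ v, bracket (c • deriv γ p) v = c * bracket (deriv γ p) v := fun v => by
    simp only [bracket, PiLp.smul_apply, smul_eq_mul]; ring
  simp only [hsm, abs_mul] at hN ⊢
  rw [intervalIntegral.integral_const_mul]
  have hN0 : 0 ≤ N := le_trans (by positivity) (hN 0)
  rcases eq_or_ne c 0 with rfl | hc
  · simp; positivity
  have hc' : 0 < |c| := abs_pos.2 hc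
  obtain ⟨m, hm, h1, h2⟩ := h.exists_half_turn p
  have hper : Function.Periodic (fun x => |bracket (deriv γ p) (deriv γ x)|) (2 * Real.pi) :=
    fun x => by simp only [h.periodic_deriv x]
  have e := hper.intervalIntegral_add_eq 0 p
  rw [zero_add] at e
  rw [e]
  have := integral_abs_deriv_le (f := fun x => bracket (deriv γ p) (γ x)) (N := N / |c|)
    (fun x => hasDerivAt_bracket_right _ (h.hasDerivAt x))
    (continuous_bracket continuous_const h.continuous_deriv) hm.1.le hm.2.le
    (fun x => by rw [le_div_iff₀ hc', mul_comm]; exact hN x) (fun x hx => (h1 x hx).le)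
    (fun x hx => (h2 x hx).le)
  calc |c| * _ ≤ |c| * (4 * (N / |c|)) := by gcongr
    _ = 4 * N := by field_simp

/-- Total variation of a coordinate along the polar curve. -/
lemma integral_abs_bracket_mul_le (h : IsStrictlyConvexCurve γ) (hs : IsOriginSymmetric γ) (q : ℝ) :
    ∫ x in (0 : ℝ)..(2 * Real.pi), |bracket (γ q) (γ x) *
      (bracket (deriv γ x) (deriv (deriv γ) x) / bracket (γ x) (deriv γ x) ^ 2)| ≤ 4 := by
  have hπ := Real.pi_pos
  obtain ⟨r, hr⟩ := hs q
  obtain ⟨q', hq', hrq⟩ := h.periodic.exists_mem_Ico (show 0 < 2 * Real.pi by positivity) r q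
  rw [hrq] at hr
  have hqq' : q < q' := lt_of_le_of_ne hq'.1 fun he => by
    have := h.bracket_pos_of_antipode hs (q := q) (q' := q + 2 * Real.pi)
    have h0 := h.bracket_pos hs q
    rw [← he] at hr
    have : bracket (γ q) (deriv γ q) = -bracket (γ q) (deriv γ q) := by
      conv_lhs => rw [hr, bracket_neg_left]
    linarith
  have hS := h.bracket_pos hs
  have hSd : ∀ x, HasDerivAt (fun x => bracket (γ x) (deriv γ x))
      (bracket (γ x) (deriv (deriv γ) x)) x := fun x => by
    refine (hasDerivAt_bracket (h.hasDerivAt x) (h.hasDerivAt_deriv x)).congr_deriv ?_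
    rw [bracket_self, zero_add]
  -- `γ_x / [γ, γ_x]` traces the polar curve up to a quarter turn. The integrand is the derivative
  -- of one of its linear coordinates, which is bounded by one and monotone between `q` and its
  -- antipode.
  have hfd : ∀ x, HasDerivAt (fun x => bracket (deriv γ x) (γ q) / bracket (γ x) (deriv γ x))
      (bracket (γ q) (γ x) *
      (bracket (deriv γ x) (deriv (deriv γ) x) / bracket (γ x) (deriv γ x) ^ 2)) x := fun x => by
    refine ((hasDerivAt_bracket_left (γ q) (h.hasDerivAt_deriv x)).div (hSd x)
      (hS x).ne').congr_deriv ?_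
    rw [← mul_div_assoc]
    congr 1
    simp only [bracket]; ring
  have hcont : Continuous fun x => bracket (γ q) (γ x) *
      (bracket (deriv γ x) (deriv (deriv γ) x) / bracket (γ x) (deriv γ x) ^ 2) :=
    (continuous_bracket continuous_const h.smooth.continuous).mul
      ((continuous_bracket h.continuous_deriv h.continuous_deriv_deriv).div
      ((continuous_bracket h.smooth.continuous h.continuous_deriv).pow 2)
      fun x => pow_ne_zero 2 (hS x).ne')
  have hpos : ∀ x, 0 ≤ bracket (deriv γ x) (deriv (deriv γ) x) / bracket (γ x) (deriv γ x) ^ 2 :=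
    fun x => div_nonneg (h.convex x).le (sq_nonneg _)
  have hper' : Function.Periodic (deriv (deriv γ)) (2 * Real.pi) := fun x => by
    rw [← deriv_comp_add_const]
    congr 1
    exact funext h.periodic_deriv
  have hper : Function.Periodic (fun x => |bracket (γ q) (γ x) *
      (bracket (deriv γ x) (deriv (deriv γ) x) / bracket (γ x) (deriv γ x) ^ 2)|) (2 * Real.pi) :=
    fun x => by simp only [h.periodic x, h.periodic_deriv x, hper' x]
  have e := hper.intervalIntegral_add_eq 0 q
  rw [zero_add] at e
  rw [e]
  have := integral_abs_deriv_le (N := 1) hfd hcont hqq'.le hq'.2.le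
    (fun x => by
      rw [abs_div, abs_of_pos (hS x), div_le_one (hS x)]
      exact h.abs_bracket_tangent_le hs x q)
    (fun x hx => mul_nonneg (h.bracket_pos_of_antipode hs hr hq'.2.le hx).le (hpos x))
    (fun x hx => mul_nonpos_of_nonpos_of_nonneg (by
      have := h.bracket_pos_of_antipode hs (q := q') (q' := q + 2 * Real.pi)
        (by rw [h.periodic q, hr, neg_neg]) (by linarith) hx
      rw [hr, bracket_neg_left] at this
      linarith) (hpos x))
  linarith

/-- A weak form of the Blaschke-Santaló inequality: the area of an origin-symmetric convex curve
times the area of its polar curve is bounded. -/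
theorem integral_mul_integral_le (h : IsStrictlyConvexCurve γ) (hs : IsOriginSymmetric γ) :
    (∫ x in (0 : ℝ)..(2 * Real.pi), bracket (γ x) (deriv γ x)) *
      (∫ x in (0 : ℝ)..(2 * Real.pi),
        bracket (deriv γ x) (deriv (deriv γ) x) / bracket (γ x) (deriv γ x) ^ 2) ≤ 64 := by
  have hπ := Real.two_pi_pos
  obtain ⟨p, q, hmax⟩ := h.exists_forall_bracket_le
  set N := bracket (γ p) (γ q) with hN
  have hS := h.bracket_pos hs
  have habs : ∀ x y, |bracket (γ x) (γ y)| ≤ N := fun x y => by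
    obtain ⟨z, hz⟩ := hs y
    have h1 := hmax x z
    rw [hz, bracket_neg_right] at h1
    exact abs_le.2 ⟨by linarith, hmax x y⟩
  -- At the maximal pair each tangent is parallel to the other position vector, so both coordinates
  -- are taken along tangent directions.
  have hp : bracket (deriv γ p) (γ q) = 0 :=
    IsLocalMax.hasDerivAt_eq_zero (f := fun x => bracket (γ x) (γ q))
      (Filter.Eventually.of_forall fun x => hmax x q)
      (hasDerivAt_bracket_left _ (h.hasDerivAt p))
  have hq : bracket (γ p) (deriv γ q) = 0 :=
    IsLocalMax.hasDerivAt_eq_zero (f := fun x => bracket (γ p) (γ x))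
      (Filter.Eventually.of_forall fun x => hmax p x)
      (hasDerivAt_bracket_right _ (h.hasDerivAt q))
  have hNpos : 0 < N := by
    refine lt_of_le_of_ne (le_trans (abs_nonneg _) (habs 0 0)) fun h0 => ?_
    have : bracket (γ p) (deriv γ p) = 0 := by
      have h1 := hasDerivAt_bracket_right (γ p) (h.hasDerivAt p)
      have h2 : (fun y => bracket (γ p) (γ y)) = fun _ => 0 := funext fun y => by
        have := habs p y
        rw [← h0] at this
        exact abs_nonpos_iff.1 this
      rw [h2] at h1
      exact h1.unique (hasDerivAt_const p 0)
    exact (hS p).ne' this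
  have cγ := h.smooth.continuous
  have cγ' := h.continuous_deriv
  set w : ℝ → ℝ := fun x =>
    bracket (deriv γ x) (deriv (deriv γ) x) / bracket (γ x) (deriv γ x) ^ 2 with hw
  have cS : Continuous fun x => bracket (γ x) (deriv γ x) := continuous_bracket cγ cγ'
  have cw : Continuous w := (continuous_bracket cγ' h.continuous_deriv_deriv).div (cS.pow 2)
    fun x => pow_ne_zero 2 (hS x).ne'
  have hwpos : ∀ x, 0 ≤ w x := fun x => div_nonneg (h.convex x).le (sq_nonneg _)
  -- Expand `N [γ, γ_x]` by the Plücker relation and bound the brackets of positions by `N`; the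
  -- remaining factors integrate to at most `4 N` each.
  have a1 : ∫ x in (0 : ℝ)..(2 * Real.pi), bracket (γ x) (deriv γ x) ≤ 8 * N := by
    have c1 : Continuous fun x => |bracket (γ q) (deriv γ x)| :=
      (continuous_bracket continuous_const cγ').abs
    have c2 : Continuous fun x => |bracket (γ p) (deriv γ x)| :=
      (continuous_bracket continuous_const cγ').abs
    calc ∫ x in (0 : ℝ)..(2 * Real.pi), bracket (γ x) (deriv γ x)
        ≤ ∫ x in (0 : ℝ)..(2 * Real.pi),
          (|bracket (γ q) (deriv γ x)| + |bracket (γ p) (deriv γ x)|) := by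
          refine intervalIntegral.integral_mono_on hπ.le (cS.intervalIntegrable _ _)
            ((c1.add c2).intervalIntegrable _ _) fun x _ => ?_
          have key := bracket_plucker (γ p) (γ q) (γ x) (deriv γ x)
          rw [bracket_swap (deriv γ x) (γ q)] at key
          have b1 := habs x q
          have b2 := habs p x
          have t1 : |bracket (γ x) (γ q) * bracket (γ p) (deriv γ x)|
              ≤ N * |bracket (γ p) (deriv γ x)| := by rw [abs_mul]; gcongr
          have t2 : |bracket (γ p) (γ x) * bracket (γ q) (deriv γ x)|
              ≤ N * |bracket (γ q) (deriv γ x)| := by rw [abs_mul]; gcongr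
          have t1' := (abs_le.1 t1).2
          have t2' := (abs_le.1 t2).2
          refine le_of_mul_le_mul_left ?_ hNpos
          rw [hN] at *
          linarith
      _ = _ := intervalIntegral.integral_add (c1.intervalIntegrable _ _) (c2.intervalIntegrable _ _)
      _ ≤ 4 * N + 4 * N := add_le_add
          (h.integral_abs_bracket_deriv_le hp fun x => habs q x)
          (h.integral_abs_bracket_deriv_le (by rw [bracket_swap, hq, neg_zero]) fun x => habs p x)
      _ = 8 * N := by ring
  -- In the same relation the brackets with `γ_x` are now bounded by `[γ, γ_x]`, leaving coordinates
  -- whose weighted integrals are at most 4.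
  have a2 : N * ∫ x in (0 : ℝ)..(2 * Real.pi), w x ≤ 8 := by
    have c1 : Continuous fun x => |bracket (γ q) (γ x) * w x| :=
      ((continuous_bracket continuous_const cγ).mul cw).abs
    have c2 : Continuous fun x => |bracket (γ p) (γ x) * w x| :=
      ((continuous_bracket continuous_const cγ).mul cw).abs
    rw [← intervalIntegral.integral_const_mul]
    calc ∫ x in (0 : ℝ)..(2 * Real.pi), N * w x
        ≤ ∫ x in (0 : ℝ)..(2 * Real.pi),
          (|bracket (γ q) (γ x) * w x| + |bracket (γ p) (γ x) * w x|) := by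
          refine intervalIntegral.integral_mono_on hπ.le
            ((continuous_const.mul cw).intervalIntegrable _ _)
            ((c1.add c2).intervalIntegrable _ _) fun x _ => ?_
          rw [abs_mul, abs_mul, abs_of_nonneg (hwpos x), ← add_mul]
          refine mul_le_mul_of_nonneg_right ?_ (hwpos x)
          have key := bracket_plucker (γ p) (γ q) (γ x) (deriv γ x)
          have b1 := h.abs_bracket_tangent_le hs x q
          have b2 := h.abs_bracket_tangent_le hs x p
          have t1 : |bracket (γ x) (γ q) * bracket (γ p) (deriv γ x)|
              ≤ |bracket (γ q) (γ x)| * bracket (γ x) (deriv γ x) := by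
            rw [abs_mul, bracket_swap (γ x), abs_neg, bracket_swap (γ p), abs_neg]; gcongr
          have t2 : |bracket (γ p) (γ x) * bracket (deriv γ x) (γ q)|
              ≤ |bracket (γ p) (γ x)| * bracket (γ x) (deriv γ x) := by rw [abs_mul]; gcongr
          have t1' := (abs_le.1 t1).2
          have t2' := (abs_le.1 t2).1
          refine le_of_mul_le_mul_right ?_ (hS x)
          rw [hN] at *
          linarith
      _ = _ := intervalIntegral.integral_add (c1.intervalIntegrable _ _) (c2.intervalIntegrable _ _)
      _ ≤ 4 + 4 := add_le_add (h.integral_abs_bracket_mul_le hs q)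
          (h.integral_abs_bracket_mul_le hs p)
      _ = 8 := by norm_num
  have hwI : 0 ≤ ∫ x in (0 : ℝ)..(2 * Real.pi), w x :=
    intervalIntegral.integral_nonneg hπ.le fun x _ => hwpos x
  calc _ ≤ 8 * N * ∫ x in (0 : ℝ)..(2 * Real.pi), w x := by gcongr
    _ = 8 * (N * ∫ x in (0 : ℝ)..(2 * Real.pi), w x) := by ring
    _ ≤ 8 * 8 := by gcongr
    _ = 64 := by norm_num

end IsStrictlyConvexCurve

/-! ### Realisation of the arc-length calculus -/

namespace SmoothPeriodic

lemma differentiable (f : SmoothPeriodic) : Differentiable ℝ f.1 :=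
  f.2.1.differentiable (by simp)

lemma periodic_deriv (f : SmoothPeriodic) : Function.Periodic (deriv f.1) (2 * Real.pi) := by
  intro x
  rw [← deriv_comp_add_const]
  congr 1
  exact funext f.2.2

lemma continuous_deriv (f : SmoothPeriodic) : Continuous (deriv f.1) :=
  (contDiff_infty_iff_deriv.1 f.2.1).2.continuous

/-- The derivation `g⁻¹ d/dx`. -/
def arcDerivation (g : SmoothPeriodic) (hg : ∀ x, 0 < g x) :
    Derivation ℝ SmoothPeriodic SmoothPeriodic :=
  Derivation.mk'
    { toFun := fun f => ⟨fun x => (g x)⁻¹ * deriv f.1 x,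
        (g.2.1.inv fun x => (hg x).ne').mul (contDiff_infty_iff_deriv.1 f.2.1).2, fun x => by
          simp only [periodic_deriv f x, g.2.2 x]⟩
      map_add' := fun f k => by
        ext x
        change (g x)⁻¹ * deriv (f.1 + k.1) x = (g x)⁻¹ * deriv f.1 x + (g x)⁻¹ * deriv k.1 x
        rw [deriv_add (differentiable f x) (differentiable k x)]; ring
      map_smul' := fun c f => by
        ext x
        change (g x)⁻¹ * deriv (c • f.1) x = c * ((g x)⁻¹ * deriv f.1 x)
        rw [deriv_const_smul _ (differentiable f x), smul_eq_mul]; ring }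
    fun f k => by
      ext x
      change (g x)⁻¹ * deriv (f.1 * k.1) x =
        f x * ((g x)⁻¹ * deriv k.1 x) + k x * ((g x)⁻¹ * deriv f.1 x)
      rw [deriv_mul (differentiable f x) (differentiable k x)]; ring

/-- Integration over a period with respect to `g dx`. -/
def arcFunctional (g : SmoothPeriodic) : SmoothPeriodic →ₗ[ℝ] ℝ where
  toFun f := ∫ x in (0 : ℝ)..(2 * Real.pi), f x * g x
  map_add' f k := by
    have := intervalIntegral.integral_add (μ := MeasureTheory.volume) (a := 0)
      (b := 2 * Real.pi) ((f.2.1.continuous.mul g.2.1.continuous).intervalIntegrable _ _)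
      ((k.2.1.continuous.mul g.2.1.continuous).intervalIntegrable _ _)
    simp only [add_apply, add_mul]
    exact this
  map_smul' c f := by
    rw [RingHom.id_apply, smul_eq_mul, ← intervalIntegral.integral_const_mul]
    simp only [smul_apply, mul_assoc]

lemma arcDerivation_apply (g : SmoothPeriodic) (hg : ∀ x, 0 < g x) (f : SmoothPeriodic) (x : ℝ) :
    (arcDerivation g hg f) x = (g x)⁻¹ * deriv f.1 x := rfl

lemma arcFunctional_apply (g f : SmoothPeriodic) :
    arcFunctional g f = ∫ x in (0 : ℝ)..(2 * Real.pi), f x * g x := rfl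

lemma arcCalculus (g : SmoothPeriodic) (hg : ∀ x, 0 < g x) :
    ArcCalculus (arcDerivation g hg) (arcFunctional g) where
  integral_deriv f := by
    have h1 : ∀ x, (arcDerivation g hg f) x * g x = deriv f.1 x := fun x => by
      rw [arcDerivation_apply, mul_right_comm, inv_mul_cancel₀ (hg x).ne', one_mul]
    rw [arcFunctional_apply]
    simp only [h1]
    rw [intervalIntegral.integral_deriv_eq_sub (fun x _ => differentiable f x)
      ((continuous_deriv f).intervalIntegrable _ _)]
    have := f.2.2 0
    rw [zero_add] at this
    rw [this, sub_self]
  integral_nonneg f hf := intervalIntegral.integral_nonneg Real.two_pi_pos.le fun x _ =>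
    mul_nonneg (hf x) (hg x).le
  exists_zero f := by
    obtain ⟨x, hx⟩ := exists_forall_le f
    refine ⟨x, ?_⟩
    have : IsLocalMax f.1 x := Filter.Eventually.of_forall hx
    rw [arcDerivation_apply, this.deriv_eq_zero, mul_zero]
  abs_sub_le f k hk x y := by
    -- By periodicity `x` may be taken in the period starting at `y`, where the integral up to `x`
    -- is at most the full one.
    obtain ⟨z, hz, hxz⟩ := f.2.2.exists_mem_Ico Real.two_pi_pos x y
    rw [hxz, arcFunctional_apply]
    have hc : Continuous fun x => k x * g x := k.2.1.continuous.mul g.2.1.continuous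
    have hle : ∀ x, |deriv f.1 x| ≤ k x * g x := fun x => by
      have := hk x
      rw [arcDerivation_apply, abs_mul, abs_of_pos (inv_pos.2 (hg x)), inv_mul_le_iff₀ (hg x)] at this
      linarith
    have hper : Function.Periodic (fun x => k x * g x) (2 * Real.pi) := fun x => by
      simp only [k.2.2 x, g.2.2 x]
    have e := hper.intervalIntegral_add_eq 0 y
    rw [zero_add] at e
    rw [e, ← intervalIntegral.integral_deriv_eq_sub (fun x _ => differentiable f x)
      ((continuous_deriv f).intervalIntegrable _ _)]
    calc |∫ x in y..z, deriv f.1 x| ≤ ∫ x in y..z, |deriv f.1 x| :=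
          intervalIntegral.abs_integral_le_integral_abs hz.1
      _ ≤ ∫ x in y..z, k x * g x := intervalIntegral.integral_mono_on hz.1
          ((continuous_deriv f).abs.intervalIntegrable _ _) (hc.intervalIntegrable _ _)
          fun x _ => hle x
      _ ≤ ∫ x in y..(y + 2 * Real.pi), k x * g x := by
          rw [← intervalIntegral.integral_add_adjacent_intervals (hc.intervalIntegrable y z)
            (hc.intervalIntegrable z (y + 2 * Real.pi))]
          have : 0 ≤ ∫ x in z..(y + 2 * Real.pi), k x * g x :=
            intervalIntegral.integral_nonneg hz.2.le fun x _ => (abs_nonneg _).trans (hle x)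
          linarith

end SmoothPeriodic

/-! ### Smooth families on `[0, T)`, one-sided at the initial time -/

section TimeDependent

variable {T : EReal}

lemma zero_mem_timeInterval (hT : 0 < T) : (0 : ℝ) ∈ timeInterval T := ⟨le_rfl, by simpa using hT⟩

lemma ordConnected_timeInterval : OrdConnected (timeInterval T) :=
  ⟨fun _ hx _ hy _ hz => ⟨hx.1.trans hz.1, (EReal.coe_le_coe_iff.2 hz.2).trans_lt hy.2⟩⟩

lemma convex_timeInterval : Convex ℝ (timeInterval T) := ordConnected_timeInterval.convex

lemma exists_pos_mem_timeInterval (hT : 0 < T) : ∃ b, 0 < b ∧ b ∈ timeInterval T := by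
  obtain ⟨b, hb0, hbT⟩ := EReal.lt_iff_exists_real_btwn.1 hT
  have : 0 < b := by exact_mod_cast hb0
  exact ⟨b, this, this.le, hbT⟩

lemma interior_timeInterval_nonempty (hT : 0 < T) : (interior (timeInterval T)).Nonempty := by
  obtain ⟨b, hb, hbT⟩ := exists_pos_mem_timeInterval hT
  refine ⟨b / 2, mem_interior_iff_mem_nhds.2 ?_⟩
  exact Filter.mem_of_superset (Icc_mem_nhds (show 0 < b / 2 by linarith) (by linarith))
    (ordConnected_timeInterval.out (zero_mem_timeInterval hT) hbT)

/-- The space-time domain `[0, T) × ℝ`. -/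
def spaceTime (T : EReal) : Set (ℝ × ℝ) := timeInterval T ×ˢ univ

lemma convex_spaceTime : Convex ℝ (spaceTime T) := convex_timeInterval.prod convex_univ

lemma interior_spaceTime_nonempty (hT : 0 < T) : (interior (spaceTime T)).Nonempty := by
  rw [spaceTime, interior_prod_eq, interior_univ]
  exact (interior_timeInterval_nonempty hT).prod univ_nonempty

lemma uniqueDiffOn_spaceTime (hT : 0 < T) : UniqueDiffOn ℝ (spaceTime T) :=
  uniqueDiffOn_convex convex_spaceTime (interior_spaceTime_nonempty hT)

lemma uniqueDiffOn_timeInterval (hT : 0 < T) : UniqueDiffOn ℝ (timeInterval T) :=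
  uniqueDiffOn_convex convex_timeInterval (interior_timeInterval_nonempty hT)

/-- Smooth time-dependent functions on `[0, T) × ℝ` which are `2π`-periodic in space. -/
structure IsSmoothFamily (T : EReal) (F : ℝ → ℝ → ℝ) : Prop where
  contDiffOn : ContDiffOn ℝ ∞ (fun p : ℝ × ℝ => F p.1 p.2) (spaceTime T)
  periodic : ∀ t ∈ timeInterval T, Function.Periodic (F t) (2 * Real.pi)

/-- The time derivative, one-sided at `t = 0`. -/
def timeDeriv (T : EReal) (F : ℝ → ℝ → ℝ) (t x : ℝ) : ℝ :=
  derivWithin (fun τ => F τ x) (timeInterval T) t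

/-- The space derivative. -/
def spaceDeriv (F : ℝ → ℝ → ℝ) (t x : ℝ) : ℝ := deriv (F t) x

namespace IsSmoothFamily

variable {F K : ℝ → ℝ → ℝ}

lemma hasFDerivWithinAt (hF : IsSmoothFamily T F) {t : ℝ} (ht : t ∈ timeInterval T) (x : ℝ) :
    HasFDerivWithinAt (fun p : ℝ × ℝ => F p.1 p.2)
      (fderivWithin ℝ (fun p : ℝ × ℝ => F p.1 p.2) (spaceTime T) (t, x)) (spaceTime T) (t, x) :=
  ((hF.contDiffOn.differentiableOn (by simp)) (t, x) ⟨ht, mem_univ _⟩).hasFDerivWithinAt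

lemma hasDerivAt_fderiv (hF : IsSmoothFamily T F) {t : ℝ} (ht : t ∈ timeInterval T) (x : ℝ) :
    HasDerivAt (F t)
      (fderivWithin ℝ (fun p : ℝ × ℝ => F p.1 p.2) (spaceTime T) (t, x) (0, 1)) x := by
  have h1 : HasDerivWithinAt (fun y : ℝ => ((t, y) : ℝ × ℝ)) (0, 1) univ x :=
    ((hasDerivAt_const x t).prodMk (hasDerivAt_id x)).hasDerivWithinAt
  have hm : MapsTo (fun y : ℝ => ((t, y) : ℝ × ℝ)) univ (spaceTime T) :=
    fun y _ => ⟨ht, mem_univ y⟩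
  have := (hF.hasFDerivWithinAt ht x).comp_hasDerivWithinAt x h1 hm
  exact hasDerivWithinAt_univ.1 this

lemma hasDerivWithinAt_fderiv (hF : IsSmoothFamily T F) {t : ℝ} (ht : t ∈ timeInterval T) (x : ℝ) :
    HasDerivWithinAt (fun τ => F τ x)
      (fderivWithin ℝ (fun p : ℝ × ℝ => F p.1 p.2) (spaceTime T) (t, x) (1, 0))
      (timeInterval T) t := by
  have h1 : HasDerivWithinAt (fun τ : ℝ => ((τ, x) : ℝ × ℝ)) (1, 0) (timeInterval T) t :=
    ((hasDerivAt_id t).prodMk (hasDerivAt_const t x)).hasDerivWithinAt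
  have hm : MapsTo (fun τ : ℝ => ((τ, x) : ℝ × ℝ)) (timeInterval T) (spaceTime T) :=
    fun τ hτ => ⟨hτ, mem_univ x⟩
  exact (hF.hasFDerivWithinAt ht x).comp_hasDerivWithinAt t h1 hm

lemma spaceDeriv_eq (hF : IsSmoothFamily T F) {t : ℝ} (ht : t ∈ timeInterval T) (x : ℝ) :
    spaceDeriv F t x = fderivWithin ℝ (fun p : ℝ × ℝ => F p.1 p.2) (spaceTime T) (t, x) (0, 1) :=
  (hF.hasDerivAt_fderiv ht x).deriv

lemma timeDeriv_eq (hF : IsSmoothFamily T F) (hT : 0 < T) {t : ℝ} (ht : t ∈ timeInterval T)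
    (x : ℝ) :
    timeDeriv T F t x = fderivWithin ℝ (fun p : ℝ × ℝ => F p.1 p.2) (spaceTime T) (t, x) (1, 0) :=
  (hF.hasDerivWithinAt_fderiv ht x).derivWithin (uniqueDiffOn_timeInterval hT t ht)

lemma hasDerivAt (hF : IsSmoothFamily T F) {t : ℝ} (ht : t ∈ timeInterval T) (x : ℝ) :
    HasDerivAt (F t) (spaceDeriv F t x) x := by
  rw [hF.spaceDeriv_eq ht]; exact hF.hasDerivAt_fderiv ht x

lemma hasDerivWithinAt (hF : IsSmoothFamily T F) (hT : 0 < T) {t : ℝ} (ht : t ∈ timeInterval T)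
    (x : ℝ) : HasDerivWithinAt (fun τ => F τ x) (timeDeriv T F t x) (timeInterval T) t := by
  rw [hF.timeDeriv_eq hT ht]; exact hF.hasDerivWithinAt_fderiv ht x

lemma timeDeriv_unique (hT : 0 < T) {t x c : ℝ} (ht : t ∈ timeInterval T)
    (h : HasDerivWithinAt (fun τ => F τ x) c (timeInterval T) t) : timeDeriv T F t x = c :=
  h.derivWithin (uniqueDiffOn_timeInterval hT t ht)

lemma congr (hF : IsSmoothFamily T F) (h : ∀ t ∈ timeInterval T, ∀ x, K t x = F t x) :
    IsSmoothFamily T K where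
  contDiffOn := hF.contDiffOn.congr fun p hp => h p.1 hp.1 p.2
  periodic t ht x := by rw [h t ht, h t ht, hF.periodic t ht]

lemma contDiffOn_fderiv_apply (hF : IsSmoothFamily T F) (hT : 0 < T) (v : ℝ × ℝ) :
    ContDiffOn ℝ ∞ (fun p => fderivWithin ℝ (fun p : ℝ × ℝ => F p.1 p.2) (spaceTime T) p v)
      (spaceTime T) :=
  (hF.contDiffOn.fderivWithin (uniqueDiffOn_spaceTime hT) (m := ∞) (by simp)).clm_apply
    contDiffOn_const

lemma spaceDeriv (hF : IsSmoothFamily T F) (hT : 0 < T) : IsSmoothFamily T (spaceDeriv F) where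
  contDiffOn := (hF.contDiffOn_fderiv_apply hT (0, 1)).congr fun p hp =>
    hF.spaceDeriv_eq hp.1 p.2
  periodic t ht x := by
    unfold EquiAffine.spaceDeriv
    rw [← deriv_comp_add_const]
    congr 1
    exact funext (hF.periodic t ht)

lemma timeDeriv (hF : IsSmoothFamily T F) (hT : 0 < T) : IsSmoothFamily T (timeDeriv T F) where
  contDiffOn := (hF.contDiffOn_fderiv_apply hT (1, 0)).congr fun p hp =>
    hF.timeDeriv_eq hT hp.1 p.2
  periodic t ht x := by
    unfold EquiAffine.timeDeriv
    exact derivWithin_congr (fun τ hτ => hF.periodic τ hτ x) (hF.periodic t ht x)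

/-- Both mixed derivatives are values of the second derivative within space-time. It is symmetric
also at `t = 0`, because every point lies in the closure of the interior. -/
lemma timeDeriv_spaceDeriv (hF : IsSmoothFamily T F) (hT : 0 < T) {t : ℝ}
    (ht : t ∈ timeInterval T) (x : ℝ) :
    EquiAffine.timeDeriv T (EquiAffine.spaceDeriv F) t x =
      EquiAffine.spaceDeriv (EquiAffine.timeDeriv T F) t x := by
  have hp : (t, x) ∈ spaceTime T := ⟨ht, mem_univ x⟩
  have hu := uniqueDiffOn_spaceTime hT
  set Fh : ℝ × ℝ → ℝ := fun p => F p.1 p.2 with hFh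
  have hsymm : IsSymmSndFDerivWithinAt ℝ Fh (spaceTime T) (t, x) := by
    refine (hF.contDiffOn (t, x) hp).isSymmSndFDerivWithinAt
      (by rw [minSmoothness_of_isRCLikeNormedField]; exact WithTop.coe_le_coe.2 (le_top : (2 : ℕ∞) ≤ ⊤)) hu ?_ hp
    rw [convex_spaceTime.closure_interior_eq_closure_of_nonempty_interior
      (interior_spaceTime_nonempty hT)]
    exact subset_closure hp
  have hd : DifferentiableWithinAt ℝ (fderivWithin ℝ Fh (spaceTime T)) (spaceTime T) (t, x) :=
    ((hF.contDiffOn.fderivWithin hu (m := ∞) (by simp)).differentiableOn (by simp)) _ hp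
  have key : ∀ v w : ℝ × ℝ, fderivWithin ℝ (fun p => fderivWithin ℝ Fh (spaceTime T) p v)
      (spaceTime T) (t, x) w = fderivWithin ℝ (fderivWithin ℝ Fh (spaceTime T)) (spaceTime T)
        (t, x) w v := fun v w => by
    rw [fderivWithin_clm_apply (hu _ hp) hd (differentiableWithinAt_const v)]
    simp
  rw [(hF.spaceDeriv hT).timeDeriv_eq hT ht, (hF.timeDeriv hT).spaceDeriv_eq ht,
    fderivWithin_congr (f := fun p => fderivWithin ℝ Fh (spaceTime T) p (0, 1))
      (fun p hp => hF.spaceDeriv_eq hp.1 p.2) (hF.spaceDeriv_eq ht x),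
    fderivWithin_congr (f := fun p => fderivWithin ℝ Fh (spaceTime T) p (1, 0))
      (fun p hp => hF.timeDeriv_eq hT hp.1 p.2) (hF.timeDeriv_eq hT ht x),
    key, key]
  exact hsymm _ _

lemma mul (hF : IsSmoothFamily T F) (hK : IsSmoothFamily T K) :
    IsSmoothFamily T (fun t x => F t x * K t x) where
  contDiffOn := hF.contDiffOn.mul hK.contDiffOn
  periodic t ht x := by simp only [hF.periodic t ht x, hK.periodic t ht x]

lemma sub (hF : IsSmoothFamily T F) (hK : IsSmoothFamily T K) :
    IsSmoothFamily T (fun t x => F t x - K t x) where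
  contDiffOn := hF.contDiffOn.sub hK.contDiffOn
  periodic t ht x := by simp only [hF.periodic t ht x, hK.periodic t ht x]

lemma inv (hF : IsSmoothFamily T F) (h : ∀ t ∈ timeInterval T, ∀ x, F t x ≠ 0) :
    IsSmoothFamily T (fun t x => (F t x)⁻¹) where
  contDiffOn := hF.contDiffOn.inv fun p hp => h p.1 hp.1 p.2
  periodic t ht x := by simp only [hF.periodic t ht x]

lemma rpow (hF : IsSmoothFamily T F) (h : ∀ t ∈ timeInterval T, ∀ x, F t x ≠ 0) (c : ℝ) :
    IsSmoothFamily T (fun t x => F t x ^ c) where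
  contDiffOn := hF.contDiffOn.rpow_const_of_ne fun p hp => h p.1 hp.1 p.2
  periodic t ht x := by simp only [hF.periodic t ht x]

/-- The function at a fixed time. -/
def slice (hF : IsSmoothFamily T F) {t : ℝ} (ht : t ∈ timeInterval T) : SmoothPeriodic :=
  ⟨F t, by
    have h1 : ContDiff ℝ ∞ fun y : ℝ => ((t, y) : ℝ × ℝ) := contDiff_const.prodMk contDiff_id
    have := hF.contDiffOn.comp (s := univ) h1.contDiffOn (fun y _ => ⟨ht, mem_univ y⟩)
    exact contDiffOn_univ.1 this, hF.periodic t ht⟩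

/-- Differentiation under the integral sign. -/
lemma hasDerivWithinAt_integral (hF : IsSmoothFamily T F) (hT : 0 < T) {t : ℝ}
    (ht : t ∈ timeInterval T) (a b : ℝ) :
    HasDerivWithinAt (fun τ => ∫ x in a..b, F τ x) (∫ x in a..b, EquiAffine.timeDeriv T F t x)
      (timeInterval T) t := by
  obtain ⟨c, htc, hc⟩ : ∃ c, t < c ∧ c ∈ timeInterval T := by
    obtain ⟨c, hc, hcT⟩ := EReal.lt_iff_exists_real_btwn.1 ht.2
    have : t < c := by exact_mod_cast hc
    exact ⟨c, this, ht.1.trans this.le, hcT⟩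
  have hsub : Icc 0 c ⊆ timeInterval T :=
    ordConnected_timeInterval.out (zero_mem_timeInterval hT) hc
  -- By the mean value inequality, a bound of the time derivative on this compact set dominates the
  -- difference quotients.
  obtain ⟨M, hM⟩ := (isCompact_Icc.prod isCompact_uIcc).exists_bound_of_continuousOn
    (s := Icc 0 c ×ˢ uIcc a b) ((hF.timeDeriv hT).contDiffOn.continuousOn.mono
      (fun p hp => ⟨hsub hp.1, mem_univ _⟩))
  have hnhds : Icc 0 c ∈ nhdsWithin t (timeInterval T) := by
    filter_upwards [self_mem_nhdsWithin, mem_nhdsWithin_of_mem_nhds (Iio_mem_nhds htc)]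
      with τ h1 h2 using ⟨h1.1, h2.le⟩
  have cF : ∀ τ ∈ timeInterval T, Continuous (F τ) := fun τ hτ => (hF.slice hτ).2.1.continuous
  rw [hasDerivWithinAt_iff_tendsto_slope]
  have hle : nhdsWithin t (timeInterval T \ {t}) ≤ nhdsWithin t (timeInterval T) :=
    nhdsWithin_mono _ sdiff_subset
  have hev : ∀ᶠ τ in nhdsWithin t (timeInterval T \ {t}), τ ∈ Icc 0 c := hle hnhds
  have hlim : Filter.Tendsto (fun τ => ∫ x in a..b, slope (fun τ => F τ x) t τ)
      (nhdsWithin t (timeInterval T \ {t})) (nhds (∫ x in a..b, EquiAffine.timeDeriv T F t x)) := by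
    refine intervalIntegral.tendsto_integral_filter_of_dominated_convergence (fun _ => M) ?_ ?_
      intervalIntegrable_const ?_
    · filter_upwards [hev] with τ hτ
      simp only [slope_def_field]
      exact (((cF τ (hsub hτ)).sub (cF t ht)).div_const _).aestronglyMeasurable
    · filter_upwards [hev] with τ hτ
      refine Filter.Eventually.of_forall fun x hx => ?_
      have h1 := (convex_Icc 0 c).norm_image_sub_le_of_norm_hasDerivWithin_le
        (f := fun τ => F τ x) (C := M)
        (fun s hs => ((hF.hasDerivWithinAt hT (hsub hs) x).mono hsub))
        (fun s hs => hM (s, x) ⟨hs, uIoc_subset_uIcc hx⟩) ⟨ht.1, htc.le⟩ hτ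
      have hM0 : 0 ≤ M := (norm_nonneg _).trans (hM (t, x) ⟨⟨ht.1, htc.le⟩, uIoc_subset_uIcc hx⟩)
      rw [slope_def_field, norm_div]
      exact div_le_of_le_mul₀ (norm_nonneg _) hM0 h1
    · exact Filter.Eventually.of_forall fun x _ =>
        hasDerivWithinAt_iff_tendsto_slope.1 (hF.hasDerivWithinAt hT ht x)
  refine hlim.congr' ?_
  filter_upwards [hev] with τ hτ
  simp only [slope_def_field]
  rw [intervalIntegral.integral_div, intervalIntegral.integral_sub
    ((cF τ (hsub hτ)).intervalIntegrable _ _) ((cF t ht).intervalIntegrable _ _)]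

end IsSmoothFamily

end TimeDependent

/-! ### Evolution equations along the flow -/

/-- The affine support function in terms of the coordinates of the curve. -/
lemma deriv_deriv_support {D : Derivation ℝ SmoothPeriodic SmoothPeriodic} {X Y : SmoothPeriodic}
    (h1 : D X * D (D Y) - D Y * D (D X) = 1) :
    D (D (X * D Y - Y * D X)) = 1 - (X * D Y - Y * D X) *
      (D (D X) * D (D (D Y)) - D (D Y) * D (D (D X))) := by
  have h2 := congrArg D h1
  simp only [map_sub, map_add, Derivation.leibniz, smul_eq_mul, Derivation.map_one_eq_zero] at h2 ⊢
  linear_combination (1 - X * D (D (D Y)) + Y * D (D (D X))) * h1 +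
    (X * D (D Y) - Y * D (D X)) * h2

/-- Evolution of the length element and of the support function under the flow, in terms of the
coordinates of the curve. -/
lemma supportData_of_evolution {D : Derivation ℝ SmoothPeriodic SmoothPeriodic}
    {X Y X₁' Y₁' u v a G : SmoothPeriodic}
    (h1 : D X * D (D Y) - D Y * D (D X) = 1) (hu : u = X * D Y - Y * D X)
    (hX : X₁' = D (D (D u) * D (D X)) - a * D X) (hY : Y₁' = D (D (D u) * D (D Y)) - a * D Y)
    (hcon : X₁' * D (D Y) + D X * (D Y₁' - a * D (D Y)) -
      (Y₁' * D (D X) + D Y * (D X₁' - a * D (D X))) = 0)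
    (hG : G = D (D u) * D (D X) * D Y + X * Y₁' - (D (D u) * D (D Y) * D X + Y * X₁'))
    (hpos : ∀ x, 0 < u x) (huv : u * v = 1) : SupportData D u v a G := by
  have h2 := congrArg D h1
  have hw := deriv_deriv_support h1
  rw [← hu] at hw
  have hu1 : D u = X * D (D Y) - Y * D (D X) := by
    rw [hu]
    simp only [map_sub, Derivation.leibniz, smul_eq_mul]
    ring
  simp only [map_sub, Derivation.leibniz, smul_eq_mul, Derivation.map_one_eq_zero] at h2
  have h3 := congrArg D h2
  simp only [map_sub, map_add, map_zero, Derivation.leibniz, smul_eq_mul] at h3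
  have hw2 := congrArg D hu1
  simp only [map_sub, Derivation.leibniz, smul_eq_mul] at hw2
  generalize hwd : D (D u) = w at *
  -- `hcon` is the time derivative of `[γ_s, γ_ss] = 1`; solving it for `a` gives `3 a = σ_ssss - 2
  -- σ_ss 𝒦`.
  have key : 3 * a = D (D w) - 2 * (w * (D (D X) * D (D (D Y)) - D (D Y) * D (D (D X)))) := by
    rw [hX, hY] at hcon
    simp only [map_sub, map_add, Derivation.leibniz, smul_eq_mul] at hcon
    linear_combination -hcon + (D (D w) - 3 * a) * h1 + 2 * D w * h2 + w * h3
  -- The curvature is eliminated through `𝒦 = (1 - σ_ss) / σ`.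
  have hst : 3 * a = D (D w) + 2 * (w ^ 2 * v) - 2 * (w * v) := by
    linear_combination key - 2 * v * w * hw + 2 * w * (D (D X) * D (D (D Y)) -
      D (D Y) * D (D (D X))) * huv
  refine ⟨hpos, huv, ?_, by rw [hwd]; exact hst⟩
  rw [hwd, hG, hX, hY]
  simp only [Derivation.leibniz, smul_eq_mul]
  linear_combination -6 * w * h1 - 3 * w * hw2 - 3 * D w * hu1 + 3 * a * hu - u * hst +
    (2 * w - 2 * w ^ 2) * huv

lemma arcDeriv_coord {γ f : ℝ → Plane} {x : ℝ} (hf : DifferentiableAt ℝ f x) (i : Fin 2) :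
    arcDeriv γ f x i = (metric γ x)⁻¹ * deriv (fun y => f y i) x := by
  rw [(hasDerivAt_coord hf.hasDerivAt i).deriv]
  rfl

/-- The arc length derivative of a time-dependent function along a family of curves. -/
def arcFamily (γ : ℝ → ℝ → Plane) (F : ℝ → ℝ → ℝ) (t x : ℝ) : ℝ :=
  (metric (γ t) x)⁻¹ * spaceDeriv F t x

/-- The rate of change of the length element. -/
def stretchFamily (T : EReal) (γ : ℝ → ℝ → Plane) (t x : ℝ) : ℝ :=
  timeDeriv T (fun τ y => metric (γ τ) y) t x * (metric (γ t) x)⁻¹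

namespace IsFlow

variable {γ₀ : ℝ → Plane} {T : EReal} {γ : ℝ → ℝ → Plane} {F K : ℝ → ℝ → ℝ} {t : ℝ}

lemma coord_family (h : IsFlow γ₀ T γ) (i : Fin 2) : IsSmoothFamily T (fun τ x => γ τ x i) where
  contDiffOn := (EuclideanSpace.proj (𝕜 := ℝ) i).contDiff.comp_contDiffOn h.smooth
  periodic t ht x := by simp only [(h.strictlyConvex t ht).periodic x]

/-- In this form the metric inherits joint smoothness in time and space from the coordinates. -/
lemma metric_eq (h : IsFlow γ₀ T γ) (ht : t ∈ timeInterval T) (x : ℝ) :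
    metric (γ t) x = (spaceDeriv (fun τ x => γ τ x 0) t x *
        spaceDeriv (spaceDeriv (fun τ x => γ τ x 1)) t x -
      spaceDeriv (fun τ x => γ τ x 1) t x *
        spaceDeriv (spaceDeriv (fun τ x => γ τ x 0)) t x) ^ (1 / 3 : ℝ) := by
  have hc := h.strictlyConvex t ht
  have e : ∀ i, spaceDeriv (fun τ x => γ τ x i) t = fun x => deriv (γ t) x i := fun i =>
    funext fun x => (hasDerivAt_coord (hc.hasDerivAt x) i).deriv
  have e2 : ∀ i, spaceDeriv (spaceDeriv (fun τ x => γ τ x i)) t x = deriv (deriv (γ t)) x i :=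
    fun i => by
      rw [spaceDeriv, e]
      exact (hasDerivAt_coord (hc.hasDerivAt_deriv x) i).deriv
  rw [e, e, e2, e2]
  rfl

lemma delta_pos (h : IsFlow γ₀ T γ) (ht : t ∈ timeInterval T) (x : ℝ) :
    0 < spaceDeriv (fun τ x => γ τ x 0) t x *
        spaceDeriv (spaceDeriv (fun τ x => γ τ x 1)) t x -
      spaceDeriv (fun τ x => γ τ x 1) t x *
        spaceDeriv (spaceDeriv (fun τ x => γ τ x 0)) t x := by
  have hc := h.strictlyConvex t ht
  have e : ∀ i, spaceDeriv (fun τ x => γ τ x i) t = fun x => deriv (γ t) x i := fun i =>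
    funext fun x => (hasDerivAt_coord (hc.hasDerivAt x) i).deriv
  have e2 : ∀ i, spaceDeriv (spaceDeriv (fun τ x => γ τ x i)) t x = deriv (deriv (γ t)) x i :=
    fun i => by
      rw [spaceDeriv, e]
      exact (hasDerivAt_coord (hc.hasDerivAt_deriv x) i).deriv
  rw [e, e, e2, e2]
  exact hc.convex x

lemma metric_pos (h : IsFlow γ₀ T γ) (ht : t ∈ timeInterval T) (x : ℝ) : 0 < metric (γ t) x := by
  rw [h.metric_eq ht]
  exact Real.rpow_pos_of_pos (h.delta_pos ht x) _

lemma metric_family (h : IsFlow γ₀ T γ) (hT : 0 < T) :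
    IsSmoothFamily T (fun τ x => metric (γ τ) x) := by
  have h0 := h.coord_family 0
  have h1 := h.coord_family 1
  refine ((((h0.spaceDeriv hT).mul ((h1.spaceDeriv hT).spaceDeriv hT)).sub
    ((h1.spaceDeriv hT).mul ((h0.spaceDeriv hT).spaceDeriv hT))).rpow
    (fun t ht x => (h.delta_pos ht x).ne') (1 / 3)).congr fun t ht x => h.metric_eq ht x

lemma arcFamily (h : IsFlow γ₀ T γ) (hT : 0 < T) (hF : IsSmoothFamily T F) :
    IsSmoothFamily T (arcFamily γ F) :=
  ((h.metric_family hT).inv fun _ ht x => (h.metric_pos ht x).ne').mul (hF.spaceDeriv hT)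

lemma stretchFamily (h : IsFlow γ₀ T γ) (hT : 0 < T) : IsSmoothFamily T (stretchFamily T γ) :=
  ((h.metric_family hT).timeDeriv hT).mul
    ((h.metric_family hT).inv fun _ ht x => (h.metric_pos ht x).ne')

/-- The arc length derivation of the curve at a fixed time. -/
def arcD (h : IsFlow γ₀ T γ) (hT : 0 < T) (ht : t ∈ timeInterval T) :
    Derivation ℝ SmoothPeriodic SmoothPeriodic :=
  SmoothPeriodic.arcDerivation ((h.metric_family hT).slice ht) (h.metric_pos ht)

/-- Integration along the curve at a fixed time. -/
def arcI (h : IsFlow γ₀ T γ) (hT : 0 < T) (ht : t ∈ timeInterval T) : SmoothPeriodic →ₗ[ℝ] ℝ :=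
  SmoothPeriodic.arcFunctional ((h.metric_family hT).slice ht)

lemma calculus (h : IsFlow γ₀ T γ) (hT : 0 < T) (ht : t ∈ timeInterval T) :
    ArcCalculus (h.arcD hT ht) (h.arcI hT ht) :=
  SmoothPeriodic.arcCalculus _ _

lemma slice_arcFamily (h : IsFlow γ₀ T γ) (hT : 0 < T) (ht : t ∈ timeInterval T)
    (hF : IsSmoothFamily T F) : (h.arcFamily hT hF).slice ht = h.arcD hT ht (hF.slice ht) := rfl

/-- The commutator of the time derivative and the arc length derivative. -/
lemma slice_timeDeriv_arcFamily (h : IsFlow γ₀ T γ) (hT : 0 < T) (ht : t ∈ timeInterval T)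
    (hF : IsSmoothFamily T F) : ((h.arcFamily hT hF).timeDeriv hT).slice ht =
      h.arcD hT ht ((hF.timeDeriv hT).slice ht) -
        (h.stretchFamily hT).slice ht * h.arcD hT ht (hF.slice ht) := by
  ext x
  have hg := h.metric_family hT
  have hgpos := h.metric_pos ht x
  have h1 := ((hg.hasDerivWithinAt hT ht x).inv hgpos.ne').mul
    ((hF.spaceDeriv hT).hasDerivWithinAt hT ht x)
  have h2 := IsSmoothFamily.timeDeriv_unique (F := EquiAffine.arcFamily γ F) hT ht h1
  change timeDeriv T (EquiAffine.arcFamily γ F) t x = (metric (γ t) x)⁻¹ *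
    spaceDeriv (timeDeriv T F) t x - EquiAffine.stretchFamily T γ t x *
      ((metric (γ t) x)⁻¹ * spaceDeriv F t x)
  rw [h2, hF.timeDeriv_spaceDeriv hT ht, EquiAffine.stretchFamily, Pi.inv_apply]
  field_simp
  ring

/-- Rate of change of an integral along the curve. -/
lemma hasDerivWithinAt_arcIntegral (h : IsFlow γ₀ T γ) (hT : 0 < T) (ht : t ∈ timeInterval T)
    (hF : IsSmoothFamily T F) : HasDerivWithinAt (fun τ => arcIntegral (γ τ) (F τ))
      (h.arcI hT ht ((hF.timeDeriv hT).slice ht + (h.stretchFamily hT).slice ht * hF.slice ht))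
      (timeInterval T) t := by
  have hg := h.metric_family hT
  refine ((hF.mul hg).hasDerivWithinAt_integral hT ht 0 (2 * Real.pi)).congr_deriv ?_
  rw [arcI, SmoothPeriodic.arcFunctional_apply]
  refine intervalIntegral.integral_congr fun x _ => ?_
  have h1 := (hF.hasDerivWithinAt hT ht x).mul (hg.hasDerivWithinAt hT ht x)
  have h2 := IsSmoothFamily.timeDeriv_unique (F := fun t x => F t x * metric (γ t) x) hT ht h1
  have hgpos := h.metric_pos ht x
  change timeDeriv T (fun t x => F t x * metric (γ t) x) t x =
    (timeDeriv T F t x + EquiAffine.stretchFamily T γ t x * F t x) * metric (γ t) x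
  rw [h2, EquiAffine.stretchFamily]
  field_simp

lemma slice_timeDeriv_mul (hT : 0 < T) (ht : t ∈ timeInterval T) (hF : IsSmoothFamily T F)
    (hK : IsSmoothFamily T K) : ((hF.mul hK).timeDeriv hT).slice ht =
      (hF.timeDeriv hT).slice ht * hK.slice ht + hF.slice ht * (hK.timeDeriv hT).slice ht := by
  ext x
  exact IsSmoothFamily.timeDeriv_unique (F := fun t x => F t x * K t x) hT ht
    ((hF.hasDerivWithinAt hT ht x).mul (hK.hasDerivWithinAt hT ht x))

lemma slice_timeDeriv_sub (hT : 0 < T) (ht : t ∈ timeInterval T) (hF : IsSmoothFamily T F)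
    (hK : IsSmoothFamily T K) : ((hF.sub hK).timeDeriv hT).slice ht =
      (hF.timeDeriv hT).slice ht - (hK.timeDeriv hT).slice ht := by
  ext x
  exact IsSmoothFamily.timeDeriv_unique (F := fun t x => F t x - K t x) hT ht
    ((hF.hasDerivWithinAt hT ht x).sub (hK.hasDerivWithinAt hT ht x))

lemma slice_timeDeriv_inv (hT : 0 < T) (ht : t ∈ timeInterval T) (hF : IsSmoothFamily T F)
    (hne : ∀ t ∈ timeInterval T, ∀ x, F t x ≠ 0) : ((hF.inv hne).timeDeriv hT).slice ht =
      -((hF.inv hne).slice ht ^ 2 * (hF.timeDeriv hT).slice ht) := by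
  ext x
  refine (IsSmoothFamily.timeDeriv_unique (F := fun t x => (F t x)⁻¹) hT ht
    ((hF.hasDerivWithinAt hT ht x).inv (hne t ht x))).trans ?_
  change _ = -((F t x)⁻¹ ^ 2 * timeDeriv T F t x)
  rw [inv_pow, neg_div, div_eq_mul_inv, mul_comm]

lemma slice_congr (ht : t ∈ timeInterval T) (hF : IsSmoothFamily T F)
    (hK : IsSmoothFamily T K) (hFK : ∀ x, F t x = K t x) : hF.slice ht = hK.slice ht :=
  Subtype.ext (funext hFK)

lemma timeDeriv_congr (ht : t ∈ timeInterval T) (hFK : ∀ t ∈ timeInterval T, ∀ x, F t x = K t x)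
    (x : ℝ) : timeDeriv T F t x = timeDeriv T K t x :=
  derivWithin_congr (fun τ hτ => hFK τ hτ x) (hFK t ht x)

/-- The tangent and normal vectors and their derivatives in coordinates. -/
lemma frame_coord (h : IsFlow γ₀ T γ) (hT : 0 < T) (ht : t ∈ timeInterval T) (i : Fin 2) (x : ℝ) :
    tangent (γ t) x i = h.arcD hT ht ((h.coord_family i).slice ht) x ∧
    normal (γ t) x i = h.arcD hT ht (h.arcD hT ht ((h.coord_family i).slice ht)) x ∧
    arcDeriv (γ t) (normal (γ t)) x i =
      h.arcD hT ht (h.arcD hT ht (h.arcD hT ht ((h.coord_family i).slice ht))) x := by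
  have hc := h.strictlyConvex t ht
  have step : ∀ (f : ℝ → Plane) (k : Fin 2 → SmoothPeriodic), (∀ i x, f x i = k i x) →
      ∀ i x, arcDeriv (γ t) f x i = h.arcD hT ht (k i) x := by
    intro f k hfk i x
    have hd : Differentiable ℝ f := by
      rw [differentiable_euclidean]
      intro i
      rw [show (fun y => f y i) = (k i).1 from funext (hfk i)]
      exact SmoothPeriodic.differentiable (k i)
    rw [arcDeriv_coord (hd x), show (fun y => f y i) = (k i).1 from funext (hfk i)]
    rfl
  have s1 := step (γ t) (fun i => (h.coord_family i).slice ht) (fun i x => rfl)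
  have s2 := step (tangent (γ t)) _ s1
  have s3 := step (normal (γ t)) _ s2
  exact ⟨s1 i x, s2 i x, s3 i x⟩

/-- The equi-affine frame has determinant one. -/
lemma frame_det (h : IsFlow γ₀ T γ) (hT : 0 < T) (ht : t ∈ timeInterval T) :
    h.arcD hT ht ((h.coord_family 0).slice ht) *
        h.arcD hT ht (h.arcD hT ht ((h.coord_family 1).slice ht)) -
      h.arcD hT ht ((h.coord_family 1).slice ht) *
        h.arcD hT ht (h.arcD hT ht ((h.coord_family 0).slice ht)) = 1 := by
  ext x
  have hg := (h.metric_family hT).inv fun _ ht x => (h.metric_pos ht x).ne'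
  have hgpos := h.metric_pos ht x
  have e2 : ∀ i, (h.arcD hT ht (h.arcD hT ht ((h.coord_family i).slice ht))) x =
      (metric (γ t) x)⁻¹ * (spaceDeriv (fun τ y => (metric (γ τ) y)⁻¹) t x *
        spaceDeriv (fun τ y => γ τ y i) t x +
        (metric (γ t) x)⁻¹ * spaceDeriv (spaceDeriv (fun τ y => γ τ y i)) t x) := fun i => by
    have := (hg.hasDerivAt ht x).mul (((h.coord_family i).spaceDeriv hT).hasDerivAt ht x)
    exact congrArg ((metric (γ t) x)⁻¹ * ·) this.deriv
  have e1 : ∀ i, (h.arcD hT ht ((h.coord_family i).slice ht)) x =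
      (metric (γ t) x)⁻¹ * spaceDeriv (fun τ y => γ τ y i) t x := fun i => rfl
  have hcube : metric (γ t) x ^ 3 = spaceDeriv (fun τ x => γ τ x 0) t x *
        spaceDeriv (spaceDeriv (fun τ x => γ τ x 1)) t x -
      spaceDeriv (fun τ x => γ τ x 1) t x *
        spaceDeriv (spaceDeriv (fun τ x => γ τ x 0)) t x := by
    rw [h.metric_eq ht, ← Real.rpow_natCast, ← Real.rpow_mul (h.delta_pos ht x).le]
    norm_num
  simp only [SmoothPeriodic.sub_apply, SmoothPeriodic.mul_apply, e1, e2,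
    SmoothPeriodic.one_apply]
  have h3 : (metric (γ t) x)⁻¹ ^ 3 * metric (γ t) x ^ 3 = 1 := by
    rw [← mul_pow, inv_mul_cancel₀ hgpos.ne', one_pow]
  rw [hcube] at h3
  linear_combination h3

/-- The support function in terms of coordinates. -/
lemma support_eq (h : IsFlow γ₀ T γ) (hT : 0 < T) (ht : t ∈ timeInterval T) (x : ℝ) :
    support (γ t) x = γ t x 0 * EquiAffine.arcFamily γ (fun τ y => γ τ y 1) t x -
      γ t x 1 * EquiAffine.arcFamily γ (fun τ y => γ τ y 0) t x := by
  rw [support, bracket, (h.frame_coord hT ht 0 x).1, (h.frame_coord hT ht 1 x).1]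
  rfl

lemma support_pos (h : IsFlow γ₀ T γ) (ht : t ∈ timeInterval T) (x : ℝ) :
    0 < support (γ t) x := by
  have h1 : support (γ t) x = (metric (γ t) x)⁻¹ * bracket (γ t x) (deriv (γ t) x) := by
    simp only [support, tangent, arcDeriv, bracket, PiLp.smul_apply, smul_eq_mul]
    ring
  rw [h1]
  exact mul_pos (inv_pos.2 (h.metric_pos ht x))
    ((h.strictlyConvex t ht).bracket_pos (h.symmetric t ht) x)

lemma support_family (h : IsFlow γ₀ T γ) (hT : 0 < T) :
    IsSmoothFamily T (fun τ x => support (γ τ) x) :=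
  (((h.coord_family 0).mul (h.arcFamily hT (h.coord_family 1))).sub
    ((h.coord_family 1).mul (h.arcFamily hT (h.coord_family 0)))).congr
    fun _ ht x => h.support_eq hT ht x

lemma supportInv_family (h : IsFlow γ₀ T γ) (hT : 0 < T) :
    IsSmoothFamily T (fun τ x => (support (γ τ) x)⁻¹) :=
  (h.support_family hT).inv fun _ ht x => (h.support_pos ht x).ne'

lemma slice_support (h : IsFlow γ₀ T γ) (hT : 0 < T) (ht : t ∈ timeInterval T) :
    (h.support_family hT).slice ht =
      (h.coord_family 0).slice ht * h.arcD hT ht ((h.coord_family 1).slice ht) -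
      (h.coord_family 1).slice ht * h.arcD hT ht ((h.coord_family 0).slice ht) :=
  Subtype.ext (funext fun x => h.support_eq hT ht x)

/-- The flow in the form `γ_t = σ_ss γ_ss`, by `σ_ss = 1 - σ𝒦`. -/
lemma slice_timeDeriv_coord (h : IsFlow γ₀ T γ) (hT : 0 < T) (ht : t ∈ timeInterval T)
    (i : Fin 2) : ((h.coord_family i).timeDeriv hT).slice ht =
      h.arcD hT ht (h.arcD hT ht ((h.support_family hT).slice ht)) *
        h.arcD hT ht (h.arcD hT ht ((h.coord_family i).slice ht)) := by
  ext x
  have h1 := (EuclideanSpace.proj (𝕜 := ℝ) i).hasFDerivAt.comp_hasDerivWithinAt t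
    (h.evolution t ht x)
  have h2 := IsSmoothFamily.timeDeriv_unique (F := fun τ x => γ τ x i) hT ht h1
  refine h2.trans ?_
  have hw := deriv_deriv_support (h.frame_det hT ht)
  rw [← h.slice_support hT ht] at hw
  rw [hw]
  change (1 - support (γ t) x * curvature (γ t) x) * normal (γ t) x i = _
  rw [(h.frame_coord hT ht i x).2.1, curvature, bracket, (h.frame_coord hT ht 0 x).2.1,
    (h.frame_coord hT ht 1 x).2.1, (h.frame_coord hT ht 0 x).2.2, (h.frame_coord hT ht 1 x).2.2]
  rfl

/-- The evolution equations of the support function and of the length element. -/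
lemma supportData (h : IsFlow γ₀ T γ) (hT : 0 < T) (ht : t ∈ timeInterval T) :
    SupportData (h.arcD hT ht) ((h.support_family hT).slice ht)
      ((h.supportInv_family hT).slice ht) ((h.stretchFamily hT).slice ht)
      (((h.support_family hT).timeDeriv hT).slice ht) := by
  have h0 := h.coord_family 0
  have h1 := h.coord_family 1
  have a0 := h.arcFamily hT h0
  have a1 := h.arcFamily hT h1
  have b0 := h.arcFamily hT a0
  have b1 := h.arcFamily hT a1
  refine supportData_of_evolution (h.frame_det hT ht) (h.slice_support hT ht)
    (X₁' := (a0.timeDeriv hT).slice ht) (Y₁' := (a1.timeDeriv hT).slice ht) ?_ ?_ ?_ ?_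
    (h.support_pos ht) ?_
  · rw [h.slice_timeDeriv_arcFamily hT ht h0, h.slice_timeDeriv_coord hT ht 0]
  · rw [h.slice_timeDeriv_arcFamily hT ht h1, h.slice_timeDeriv_coord hT ht 1]
  · have hc := slice_timeDeriv_sub hT ht (a0.mul b1) (a1.mul b0)
    rw [slice_timeDeriv_mul hT ht a0 b1, slice_timeDeriv_mul hT ht a1 b0,
      h.slice_timeDeriv_arcFamily hT ht a1, h.slice_timeDeriv_arcFamily hT ht a0] at hc
    -- The frame determinant equals one at all times, so its time derivative vanishes.
    refine hc.symm.trans ?_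
    ext x
    change timeDeriv T (fun t x => EquiAffine.arcFamily γ (fun τ y => γ τ y 0) t x *
      EquiAffine.arcFamily γ (EquiAffine.arcFamily γ fun τ y => γ τ y 1) t x -
      EquiAffine.arcFamily γ (fun τ y => γ τ y 1) t x *
      EquiAffine.arcFamily γ (EquiAffine.arcFamily γ fun τ y => γ τ y 0) t x) t x = 0
    refine IsSmoothFamily.timeDeriv_unique hT ht ?_
    refine (hasDerivWithinAt_const t (timeInterval T) (1 : ℝ)).congr (fun τ hτ => ?_) ?_
    · exact congrArg (fun f : SmoothPeriodic => f x) (h.frame_det hT hτ)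
    · exact congrArg (fun f : SmoothPeriodic => f x) (h.frame_det hT ht)
  · have hc := slice_timeDeriv_sub hT ht (h0.mul a1) (h1.mul a0)
    rw [slice_timeDeriv_mul hT ht h0 a1, slice_timeDeriv_mul hT ht h1 a0,
      h.slice_timeDeriv_coord hT ht 0,
      h.slice_timeDeriv_coord hT ht 1] at hc
    refine Eq.trans ?_ hc
    ext x
    exact timeDeriv_congr ht (fun τ hτ x => h.support_eq hT hτ x) x
  · ext x
    exact mul_inv_cancel₀ (h.support_pos ht x).ne'

lemma supportDeriv_family (h : IsFlow γ₀ T γ) (hT : 0 < T) (n : ℕ) :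
    IsSmoothFamily T (fun τ x => supportDeriv (γ τ) n x) := by
  induction n with
  | zero => exact h.support_family hT
  | succ n ih =>
    refine (h.arcFamily hT ih).congr fun t ht x => ?_
    rw [supportDeriv, Function.iterate_succ_apply']
    rfl

lemma slice_supportDeriv (h : IsFlow γ₀ T γ) (hT : 0 < T) (ht : t ∈ timeInterval T) (n : ℕ) :
    (h.supportDeriv_family hT n).slice ht =
      (⇑(h.arcD hT ht))^[n] ((h.support_family hT).slice ht) := by
  induction n with
  | zero => rfl
  | succ n ih =>
    rw [Function.iterate_succ_apply', ← ih, ← h.slice_arcFamily hT ht]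
    refine slice_congr ht _ _ fun x => ?_
    rw [supportDeriv, Function.iterate_succ_apply']
    rfl

lemma slice_timeDeriv_supportDeriv (h : IsFlow γ₀ T γ) (hT : 0 < T) (ht : t ∈ timeInterval T)
    (n : ℕ) : ((h.supportDeriv_family hT n).timeDeriv hT).slice ht =
      derivSpeed (h.arcD hT ht) ((h.support_family hT).slice ht) ((h.stretchFamily hT).slice ht)
        (((h.support_family hT).timeDeriv hT).slice ht) n := by
  induction n with
  | zero => rfl
  | succ n ih =>
    rw [derivSpeed, ← ih, Function.iterate_succ_apply', ← h.slice_supportDeriv hT ht,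
      ← h.slice_timeDeriv_arcFamily hT ht]
    refine slice_congr ht _ _ fun x => timeDeriv_congr ht (fun τ hτ y => ?_) x
    rw [supportDeriv, Function.iterate_succ_apply']
    rfl

/-- The rate of change of the energies. -/
lemma hasDerivWithinAt_energy (h : IsFlow γ₀ T γ) (hT : 0 < T) (ht : t ∈ timeInterval T) (n : ℕ) :
    HasDerivWithinAt (fun τ => energy n (γ τ))
      (h.arcI hT ht (2 * (⇑(h.arcD hT ht))^[n] ((h.support_family hT).slice ht) *
        derivSpeed (h.arcD hT ht) ((h.support_family hT).slice ht)
          ((h.stretchFamily hT).slice ht) (((h.support_family hT).timeDeriv hT).slice ht) n +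
        (h.stretchFamily hT).slice ht *
          ((⇑(h.arcD hT ht))^[n] ((h.support_family hT).slice ht)) ^ 2)) (timeInterval T) t := by
  have hs := h.supportDeriv_family hT n
  have h1 := h.hasDerivWithinAt_arcIntegral hT ht (hs.mul hs)
  have h2 : (hs.mul hs).slice ht = hs.slice ht ^ 2 := by rw [sq]; rfl
  rw [slice_timeDeriv_mul hT ht hs hs, h2, h.slice_supportDeriv hT ht,
    h.slice_timeDeriv_supportDeriv hT ht] at h1
  refine (h1.congr_deriv (congrArg _ (by ring))).congr_of_eventuallyEq
    (Filter.Eventually.of_forall fun τ => ?_) ?_ <;>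
  simp only [energy, sq]

lemma arcI_energy (h : IsFlow γ₀ T γ) (hT : 0 < T) (ht : t ∈ timeInterval T) :
    h.arcI hT ht (h.arcD hT ht ((h.support_family hT).slice ht) ^ 2) = energy 1 (γ t) := rfl

end IsFlow

/-! ### A priori bounds and the energy estimate -/

/-- The area enclosed by a curve, up to a factor two. -/
def area (γ : ℝ → Plane) : ℝ := arcIntegral γ (support γ)

/-- The area enclosed by the polar dual of a curve, up to a factor two. -/
def polarArea (γ : ℝ → Plane) : ℝ := arcIntegral γ (fun x => (support γ x)⁻¹ ^ 2)

lemma le_initial_of_deriv_nonpos {T : EReal} {f : ℝ → ℝ} (hT : 0 < T)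
    (hf : ∀ t ∈ timeInterval T, ∃ d ≤ 0, HasDerivWithinAt f d (timeInterval T) t) {t : ℝ}
    (ht : t ∈ timeInterval T) : f t ≤ f 0 := by
  choose! d hd hfd using hf
  exact antitoneOn_of_hasDerivWithinAt_nonpos convex_timeInterval
    (fun τ hτ => (hfd τ hτ).continuousWithinAt)
    (fun τ hτ => (hfd τ (interior_subset hτ)).mono interior_subset)
    (fun τ hτ => hd τ (interior_subset hτ)) (zero_mem_timeInterval hT) ht ht.1

/-- The logarithm of a positive smooth periodic function. -/
def SmoothPeriodic.log (u : SmoothPeriodic) (hu : ∀ x, 0 < u x) : SmoothPeriodic :=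
  ⟨fun x => Real.log (u x), u.2.1.log fun x => (hu x).ne', fun x => by simp only [u.2.2 x]⟩

lemma SmoothPeriodic.arcDerivation_log (g u v : SmoothPeriodic) (hg : ∀ x, 0 < g x)
    (hu : ∀ x, 0 < u x) (huv : u * v = 1) :
    arcDerivation g hg (SmoothPeriodic.log u hu) = arcDerivation g hg u * v := by
  ext x
  have h1 : u x * v x = 1 := congrArg (fun f : SmoothPeriodic => f x) huv
  have h2 : deriv (SmoothPeriodic.log u hu).1 x = deriv u.1 x / u x :=
    ((differentiable u x).hasDerivAt.log (hu x).ne').deriv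
  rw [mul_apply, arcDerivation_apply, arcDerivation_apply, h2, eq_inv_of_mul_eq_one_right h1,
    div_eq_mul_inv, mul_assoc]

namespace IsFlow

variable {γ₀ : ℝ → Plane} {T : EReal} {γ : ℝ → ℝ → Plane} {t : ℝ}

lemma arcIntegral_pos (h : IsFlow γ₀ T γ) (hT : 0 < T) (ht : t ∈ timeInterval T)
    {F : ℝ → ℝ → ℝ} (hF : IsSmoothFamily T F) (hpos : ∀ x, 0 < F t x) :
    0 < arcIntegral (γ t) (F t) :=
  intervalIntegral.intervalIntegral_pos_of_pos
    (((hF.slice ht).2.1.continuous.mul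
      ((h.metric_family hT).slice ht).2.1.continuous).intervalIntegrable _ _)
    (fun x => mul_pos (hpos x) (h.metric_pos ht x)) Real.two_pi_pos

lemma area_pos (h : IsFlow γ₀ T γ) (hT : 0 < T) (ht : t ∈ timeInterval T) : 0 < area (γ t) :=
  h.arcIntegral_pos hT ht (h.support_family hT) (h.support_pos ht)

lemma supportInvSq_family (h : IsFlow γ₀ T γ) (hT : 0 < T) :
    IsSmoothFamily T (fun τ x => (support (γ τ) x)⁻¹ ^ 2) :=
  ((h.supportInv_family hT).mul (h.supportInv_family hT)).congr fun _ _ _ => sq _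

lemma slice_supportInvSq (h : IsFlow γ₀ T γ) (hT : 0 < T) (ht : t ∈ timeInterval T) :
    (h.supportInvSq_family hT).slice ht = (h.supportInv_family hT).slice ht ^ 2 := rfl

lemma polarArea_pos (h : IsFlow γ₀ T γ) (hT : 0 < T) (ht : t ∈ timeInterval T) :
    0 < polarArea (γ t) :=
  h.arcIntegral_pos hT ht (h.supportInvSq_family hT)
    fun x => pow_pos (inv_pos.2 (h.support_pos ht x)) 2

/-- The flow preserves the enclosed area. -/
lemma area_eq (h : IsFlow γ₀ T γ) (hT : 0 < T) (ht : t ∈ timeInterval T) :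
    area (γ t) = area γ₀ := by
  have hd : ∀ t ∈ timeInterval T,
      HasDerivWithinAt (fun τ => area (γ τ)) 0 (timeInterval T) t := fun t ht =>
    (h.hasDerivWithinAt_arcIntegral hT ht (h.support_family hT)).congr_deriv
      ((h.supportData hT ht).integral_area (h.calculus hT ht))
  have h1 := le_initial_of_deriv_nonpos hT (fun t ht => ⟨0, le_rfl, hd t ht⟩) ht
  have h2 := le_initial_of_deriv_nonpos (f := fun τ => -area (γ τ)) hT
    (fun t ht => ⟨-0, by simp, (hd t ht).neg⟩) ht
  rw [← h.initial]
  linarith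

lemma hasDerivWithinAt_polarArea (h : IsFlow γ₀ T γ) (hT : 0 < T) (ht : t ∈ timeInterval T) :
    HasDerivWithinAt (fun τ => polarArea (γ τ))
      (6 * h.arcI hT ht ((h.supportInv_family hT).slice ht ^ 4 *
        h.arcD hT ht ((h.support_family hT).slice ht) ^ 2)) (timeInterval T) t := by
  have hv := h.supportInv_family hT
  refine (h.hasDerivWithinAt_arcIntegral hT ht (h.supportInvSq_family hT)).congr_deriv ?_
  rw [← (h.supportData hT ht).integral_polarArea (h.calculus hT ht)]
  congr 1
  have h1 : ((h.supportInvSq_family hT).timeDeriv hT).slice ht =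
      ((hv.mul hv).timeDeriv hT).slice ht :=
    slice_congr ht _ _ fun x => timeDeriv_congr ht (fun _ _ _ => sq _) x
  have h2 := slice_timeDeriv_inv hT ht (h.support_family hT)
    fun _ ht x => (h.support_pos ht x).ne'
  have h3 := slice_timeDeriv_mul hT ht hv hv
  rw [h1, h3, h.slice_supportInvSq hT ht]
  change (hv.timeDeriv hT).slice ht = _ at h2
  rw [h2]
  ring

lemma initial_le_polarArea (h : IsFlow γ₀ T γ) (hT : 0 < T) (ht : t ∈ timeInterval T) :
    polarArea γ₀ ≤ polarArea (γ t) := by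
  have := le_initial_of_deriv_nonpos (f := fun τ => -polarArea (γ τ)) hT
    (fun t ht => ⟨_, neg_nonpos.2 (mul_nonneg (by norm_num)
      ((h.calculus hT ht).integral_nonneg _ fun x => ?_)),
      (h.hasDerivWithinAt_polarArea hT ht).neg⟩) ht
  · rw [← h.initial]
    linarith
  · exact mul_nonneg (Even.pow_nonneg (by decide) _) (sq_nonneg _)

/-- The areas of a curve and of its polar dual are inversely related. -/
lemma area_mul_polarArea_le (h : IsFlow γ₀ T γ) (ht : t ∈ timeInterval T) :
    area (γ t) * polarArea (γ t) ≤ 64 := by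
  have hc := h.strictlyConvex t ht
  refine le_of_eq_of_le ?_ (hc.integral_mul_integral_le (h.symmetric t ht))
  have hs : ∀ x, support (γ t) x = (metric (γ t) x)⁻¹ * bracket (γ t x) (deriv (γ t) x) :=
    fun x => by
      simp only [support, tangent, arcDeriv, bracket, PiLp.smul_apply, smul_eq_mul]
      ring
  have hcube : ∀ x, metric (γ t) x ^ 3 = bracket (deriv (γ t) x) (deriv (deriv (γ t)) x) :=
    fun x => by
      rw [metric, ← Real.rpow_natCast, ← Real.rpow_mul (hc.convex x).le]
      norm_num
  -- In terms of `dx`, `σ ds = [γ, γ_x] dx` and `σ⁻² ds = g³ [γ, γ_x]⁻² dx`, where `g³ = [γ_x,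
  -- γ_xx]`.
  congr 1 <;> refine intervalIntegral.integral_congr fun x _ => ?_ <;>
    have hg := h.metric_pos ht x <;> beta_reduce <;> rw [hs]
  · field_simp
  · have hb := hc.bracket_pos (h.symmetric t ht) x
    rw [← hcube]
    field_simp

lemma polarArea_le (h : IsFlow γ₀ T γ) (hT : 0 < T) (ht : t ∈ timeInterval T) :
    polarArea (γ t) ≤ 64 / area γ₀ := by
  have h1 := h.area_mul_polarArea_le ht
  have h2 := h.area_pos hT ht
  rw [h.area_eq hT ht] at h1 h2
  rw [le_div_iff₀ h2]
  linarith

lemma energy_one_nonneg (h : IsFlow γ₀ T γ) (hT : 0 < T) (ht : t ∈ timeInterval T) :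
    0 ≤ energy 1 (γ t) := by
  rw [← h.arcI_energy hT ht]
  exact (h.calculus hT ht).integral_nonneg _ fun x => sq_nonneg _

/-- A bound for the growth of the first energy. -/
lemma exists_energy_one_deriv (h : IsFlow γ₀ T γ) (hT : 0 < T) (ht : t ∈ timeInterval T) :
    ∃ d, HasDerivWithinAt (fun τ => energy 1 (γ τ)) d (timeInterval T) t ∧
      d ≤ 6 * h.arcI hT ht (h.arcD hT ht ((h.support_family hT).slice ht) ^ 2 *
        (h.supportInv_family hT).slice ht) :=
  ⟨_, h.hasDerivWithinAt_energy hT ht 1,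
    (h.supportData hT ht).integral_firstEnergy_le (h.calculus hT ht)⟩

/-- The first energy grows at most exponentially with respect to the polar area. -/
lemma energy_one_le (h : IsFlow γ₀ T γ) (hT : 0 < T) (ht : t ∈ timeInterval T) :
    energy 1 (γ t) ≤ Real.exp (Real.log (1 + energy 1 γ₀) +
      (8 * area γ₀ + 8 * area γ₀ / polarArea γ₀) * (64 / area γ₀)) := by
  have h0 := zero_mem_timeInterval hT
  have hA := h.area_pos hT h0
  have hB := h.polarArea_pos hT h0
  rw [h.initial] at hA hB
  set c := 8 * area γ₀ + 8 * area γ₀ / polarArea γ₀ with hc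
  have hc0 : 0 < c := by positivity
  -- Writing `σ⁻¹ = σ³ σ⁻⁴` and using `σ³ ≤ c (1 + E)`, the growth of `E` is at most `c (1 + E)`
  -- times that of the polar area, so this difference is nonincreasing.
  have key := le_initial_of_deriv_nonpos
    (f := fun τ => Real.log (1 + energy 1 (γ τ)) - c * polarArea (γ τ)) hT (fun t ht => by
      obtain ⟨d, hd, hdle⟩ := h.exists_energy_one_deriv hT ht
      have hE := h.energy_one_nonneg hT ht
      refine ⟨_, ?_, ((hd.const_add 1).log (by positivity)).sub
        ((h.hasDerivWithinAt_polarArea hT ht).const_mul c)⟩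
      have S := h.supportData hT ht
      have hcal := h.calculus hT ht
      set u := (h.support_family hT).slice ht
      set v := (h.supportInv_family hT).slice ht with hv
      have hIu : h.arcI hT ht u = area γ₀ := h.area_eq hT ht
      have hIv : h.arcI hT ht (v ^ 2) = polarArea (γ t) := rfl
      have hle : h.arcI hT ht (h.arcD hT ht u ^ 2 * v) ≤ c * (1 + energy 1 (γ t)) *
          h.arcI hT ht (v ^ 4 * h.arcD hT ht u ^ 2) := by
        have := hcal.integral_mono (f := h.arcD hT ht u ^ 2 * v)
          (k := (c * (1 + energy 1 (γ t))) • (v ^ 4 * h.arcD hT ht u ^ 2)) fun x => by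
            have hx := S.pow_three_le hcal x (by rw [hIv]; exact h.polarArea_pos hT ht)
            rw [hIu, hIv, h.arcI_energy hT ht] at hx
            have hx2 : u x ^ 3 ≤ c * (1 + energy 1 (γ t)) := by
              have : 8 * area γ₀ / polarArea (γ t) ≤ 8 * area γ₀ / polarArea γ₀ := by
                gcongr
                exact h.initial_le_polarArea hT ht
              have h2 : 0 ≤ 8 * area γ₀ / polarArea γ₀ * energy 1 (γ t) := by positivity
              rw [hc]
              linarith
            have hux := S.pos x
            simp only [SmoothPeriodic.mul_apply, SmoothPeriodic.smul_apply,
              SmoothPeriodic.pow_apply, S.inv_apply]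
            calc (h.arcD hT ht u) x ^ 2 * (u x)⁻¹
                = u x ^ 3 * ((u x)⁻¹ ^ 4 * (h.arcD hT ht u) x ^ 2) := by field_simp
              _ ≤ _ := by gcongr
        rwa [map_smul, smul_eq_mul] at this
      rw [sub_nonpos, div_le_iff₀ (by positivity)]
      linarith) ht
  have hE := h.energy_one_nonneg hT ht
  simp only [h.initial] at key
  have hBt := mul_le_mul_of_nonneg_left (h.polarArea_le hT ht) hc0.le
  have hcB : 0 ≤ c * polarArea γ₀ := by positivity
  have hlog : Real.log (1 + energy 1 (γ t)) ≤
      Real.log (1 + energy 1 γ₀) + c * (64 / area γ₀) := by linarith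
  have := (Real.log_le_iff_le_exp (by positivity)).1 hlog
  linarith

/-- Bounds along the flow that only depend on the initial curve. -/
lemma exists_uniform_bounds (γ₀ : ℝ → Plane) : ∃ K L M : ℝ, 0 < K ∧ 0 ≤ L ∧ 0 ≤ M ∧
    ∀ (T : EReal) (γ : ℝ → ℝ → Plane) (hT : 0 < T) (h : IsFlow γ₀ T γ) (t : ℝ)
    (ht : t ∈ timeInterval T), (∀ x, (support (γ t) x)⁻¹ ≤ K) ∧ h.arcI hT ht 1 ≤ L ∧
      energy 1 (γ t) ≤ M ^ 2 := by
  set z := Real.log (1 + energy 1 γ₀) +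
    (8 * area γ₀ + 8 * area γ₀ / polarArea γ₀) * (64 / area γ₀) with hz
  set w := Real.log (area γ₀ / (64 / area γ₀)) / 3 - (Real.exp z + 64 / area γ₀) with hw
  -- `exp z` bounds the first energy and `exp w` bounds `σ` from below, so the length is at most the
  -- area divided by `exp w`. The absolute value gives `0 ≤ L` even when `γ₀` starts no flow.
  refine ⟨(Real.exp w)⁻¹, (Real.exp w)⁻¹ * |area γ₀|, Real.exp (z / 2), by positivity,
    by positivity, by positivity, fun T γ hT h t ht => ?_⟩
  have hcal := h.calculus hT ht
  have S := h.supportData hT ht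
  have hA := h.area_pos hT ht
  rw [h.area_eq hT ht] at hA
  have hE := h.energy_one_le hT ht
  have hlow : ∀ x, Real.exp w ≤ support (γ t) x := fun x =>
    S.lower_bound hcal (SmoothPeriodic.log _ S.pos) (fun x => rfl)
      (SmoothPeriodic.arcDerivation_log _ _ _ _ _ S.mul_inv) x hA (by positivity)
      (h.area_eq hT ht).ge (h.polarArea_le hT ht) hE
  have hv : ∀ x, (support (γ t) x)⁻¹ ≤ (Real.exp w)⁻¹ := fun x =>
    inv_anti₀ (Real.exp_pos w) (hlow x)
  refine ⟨hv, ?_, ?_⟩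
  · have := hcal.integral_mono (f := 1)
      (k := (Real.exp w)⁻¹ • (h.support_family hT).slice ht) fun x => by
        rw [SmoothPeriodic.one_apply, SmoothPeriodic.smul_apply, ← div_eq_inv_mul,
          one_le_div (Real.exp_pos w)]
        exact hlow x
    rw [map_smul, smul_eq_mul] at this
    refine this.trans (mul_le_mul_of_nonneg_left ?_ (by positivity))
    exact (h.area_eq hT ht).le.trans (le_abs_self _)
  · rw [← Real.exp_nat_mul]
    refine hE.trans_eq (congrArg _ ?_)
    push_cast
    ring

/-- The energies grow at most linearly in the first energy. -/
theorem exists_energy_deriv_le (γ₀ : ℝ → Plane) {n : ℕ} (hn : 1 ≤ n) : ∃ C : ℝ, 0 ≤ C ∧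
    ∀ (T : EReal) (γ : ℝ → ℝ → Plane), 0 < T → IsFlow γ₀ T γ → ∀ t ∈ timeInterval T, ∃ d : ℝ,
      HasDerivWithinAt (fun τ => energy n (γ τ)) d (timeInterval T) t ∧
      d ≤ C * energy 1 (γ t) := by
  obtain ⟨K, L, M, hK, hL, hM, hbound⟩ := exists_uniform_bounds γ₀
  -- Moving two derivatives off `G` requires order at least two; order one follows from the
  -- first-energy inequality and the lower bound of `σ`.
  obtain rfl | ⟨m, rfl⟩ : n = 1 ∨ ∃ m, n = m + 2 := by
    rcases Nat.lt_or_ge n 2 with h | h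
    · exact Or.inl (by omega)
    · exact Or.inr ⟨n - 2, by omega⟩
  · refine ⟨6 * K, by positivity, fun T γ hT h t ht => ?_⟩
    obtain ⟨hv, -, -⟩ := hbound T γ hT h t ht
    obtain ⟨d, hd, hdle⟩ := h.exists_energy_one_deriv hT ht
    refine ⟨d, hd, hdle.trans ?_⟩
    rw [mul_assoc, ← h.arcI_energy hT ht, ← smul_eq_mul K, ← map_smul]
    refine mul_le_mul_of_nonneg_left ((h.calculus hT ht).integral_mono fun x => ?_) (by norm_num)
    rw [SmoothPeriodic.mul_apply, SmoothPeriodic.smul_apply, mul_comm]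
    exact mul_le_mul_of_nonneg_right (hv x) (sq_nonneg _)
  · obtain ⟨C, hC, hmain⟩ := exists_energyDeriv_le m K L M hK hL hM
    refine ⟨C, hC, fun T γ hT h t ht => ?_⟩
    obtain ⟨hv, hI, hE⟩ := hbound T γ hT h t ht
    exact ⟨_, h.hasDerivWithinAt_energy hT ht (m + 2),
      hmain (h.calculus hT ht) (h.supportData hT ht) hv hI hE⟩

end IsFlow

end EquiAffine

end

theorem mainTheorem5 (n : ℕ) (hn : 1 ≤ n) (γ₀ : ℝ → EquiAffine.Plane)
    (hconv : EquiAffine.IsStrictlyConvexCurve γ₀) (hsymm : EquiAffine.IsOriginSymmetric γ₀) :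
    ∃ C : ℝ, 0 < C ∧
      ∀ (T : EReal) (γ : ℝ → ℝ → EquiAffine.Plane), 0 < T → EquiAffine.IsFlow γ₀ T γ →
        ∀ t ∈ EquiAffine.timeInterval T, ∃ d : ℝ,
          HasDerivWithinAt (fun τ => EquiAffine.energy n (γ τ)) d
            (EquiAffine.timeInterval T) t ∧
          d ≤ C * (EquiAffine.energy 1 (γ t) + EquiAffine.energy 1 (γ t) ^ (2 * n + 3)) := by
  obtain ⟨C, hC, h⟩ := EquiAffine.IsFlow.exists_energy_deriv_le γ₀ hn
  -- The summand 1 makes the constant positive. The linear bound already suffices, as the power of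
  -- `E` only adds a nonnegative term.
  refine ⟨C + 1, by positivity, fun T γ hT hflow t ht => ?_⟩
  obtain ⟨d, hd, hdle⟩ := h T γ hT hflow t ht
  have hE := hflow.energy_one_nonneg hT ht
  refine ⟨d, hd, hdle.trans (mul_le_mul (by linarith) ?_ hE (by positivity))⟩
  exact le_add_of_nonneg_right (pow_nonneg hE _)
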